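/- Let $\mathbb T=\mathbb R/\mathbb Z$ and let $H:\mathbb R\times\mathbb T\times\mathbb R\to\mathbb R$, $(t,x,p)\mapsto H(t,x,p)$, be a Hamiltonian such that: $H$ is $C^2$ and $1$-periodic in $t$; $H$ is convex in $p$ with $\partial_{pp}H>0$; $\lim_{|p|\to\infty}H(t,x,p)/|p|=+\infty$ for each $(t,x)$; and the Hamiltonian flow $\dot x=\partial_pH(t,x,p)$, $\dot p=-\partial_xH(t,x,p)$ on $\mathbb T\times\mathbb R$ is complete (every trajectory is defined for all $t\in\mathbb R$). A function $y:[t_0,\infty)\times\mathbb T\to\mathbb R$ with $y(t_0,\cdot)\in L^1(\mathbb T)$ is called an entropy solution of $$\partial_t y+\partial_x\big(H(t,x,y)\big)=0 \qquad (B)$$ if (i) $y$ and $H(t,x,y(t,x))$ are locally integrable on $[t_0,\infty)\times\mathbb T$, and for all smooth compactly supported $\phi:[t_0,\infty)\times\mathbb T\to\mathbb R$ $$\int_{[t_0,\infty)\times\mathbb T}\big(y\,\partial_t\phi+H(t,x,y)\,\partial_x\phi\big)\,dt\,dx+\int_{\mathbb T}y(t_0,x)\phi(t_0,x)\,dx=0;$$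 (ii) there is a positive non-increasing function $K:(t_0,\infty)\to\mathbb R$ such that $y(t,x+\delta)-y(t,x)\le K(t)\delta$ for all $t>t_0$, $x\in\mathbb T$, $\delta>0$. For $c\in\mathbb R$, a viscosity solution on $[t_0,\infty)\times\mathbb T$ of $$\partial_tu+H(t,x,c+\partial_xu)=0\qquad (HJ_c)$$ is a continuous function $u:[t_0,\infty)\times\mathbb T\to\mathbb R$ which is a viscosity sub- and supersolution (with $C^1$ test functions) on $(t_0,\infty)\times\mathbb T$. **Proposition.** Let $t_0\in\mathbb R$, $y_0\in L^\infty(\mathbb T)$ and $c=\int_{\mathbb T}y_0$. 1. There is an entropy solution $y$ of (B) with $y(t_0,\cdot)=y_0$ almost everywhere and $$y\in L^\infty([t_0,\infty)\times\mathbb T)\cap C([t_0,\infty),L^1(\mathbb T)).$$ 2. This solution is unique: if $z$ is an entropy solution of (B) with $z(t_0,\cdot)=y_0$ almost everywhere and $z\in C([t_0,\infty),L^1(\mathbb T))$, then $z(t,\cdot)=y(t,\cdot)$ almost everywhere, for every $t\ge t_0$; if instead $z\in L^\infty([t_0,\infty)\times\mathbb T)$, then $z=y$ almost everywhere on $[t_0,\infty)\times\mathbb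 T$. 3. There is exactly one viscosity solution $u:[t_0,\infty)\times\mathbb T\to\mathbb R$ of $(HJ_c)$ with $u(t_0,x)=\int_0^x(y_0(s)-c)\,ds$, and $y=c+\partial_xu$, in the sense that for every $t\ge t_0$ the function $y(t,\cdot)-c$ is the distributional derivative of $u(t,\cdot)$ on $\mathbb T$. -/

import Mathlib

open MeasureTheory Set Filter Topology

noncomputable section

namespace BurgersCircle

/-- The derivative of a function on the circle `ℝ/ℤ`. -/
def circleDeriv (f : UnitAddCircle → ℝ) (x : UnitAddCircle) : ℝ :=
  deriv (fun s : ℝ => f (x + (s : UnitAddCircle))) 0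

/-- The standing assumptions on a Hamiltonian `H(t,x,p)` on `ℝ × 𝕋 × ℝ`. In `complete`, the
trajectories `(x(t), p(t))` in `𝕋 × ℝ` are written through a lift of `x(t)` to `ℝ`. -/
structure IsAdmissibleHamiltonian (H : ℝ → UnitAddCircle → ℝ → ℝ) : Prop where
  contDiff : ContDiff ℝ 2 (fun q : ℝ × ℝ × ℝ => H q.1 (q.2.1 : UnitAddCircle) q.2.2)
  periodic : ∀ (t : ℝ) (x : UnitAddCircle) (p : ℝ), H (t + 1) x p = H t x p
  convex : ∀ (t : ℝ) (x : UnitAddCircle), ConvexOn ℝ univ (H t x)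
  deriv2_pos : ∀ (t : ℝ) (x : UnitAddCircle) (p : ℝ), 0 < iteratedDeriv 2 (H t x) p
  superlinear : ∀ (t : ℝ) (x : UnitAddCircle),
    Tendsto (fun p : ℝ => H t x p / |p|) (cocompact ℝ) atTop
  complete : ∀ t₀ x₀ p₀ : ℝ, ∃ x p : ℝ → ℝ, x t₀ = x₀ ∧ p t₀ = p₀ ∧ ∀ t : ℝ,
    HasDerivAt x (deriv (H t (x t : UnitAddCircle)) (p t)) t ∧
    HasDerivAt p (-circleDeriv (fun z => H t z (p t)) (x t : UnitAddCircle)) t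

/-- The domain `[t₀,∞) × 𝕋`. -/
def timeSpace (t₀ : ℝ) : Set (ℝ × UnitAddCircle) := Ici t₀ ×ˢ univ

/-- Entropy solutions on `[t₀,∞) × 𝕋` of `∂ₜ y + ∂ₓ (H(t,x,y)) = 0`: the equation holds in the
sense of distributions, with the initial value `y(t₀,·)`, and the Oleinik inequalities hold. A
smooth compactly supported test function on `[t₀,∞) × 𝕋` is the restriction of one on `ℝ × 𝕋`. -/
structure IsEntropySolution (H : ℝ → UnitAddCircle → ℝ → ℝ) (t₀ : ℝ)
    (y : ℝ → UnitAddCircle → ℝ) : Prop where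
  integrable_init : Integrable (y t₀) volume
  locallyIntegrable :
    LocallyIntegrableOn (fun q : ℝ × UnitAddCircle => y q.1 q.2) (timeSpace t₀) volume
  locallyIntegrable_flux :
    LocallyIntegrableOn (fun q : ℝ × UnitAddCircle => H q.1 q.2 (y q.1 q.2)) (timeSpace t₀) volume
  weak_eq : ∀ φ : ℝ → UnitAddCircle → ℝ,
    ContDiff ℝ (⊤ : ℕ∞) (fun q : ℝ × ℝ => φ q.1 (q.2 : UnitAddCircle)) →
    HasCompactSupport (fun q : ℝ × UnitAddCircle => φ q.1 q.2) →
    (∫ q in timeSpace t₀, (y q.1 q.2 * deriv (fun t => φ t q.2) q.1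
        + H q.1 q.2 (y q.1 q.2) * circleDeriv (φ q.1) q.2))
      + ∫ x : UnitAddCircle, y t₀ x * φ t₀ x = 0
  oleinik : ∃ K : ℝ → ℝ, (∀ t, t₀ < t → 0 < K t) ∧ AntitoneOn K (Ioi t₀) ∧
    ∀ t, t₀ < t → ∀ (x : UnitAddCircle) (δ : ℝ), 0 < δ →
      y t (x + (δ : UnitAddCircle)) - y t x ≤ K t * δ

/-- `y` belongs to `L^∞([t₀,∞) × 𝕋)`. -/
def IsBoundedOn (t₀ : ℝ) (y : ℝ → UnitAddCircle → ℝ) : Prop :=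
  MemLp (fun q : ℝ × UnitAddCircle => y q.1 q.2) ⊤ (volume.restrict (timeSpace t₀))

/-- `y` belongs to `C([t₀,∞), L¹(𝕋))`. -/
def IsContinuousL1 (t₀ : ℝ) (y : ℝ → UnitAddCircle → ℝ) : Prop :=
  (∀ t, t₀ ≤ t → MemLp (y t) 1 volume) ∧
  ∀ t, t₀ ≤ t → Tendsto (fun s => eLpNorm (y s - y t) 1 volume) (𝓝[Ici t₀] t) (𝓝 0)

/-- Viscosity solutions `u ∈ C([t₀,∞) × 𝕋)` of `∂ₜ u + H(t,x,c + ∂ₓ u) = 0`. The circle variable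
is lifted to `ℝ`, so that `C¹` test functions on `ℝ × ℝ` can be used. -/
structure IsViscositySolution (H : ℝ → UnitAddCircle → ℝ → ℝ) (c t₀ : ℝ)
    (u : ℝ → UnitAddCircle → ℝ) : Prop where
  continuousOn : ContinuousOn (fun q : ℝ × UnitAddCircle => u q.1 q.2) (timeSpace t₀)
  subsolution : ∀ φ : ℝ × ℝ → ℝ, ContDiff ℝ 1 φ → ∀ t x : ℝ, t₀ < t →
    IsLocalMax (fun q : ℝ × ℝ => u q.1 (q.2 : UnitAddCircle) - φ q) (t, x) →
    deriv (fun s => φ (s, x)) t + H t (x : UnitAddCircle) (c + deriv (fun z => φ (t, z)) x) ≤ 0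
  supersolution : ∀ φ : ℝ × ℝ → ℝ, ContDiff ℝ 1 φ → ∀ t x : ℝ, t₀ < t →
    IsLocalMin (fun q : ℝ × ℝ => u q.1 (q.2 : UnitAddCircle) - φ q) (t, x) →
    0 ≤ deriv (fun s => φ (s, x)) t + H t (x : UnitAddCircle) (c + deriv (fun z => φ (t, z)) x)

/-- `g` is the derivative of `f` on the circle in the sense of distributions. -/
def IsWeakDeriv (f g : UnitAddCircle → ℝ) : Prop :=
  Integrable f volume ∧ Integrable g volume ∧
  ∀ ψ : UnitAddCircle → ℝ, ContDiff ℝ (⊤ : ℕ∞) (fun s : ℝ => ψ (s : UnitAddCircle)) →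
    ∫ x : UnitAddCircle, f x * circleDeriv ψ x = -∫ x : UnitAddCircle, g x * ψ x

end BurgersCircle

end

noncomputable section

namespace BurgersCircle

/-! The equation (B) is the space derivative of a Hamilton–Jacobi equation: if `y = c + ∂ₓu`, then
`u` solves the equation with Hamiltonian `H(t,x,c+p)`. Convexity makes `u` the value of a
minimization problem, and the Oleinik inequality for `y` is the semiconcavity of `u`.

Existence. The minimization problem is discretized in time with step `1/N` (`laxScheme`). Its
minimizing chains follow the symplectic Euler scheme exactly (`chainMomentum_succ`). Comparison with
slow competitors shows that in every unit of time some momentum is bounded a priori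
(`exists_small_momentum`), and completeness of the flow carries this bound to the neighbouring steps
(`euler_bound`). Hence all momenta are bounded independently of `N` and of time, which gives uniform
Lipschitz and semiconcavity estimates together with both halves of the dynamic programming principle
(`exists_schemeEstimates`). A limit along an ultrafilter keeps them (`exists_isLaxOleinik`). The
limit is a viscosity solution, and doubling of variables shows that it is the only one
(`IsTonelli.comparison`); only one of the two compared functions has to be Lipschitz in space, so
the uniqueness covers all continuous viscosity solutions.

At a point where `w(t,·)` is differentiable, dynamic programming gives a first order expansion
forward in time, with right time derivative `-H(t,x,y)` (`IsLaxOleinik.expansion`). Paired with a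
test function, this is the weak form of (B) (`IsEntropyPair.weak_eq`). The same expansion and
semiconcavity show that `y` is continuous in time at almost every `x`, hence continuous with values
in `L¹`.

Uniqueness. For two entropy solutions let `d` be minus the time integral of the flux difference
(`fluxPotential`). The weak equation says `∂ₓd = z₁ - z₂`, so `d` is transported: `∂ₜd + b ∂ₓd = 0`,
where `b` is the average of `∂ₚH` between `z₂` and `z₁`. Since `∂ₚH` increases in `p`, the Oleinik
inequalities bound `b(x+δ) - b(x)` above by a multiple of `δ`, so the integral of `((d - ε)⁺)²`
obeys a Grönwall inequality. The constant may blow up at `t₀`, but the excess over the level `ε`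
already vanishes at some later time `s` arbitrarily close to `t₀`, so it vanishes afterwards
whatever the constant (`ae_fluxPotential_le`). Continuity in `L¹` or boundedness serves only to make
`d` uniformly small at such times `s`. Exchanging the solutions gives `d = 0`. -/

/-! ### Tonelli Hamiltonians on the universal cover -/

/-- The partial derivative in the space variable. -/
def dX (G : ℝ → ℝ → ℝ → ℝ) (t x p : ℝ) : ℝ := deriv (fun z => G t z p) x

/-- The partial derivative in the momentum variable. -/
def dP (G : ℝ → ℝ → ℝ → ℝ) (t x p : ℝ) : ℝ := deriv (G t x) p

/-- Admissible Hamiltonians, written on `ℝ × ℝ × ℝ` as functions periodic in time and space. -/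
structure IsTonelli (G : ℝ → ℝ → ℝ → ℝ) : Prop where
  contDiff : ContDiff ℝ 2 (fun q : ℝ × ℝ × ℝ => G q.1 q.2.1 q.2.2)
  periodic_time : ∀ t x p, G (t + 1) x p = G t x p
  periodic_space : ∀ t x p, G t (x + 1) p = G t x p
  deriv2_pos : ∀ t x p, 0 < iteratedDeriv 2 (G t x) p
  superlinear : ∀ t x, Tendsto (fun p : ℝ => G t x p / |p|) (cocompact ℝ) atTop
  complete : ∀ t₀ x₀ p₀ : ℝ, ∃ x p : ℝ → ℝ, x t₀ = x₀ ∧ p t₀ = p₀ ∧ ∀ t : ℝ,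
    HasDerivAt x (dP G t (x t) (p t)) t ∧ HasDerivAt p (-dX G t (x t) (p t)) t

/-- Periodicity in the first two variables. -/
def IsBiperiodic {E : Type*} (F : ℝ → ℝ → ℝ → E) : Prop :=
  (∀ t x p, F (t + 1) x p = F t x p) ∧ ∀ t x p, F t (x + 1) p = F t x p

theorem IsBiperiodic.fract {E : Type*} {F : ℝ → ℝ → ℝ → E} (h : IsBiperiodic F) (t x p : ℝ) :
    F (Int.fract t) (Int.fract x) p = F t x p := by
  have h1 : Function.Periodic (fun s => F s (Int.fract x) p) 1 := fun s => h.1 s _ p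
  have h2 : Function.Periodic (fun s => F t s p) 1 := fun s => h.2 t s p
  have e1 := h1.sub_int_mul_eq (x := t) ⌊t⌋
  have e2 := h2.sub_int_mul_eq (x := x) ⌊x⌋
  simp only [mul_one] at e1 e2
  rw [Int.self_sub_floor] at e1 e2
  exact e1.trans e2

/-- Periodicity brings `(t, x)` into the unit square, so compactness gives a bound. The constants
that are uniform in time and space rest on this. -/
theorem IsBiperiodic.exists_norm_le {E : Type*} [NormedAddCommGroup E] {F : ℝ → ℝ → ℝ → E}
    (h : IsBiperiodic F) (hc : Continuous fun q : ℝ × ℝ × ℝ => F q.1 q.2.1 q.2.2) (P : ℝ) :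
    ∃ C, 0 < C ∧ ∀ t x p, |p| ≤ P → ‖F t x p‖ ≤ C := by
  obtain ⟨C, hC⟩ := (isCompact_Icc.prod (isCompact_Icc.prod isCompact_Icc) :
    IsCompact (Icc (0:ℝ) 1 ×ˢ (Icc (0:ℝ) 1 ×ˢ Icc (-P) P))).exists_bound_of_continuousOn
      hc.continuousOn
  refine ⟨max C 1, by positivity, fun t x p hp => ?_⟩
  rw [← h.fract]
  exact (hC (Int.fract t, Int.fract x, p) ⟨⟨Int.fract_nonneg _, (Int.fract_lt_one _).le⟩,
    ⟨Int.fract_nonneg _, (Int.fract_lt_one _).le⟩, abs_le.1 hp⟩).trans (le_max_left _ _)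

theorem IsBiperiodic.fderiv {F : ℝ → ℝ → ℝ → ℝ} (h : IsBiperiodic F) :
    IsBiperiodic (fun t x p => fderiv ℝ (fun q : ℝ × ℝ × ℝ => F q.1 q.2.1 q.2.2) (t, x, p)) := by
  constructor <;> intro t x p
  · have := fderiv_comp_add_right (𝕜 := ℝ) (f := fun q : ℝ × ℝ × ℝ => F q.1 q.2.1 q.2.2)
      (x := (t, x, p)) ((1, 0, 0) : ℝ × ℝ × ℝ)
    simp only [Prod.mk_add_mk, Prod.fst_add, Prod.snd_add, add_zero, h.1] at this
    exact this.symm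
  · have := fderiv_comp_add_right (𝕜 := ℝ) (f := fun q : ℝ × ℝ × ℝ => F q.1 q.2.1 q.2.2)
      (x := (t, x, p)) ((0, 1, 0) : ℝ × ℝ × ℝ)
    simp only [Prod.mk_add_mk, Prod.fst_add, Prod.snd_add, add_zero, h.2] at this
    exact this.symm

theorem IsBiperiodic.exists_lipschitz {F : ℝ → ℝ → ℝ → ℝ} (h : IsBiperiodic F)
    (hc : ContDiff ℝ 1 fun q : ℝ × ℝ × ℝ => F q.1 q.2.1 q.2.2) (P : ℝ) :
    ∃ C, 0 < C ∧ (∀ t x p, |p| ≤ P → |F t x p| ≤ C) ∧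
      ∀ t x p t' x' p', |p| ≤ P → |p'| ≤ P →
        |F t x p - F t' x' p'| ≤ C * (|t - t'| + |x - x'| + |p - p'|) := by
  obtain ⟨C₁, hC₁, h₁⟩ := h.exists_norm_le hc.continuous P
  obtain ⟨C₂, hC₂, h₂⟩ := h.fderiv.exists_norm_le
    (show Continuous fun q : ℝ × ℝ × ℝ => _ from hc.continuous_fderiv one_ne_zero) P
  refine ⟨C₁ + C₂, by positivity, fun t x p hp => (h₁ t x p hp).trans (by linarith), ?_⟩
  intro t x p t' x' p' hp hp'
  have hconv : Convex ℝ (univ ×ˢ (univ ×ˢ Icc (-P) P) : Set (ℝ × ℝ × ℝ)) :=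
    convex_univ.prod (convex_univ.prod (convex_Icc _ _))
  have := hconv.norm_image_sub_le_of_norm_fderiv_le
    (f := fun q : ℝ × ℝ × ℝ => F q.1 q.2.1 q.2.2) (C := C₂)
    (fun q _ => hc.differentiable one_ne_zero q)
    (fun q hq => h₂ q.1 q.2.1 q.2.2 (abs_le.2 hq.2.2))
    (x := (t', x', p')) (y := (t, x, p)) ⟨trivial, trivial, abs_le.1 hp'⟩
    ⟨trivial, trivial, abs_le.1 hp⟩
  refine (Real.norm_eq_abs _ ▸ this).trans ?_
  have hn : ‖((t, x, p) : ℝ × ℝ × ℝ) - (t', x', p')‖ ≤ |t - t'| + |x - x'| + |p - p'| := by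
    simp only [Prod.mk_sub_mk, Prod.norm_mk, Real.norm_eq_abs]
    have := abs_nonneg (t - t'); have := abs_nonneg (x - x'); have := abs_nonneg (p - p')
    refine max_le (by linarith) (max_le (by linarith) (by linarith))
  have h0 : 0 ≤ |t - t'| + |x - x'| + |p - p'| := by positivity
  calc _ ≤ C₂ * (|t - t'| + |x - x'| + |p - p'|) := by gcongr
    _ ≤ _ := by gcongr; linarith

namespace IsTonelli

variable {G : ℝ → ℝ → ℝ → ℝ}

theorem biperiodic (hG : IsTonelli G) : IsBiperiodic G := ⟨hG.periodic_time, hG.periodic_space⟩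

theorem continuous (hG : IsTonelli G) : Continuous fun q : ℝ × ℝ × ℝ => G q.1 q.2.1 q.2.2 :=
  hG.contDiff.continuous

theorem hasDerivAt_dP (hG : IsTonelli G) (t x p : ℝ) : HasDerivAt (G t x) (dP G t x p) p := by
  have h := (hG.contDiff.differentiable two_ne_zero (t, x, p)).comp p
    (f := fun p : ℝ => (t, x, p)) (by fun_prop)
  exact (DifferentiableAt.hasDerivAt h :)

theorem hasDerivAt_dX (hG : IsTonelli G) (t x p : ℝ) :
    HasDerivAt (fun z => G t z p) (dX G t x p) x := by
  have h := (hG.contDiff.differentiable two_ne_zero (t, x, p)).comp x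
    (f := fun x : ℝ => (t, x, p)) (by fun_prop)
  exact (DifferentiableAt.hasDerivAt h :)

theorem dP_eq_fderiv (hG : IsTonelli G) (t x p : ℝ) :
    dP G t x p = fderiv ℝ (fun q : ℝ × ℝ × ℝ => G q.1 q.2.1 q.2.2) (t, x, p) (0, 0, 1) := by
  have h := (hG.contDiff.differentiable two_ne_zero (t, x, p)).hasFDerivAt.comp_hasDerivAt p
    (f := fun p : ℝ => (t, x, p)) ((hasDerivAt_const p t).prodMk
      ((hasDerivAt_const p x).prodMk (hasDerivAt_id p)))
  exact (hG.hasDerivAt_dP t x p).unique h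

theorem dX_eq_fderiv (hG : IsTonelli G) (t x p : ℝ) :
    dX G t x p = fderiv ℝ (fun q : ℝ × ℝ × ℝ => G q.1 q.2.1 q.2.2) (t, x, p) (0, 1, 0) := by
  have h := (hG.contDiff.differentiable two_ne_zero (t, x, p)).hasFDerivAt.comp_hasDerivAt x
    (f := fun x : ℝ => (t, x, p)) ((hasDerivAt_const x t).prodMk
      ((hasDerivAt_id x).prodMk (hasDerivAt_const x p)))
  exact (hG.hasDerivAt_dX t x p).unique h

theorem contDiff_dP (hG : IsTonelli G) :
    ContDiff ℝ 1 fun q : ℝ × ℝ × ℝ => dP G q.1 q.2.1 q.2.2 := by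
  simp only [hG.dP_eq_fderiv]
  exact (hG.contDiff.fderiv_right (m := 1) (by norm_num)).clm_apply contDiff_const

theorem contDiff_dX (hG : IsTonelli G) :
    ContDiff ℝ 1 fun q : ℝ × ℝ × ℝ => dX G q.1 q.2.1 q.2.2 := by
  simp only [hG.dX_eq_fderiv]
  exact (hG.contDiff.fderiv_right (m := 1) (by norm_num)).clm_apply contDiff_const

theorem biperiodic_dP (hG : IsTonelli G) : IsBiperiodic (dP G) := by
  constructor <;> intro t x p <;> unfold dP <;> congr 1 <;> funext q
  exacts [hG.periodic_time t x q, hG.periodic_space t x q]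

theorem biperiodic_dX (hG : IsTonelli G) : IsBiperiodic (dX G) := by
  constructor <;> intro t x p
  · simp only [dX, hG.periodic_time]
  · simp only [hG.dX_eq_fderiv]
    exact congrArg (fun l => l (0, 1, 0)) (hG.biperiodic.fderiv.2 t x p)

theorem hasDerivAt_dPP (hG : IsTonelli G) (t x p : ℝ) :
    HasDerivAt (dP G t x) (iteratedDeriv 2 (G t x) p) p := by
  have h := (hG.contDiff_dP.differentiable one_ne_zero (t, x, p)).comp p
    (f := fun p : ℝ => (t, x, p)) (by fun_prop)
  have h2 := (DifferentiableAt.hasDerivAt h :)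
  rw [iteratedDeriv_succ, iteratedDeriv_one]
  exact h2

theorem strictMono_dP (hG : IsTonelli G) (t x : ℝ) : StrictMono (dP G t x) :=
  strictMono_of_hasDerivAt_pos (fun p => hG.hasDerivAt_dPP t x p) (fun p => hG.deriv2_pos t x p)

theorem exists_strongly_monotone (hG : IsTonelli G) (P : ℝ) :
    ∃ m, 0 < m ∧ ∀ t x p q, |p| ≤ P → |q| ≤ P →
      m * |p - q| ≤ |dP G t x p - dP G t x q| := by
  have e : ∀ t x p, iteratedDeriv 2 (G t x) p =
      fderiv ℝ (fun q : ℝ × ℝ × ℝ => dP G q.1 q.2.1 q.2.2) (t, x, p) (0, 0, 1) := by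
    intro t x p
    have h := (hG.contDiff_dP.differentiable one_ne_zero (t, x, p)).hasFDerivAt.comp_hasDerivAt p
      (f := fun p : ℝ => (t, x, p)) ((hasDerivAt_const p t).prodMk
        ((hasDerivAt_const p x).prodMk (hasDerivAt_id p)))
    exact (hG.hasDerivAt_dPP t x p).unique h
  -- An upper bound for the inverse of the second derivative is a positive lower bound for the
  -- second derivative itself.
  have hper : IsBiperiodic fun t x p => (iteratedDeriv 2 (G t x) p)⁻¹ := by
    constructor <;> intro t x p <;> simp only [e]
    · exact congrArg (fun l => (l (0, 0, 1))⁻¹) (hG.biperiodic_dP.fderiv.1 t x p)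
    · exact congrArg (fun l => (l (0, 0, 1))⁻¹) (hG.biperiodic_dP.fderiv.2 t x p)
  obtain ⟨C, hC, hb⟩ := hper.exists_norm_le (P := P) (by
    refine Continuous.inv₀ ?_ fun q => (hG.deriv2_pos _ _ _).ne'
    simp only [e]
    exact (hG.contDiff_dP.continuous_fderiv one_ne_zero).clm_apply continuous_const)
  refine ⟨C⁻¹, by positivity, fun t x p q hp hq => ?_⟩
  have key : ∀ p q, |p| ≤ P → |q| ≤ P → q < p →
      C⁻¹ * (p - q) ≤ dP G t x p - dP G t x q := by
    intro p q hp hq hqp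
    obtain ⟨r, hr, hr'⟩ := exists_hasDerivAt_eq_slope (dP G t x) _ hqp
      (fun s _ => (hG.hasDerivAt_dPP t x s).continuousAt.continuousWithinAt)
      (fun s _ => hG.hasDerivAt_dPP t x s)
    have hrP : |r| ≤ P := abs_le.2 ⟨(abs_le.1 hq).1.trans hr.1.le, hr.2.le.trans (abs_le.1 hp).2⟩
    have h1 := hb t x r hrP
    have h0 := hG.deriv2_pos t x r
    rw [Real.norm_of_nonneg (by positivity), inv_le_comm₀ h0 hC] at h1
    rw [hr', le_div_iff₀ (by linarith)] at h1
    exact h1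
  rcases lt_trichotomy p q with h | h | h
  · rw [abs_sub_comm p q, abs_sub_comm (dP G t x p), abs_of_pos (by linarith)]
    exact (key q p hq hp h).trans (le_abs_self _)
  · simp [h]
  · rw [abs_of_pos (by linarith : 0 < p - q)]
    exact (key p q hp hq h).trans (le_abs_self _)

theorem tangent_le (hG : IsTonelli G) (t x p q : ℝ) :
    G t x p + dP G t x p * (q - p) ≤ G t x q := by
  rcases lt_trichotomy p q with h | h | h
  · obtain ⟨r, hr, hr'⟩ := exists_hasDerivAt_eq_slope (G t x) (dP G t x) h
      (fun s _ => (hG.hasDerivAt_dP t x s).continuousAt.continuousWithinAt)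
      (fun s _ => hG.hasDerivAt_dP t x s)
    have := (hG.strictMono_dP t x) hr.1
    rw [eq_div_iff (by linarith)] at hr'
    nlinarith
  · simp [h]
  · obtain ⟨r, hr, hr'⟩ := exists_hasDerivAt_eq_slope (G t x) (dP G t x) h
      (fun s _ => (hG.hasDerivAt_dP t x s).continuousAt.continuousWithinAt)
      (fun s _ => hG.hasDerivAt_dP t x s)
    have := (hG.strictMono_dP t x) hr.2
    rw [eq_div_iff (by linarith)] at hr'
    nlinarith

/-- The tangent line at `±A`, evaluated at `0`, bounds the slope there from below in absolute value
by `(G(±A) - G(0)) / A`. Superlinearity makes this exceed `R`, and `A ≥ 1` absorbs `G(0)`. -/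
theorem exists_dP_gt (hG : IsTonelli G) (t x R : ℝ) :
    ∃ P, R < dP G t x P ∧ dP G t x (-P) < -R := by
  have h := hG.superlinear t x
  have h1 : ∀ᶠ p in cocompact ℝ, R + 1 + |G t x 0| ≤ G t x p / |p| := h.eventually_ge_atTop _
  rw [← Metric.cobounded_eq_cocompact, ← comap_norm_atTop, eventually_comap] at h1
  obtain ⟨A, hA⟩ := (h1.and (eventually_ge_atTop (1:ℝ))).exists
  obtain ⟨hA, hA1⟩ := hA
  have hA0 : 0 < A := by linarith
  refine ⟨A, ?_, ?_⟩
  · have a1 := hA A (by rw [Real.norm_of_nonneg]; linarith)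
    rw [abs_of_pos hA0, le_div_iff₀ hA0] at a1
    have := hG.tangent_le t x A 0
    have h0 := le_abs_self (G t x 0)
    have h00 := mul_le_mul_of_nonneg_left hA1 (abs_nonneg (G t x 0))
    by_contra hc
    push Not at hc
    have hc' := mul_le_mul_of_nonneg_right hc hA0.le
    linarith
  · have a1 := hA (-A) (by rw [norm_neg, Real.norm_of_nonneg]; linarith)
    rw [abs_neg, abs_of_pos hA0, le_div_iff₀ hA0] at a1
    have := hG.tangent_le t x (-A) 0
    have h0 := le_abs_self (G t x 0)
    have h00 := mul_le_mul_of_nonneg_left hA1 (abs_nonneg (G t x 0))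
    by_contra hc
    push Not at hc
    have hc' := mul_le_mul_of_nonneg_right hc hA0.le
    linarith

/-- Superlinearity is assumed only pointwise in `(t, x)`. It becomes uniform by compactness because
`∂ₚG` is monotone in `p`: a threshold valid near one point stays valid when `P` is enlarged. -/
theorem exists_unif_dP_ge (hG : IsTonelli G) (R : ℝ) :
    ∃ P, 0 < P ∧ ∀ t x, R ≤ dP G t x P ∧ dP G t x (-P) ≤ -R := by
  have hcont := hG.contDiff_dP.continuous
  have key : ∃ P, 0 < P ∧ ∀ q ∈ (Icc (0:ℝ) 1 ×ˢ Icc (0:ℝ) 1 : Set (ℝ × ℝ)),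
      R ≤ dP G q.1 q.2 P ∧ dP G q.1 q.2 (-P) ≤ -R := by
    refine (isCompact_Icc.prod isCompact_Icc).induction_on
      (p := fun S => ∃ P, 0 < P ∧ ∀ q ∈ S, R ≤ dP G q.1 q.2 P ∧ dP G q.1 q.2 (-P) ≤ -R)
      ⟨1, one_pos, fun q hq => hq.elim⟩ ?_ ?_ ?_
    · rintro s t hst ⟨P, hP, h⟩
      exact ⟨P, hP, fun q hq => h q (hst hq)⟩
    · rintro s t ⟨P, hP, h⟩ ⟨P', hP', h'⟩
      have mono : ∀ P P' : ℝ, P ≤ P' → ∀ q : ℝ × ℝ, R ≤ dP G q.1 q.2 P ∧ dP G q.1 q.2 (-P) ≤ -R →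
          R ≤ dP G q.1 q.2 P' ∧ dP G q.1 q.2 (-P') ≤ -R := fun P P' hPP q hq =>
        ⟨hq.1.trans ((hG.strictMono_dP _ _).monotone hPP),
          ((hG.strictMono_dP _ _).monotone (neg_le_neg hPP)).trans hq.2⟩
      refine ⟨max P P', by positivity, fun q hq => hq.elim (fun hq => ?_) (fun hq => ?_)⟩
      · exact mono _ _ (le_max_left _ _) q (h q hq)
      · exact mono _ _ (le_max_right _ _) q (h' q hq)
    · intro q _
      obtain ⟨P, h1, h2⟩ := hG.exists_dP_gt q.1 q.2 R
      refine ⟨_, mem_nhdsWithin_of_mem_nhds (inter_mem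
        ((hcont.comp (by fun_prop : Continuous fun q : ℝ × ℝ => (q.1, q.2, P))).continuousAt.eventually
          (lt_mem_nhds h1))
        ((hcont.comp (by fun_prop : Continuous fun q : ℝ × ℝ => (q.1, q.2, -P))).continuousAt.eventually
          (gt_mem_nhds h2))), max P 1, by positivity, ?_⟩
      rintro q' ⟨hq1, hq2⟩
      simp only [mem_ofPred_eq, Function.comp] at hq1 hq2
      exact ⟨hq1.le.trans ((hG.strictMono_dP _ _).monotone (le_max_left _ _)),
        ((hG.strictMono_dP _ _).monotone (neg_le_neg (le_max_left _ _))).trans hq2.le⟩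
  obtain ⟨P, hP, h⟩ := key
  refine ⟨P, hP, fun t x => ?_⟩
  rw [← hG.biperiodic_dP.fract t x P, ← hG.biperiodic_dP.fract t x (-P)]
  exact h (Int.fract t, Int.fract x) ⟨⟨Int.fract_nonneg _, (Int.fract_lt_one _).le⟩,
    ⟨Int.fract_nonneg _, (Int.fract_lt_one _).le⟩⟩

theorem exists_dP_eq (hG : IsTonelli G) (t x v : ℝ) : ∃ p, dP G t x p = v := by
  obtain ⟨P, hP, h⟩ := hG.exists_unif_dP_ge |v|
  have hc : Continuous (dP G t x) :=
    continuous_iff_continuousAt.2 fun p => (hG.hasDerivAt_dPP t x p).continuousAt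
  have := intermediate_value_Icc (by linarith : -P ≤ P) hc.continuousOn
  obtain ⟨p, -, hp⟩ := this ⟨(h t x).2.trans (neg_abs_le v), (le_abs_self v).trans (h t x).1⟩
  exact ⟨p, hp⟩

end IsTonelli

/-! ### The Legendre transform -/

open Classical in
/-- The momentum conjugate to the velocity `v`: the solution `p` of `∂ₚ G(t,x,p) = v`. -/
def momentum (G : ℝ → ℝ → ℝ → ℝ) (t x v : ℝ) : ℝ :=
  -- For a Tonelli Hamiltonian the default `0` never occurs, by `exists_dP_eq`.
  if h : ∃ p, dP G t x p = v then h.choose else 0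

/-- The Lagrangian, i.e. the Legendre transform of `G`. -/
def lagrangian (G : ℝ → ℝ → ℝ → ℝ) (t x v : ℝ) : ℝ :=
  momentum G t x v * v - G t x (momentum G t x v)

namespace IsTonelli

variable {G : ℝ → ℝ → ℝ → ℝ}

theorem dP_momentum (hG : IsTonelli G) (t x v : ℝ) : dP G t x (momentum G t x v) = v := by
  have h := hG.exists_dP_eq t x v
  rw [momentum, dif_pos h]
  exact h.choose_spec

theorem momentum_dP (hG : IsTonelli G) (t x p : ℝ) : momentum G t x (dP G t x p) = p :=
  (hG.strictMono_dP t x).injective (hG.dP_momentum _ _ _)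

theorem lagrangian_dP (hG : IsTonelli G) (t x p : ℝ) :
    lagrangian G t x (dP G t x p) = p * dP G t x p - G t x p := by
  rw [lagrangian, hG.momentum_dP]

theorem biperiodic_momentum (hG : IsTonelli G) : IsBiperiodic (momentum G) := by
  constructor <;> intro t x v <;> apply (hG.strictMono_dP t x).injective
  · rw [hG.dP_momentum, ← hG.biperiodic_dP.1, hG.dP_momentum]
  · rw [hG.dP_momentum, ← hG.biperiodic_dP.2, hG.dP_momentum]

theorem biperiodic_lagrangian (hG : IsTonelli G) : IsBiperiodic (lagrangian G) := by
  constructor <;> intro t x v <;> unfold lagrangian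
  · rw [hG.biperiodic_momentum.1, hG.periodic_time]
  · rw [hG.biperiodic_momentum.2, hG.periodic_space]

theorem fenchel (hG : IsTonelli G) (t x p v : ℝ) : p * v - G t x p ≤ lagrangian G t x v := by
  have := hG.tangent_le t x (momentum G t x v) p
  rw [hG.dP_momentum] at this
  unfold lagrangian
  linarith

theorem exists_momentum_le (hG : IsTonelli G) (V : ℝ) :
    ∃ P, 0 < P ∧ ∀ t x v, |v| ≤ V → |momentum G t x v| ≤ P := by
  obtain ⟨P, hP, h⟩ := hG.exists_unif_dP_ge V
  refine ⟨P, hP, fun t x v hv => abs_le.2 ⟨?_, ?_⟩⟩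
  · rw [← (hG.strictMono_dP t x).le_iff_le, hG.dP_momentum]
    exact (h t x).2.trans (neg_le_of_abs_le hv)
  · rw [← (hG.strictMono_dP t x).le_iff_le, hG.dP_momentum]
    exact (le_of_abs_le hv).trans (h t x).1

/-- By monotonicity of `∂ₚG`, comparing the momentum with a number `a` amounts to comparing `v` with
`∂ₚG(t,x,a)`, which is an open condition in `(t, x, v)`. -/
theorem continuous_momentum (hG : IsTonelli G) :
    Continuous fun q : ℝ × ℝ × ℝ => momentum G q.1 q.2.1 q.2.2 := by
  have hcont := hG.contDiff_dP.continuous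
  rw [continuous_iff_continuousAt]
  rintro ⟨t, x, v⟩
  refine tendsto_order.2 ⟨fun a ha => ?_, fun a ha => ?_⟩
  · have h1 : dP G t x a < v := by
      rw [← hG.dP_momentum t x v]; exact hG.strictMono_dP t x ha
    have h2 : ∀ᶠ q : ℝ × ℝ × ℝ in 𝓝 (t, x, v), dP G q.1 q.2.1 a < q.2.2 :=
      (ContinuousAt.eventually_lt (f := fun q : ℝ × ℝ × ℝ => dP G q.1 q.2.1 a)
        (hcont.comp (by fun_prop : Continuous fun q : ℝ × ℝ × ℝ => (q.1, q.2.1, a))).continuousAt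
        (by fun_prop) h1)
    filter_upwards [h2] with q hq
    rw [← (hG.strictMono_dP q.1 q.2.1).lt_iff_lt, hG.dP_momentum]
    exact hq
  · have h1 : v < dP G t x a := by
      rw [← hG.dP_momentum t x v]; exact hG.strictMono_dP t x ha
    have h2 : ∀ᶠ q : ℝ × ℝ × ℝ in 𝓝 (t, x, v), q.2.2 < dP G q.1 q.2.1 a :=
      (ContinuousAt.eventually_lt (g := fun q : ℝ × ℝ × ℝ => dP G q.1 q.2.1 a) (by fun_prop)
        (hcont.comp (by fun_prop : Continuous fun q : ℝ × ℝ × ℝ => (q.1, q.2.1, a))).continuousAt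
        h1)
    filter_upwards [h2] with q hq
    rw [← (hG.strictMono_dP q.1 q.2.1).lt_iff_lt, hG.dP_momentum]
    exact hq

theorem continuous_lagrangian (hG : IsTonelli G) :
    Continuous fun q : ℝ × ℝ × ℝ => lagrangian G q.1 q.2.1 q.2.2 := by
  have h1 := hG.continuous_momentum
  exact (h1.mul (by fun_prop)).sub (hG.continuous.comp
    (f := fun q : ℝ × ℝ × ℝ => (q.1, q.2.1, momentum G q.1 q.2.1 q.2.2)) (by fun_prop))

/-- Fenchel's inequality with `p = R` or `p = -R`, according to the sign of `v`. -/
theorem exists_lagrangian_ge (hG : IsTonelli G) (R : ℝ) :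
    ∃ C, 0 < C ∧ ∀ t x v, R * |v| - C ≤ lagrangian G t x v := by
  obtain ⟨C, hC, h⟩ := hG.biperiodic.exists_norm_le hG.continuous |R|
  refine ⟨C, hC, fun t x v => ?_⟩
  rcases le_total 0 v with hv | hv
  · have h1 := hG.fenchel t x R v
    have h2 := (le_abs_self _).trans (h t x R le_rfl)
    rw [abs_of_nonneg hv]; linarith
  · have h1 := hG.fenchel t x (-R) v
    have h2 := (le_abs_self _).trans (h t x (-R) (by rw [abs_neg]))
    rw [abs_of_nonpos hv]; linarith

/-- A first order expansion of the Lagrangian with a quadratic upper bound on the remainder. -/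
theorem exists_lagrangian_le_quadratic (hG : IsTonelli G) (V : ℝ) :
    ∃ C, 0 < C ∧ ∀ t x x' v v', |v| ≤ V → |v'| ≤ V →
      lagrangian G t x' v' ≤ lagrangian G t x v + momentum G t x v * (v' - v)
        - dX G t x (momentum G t x v) * (x' - x) + C * ((x' - x) ^ 2 + (v' - v) ^ 2) := by
  obtain ⟨P, hP, hmom⟩ := hG.exists_momentum_le V
  obtain ⟨m, hm, hmono⟩ := hG.exists_strongly_monotone P
  obtain ⟨C₁, hC₁, -, hX⟩ := hG.biperiodic_dX.exists_lipschitz hG.contDiff_dX P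
  obtain ⟨C₂, hC₂, -, hPl⟩ := hG.biperiodic_dP.exists_lipschitz hG.contDiff_dP P
  set K := C₁ + C₂ with hK
  refine ⟨K + (2 + 2 * K ^ 2) / m, by positivity, fun t x x' v v' hv hv' => ?_⟩
  set p := momentum G t x v with hp
  set p' := momentum G t x' v' with hp'
  have hpP := hmom t x v hv
  have hpP' := hmom t x' v' hv'
  -- Strong monotonicity makes the momentum Lipschitz in `(x, v)`, so no derivative of the Legendre
  -- transform is needed.
  have hd : m * |p' - p| ≤ |v' - v| + K * |x' - x| := by
    have h1 := hmono t x' p' p hpP' hpP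
    rw [hG.dP_momentum] at h1
    have h2 := hPl t x p t x' p hpP hpP
    rw [hG.dP_momentum] at h2
    simp only [sub_self, abs_zero, zero_add, add_zero] at h2
    have h3 : |v' - dP G t x' p| ≤ |v' - v| + |v - dP G t x' p| := abs_sub_le _ _ _
    rw [abs_sub_comm x x'] at h2
    have := abs_nonneg (x' - x)
    nlinarith
  -- Using the perturbed momentum `p'` at the base point bounds the increment of the Lagrangian by
  -- `p' (v' - v) - (G t x' p' - G t x p')`; replacing `p'` by `p` here costs only quadratic terms.
  have hL := hG.fenchel t x p' v
  obtain ⟨ζ, hζ, hζ'⟩ : ∃ ζ, |ζ - x| ≤ |x' - x| ∧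
      G t x' p' - G t x p' = dX G t ζ p' * (x' - x) := by
    rcases lt_trichotomy x x' with h | h | h
    · obtain ⟨r, hr, hr'⟩ := exists_hasDerivAt_eq_slope (fun z => G t z p') (fun z => dX G t z p') h
        (fun s _ => (hG.hasDerivAt_dX t s p').continuousAt.continuousWithinAt)
        (fun s _ => hG.hasDerivAt_dX t s p')
      refine ⟨r, ?_, ?_⟩
      · rw [abs_of_pos, abs_of_pos] <;> linarith [hr.1, hr.2]
      · rw [eq_div_iff (by linarith)] at hr'; linarith
    · exact ⟨x, by simp, by simp [h]⟩
    · obtain ⟨r, hr, hr'⟩ := exists_hasDerivAt_eq_slope (fun z => G t z p') (fun z => dX G t z p') h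
        (fun s _ => (hG.hasDerivAt_dX t s p').continuousAt.continuousWithinAt)
        (fun s _ => hG.hasDerivAt_dX t s p')
      refine ⟨r, ?_, ?_⟩
      · rw [abs_of_neg, abs_of_neg] <;> linarith [hr.1, hr.2]
      · rw [eq_div_iff (by linarith)] at hr'; linarith
  have hX' := hX t x p t ζ p' hpP hpP'
  simp only [sub_self, abs_zero, zero_add] at hX'
  rw [abs_sub_comm x ζ, abs_sub_comm p p'] at hX'
  set a := |x' - x| with ha
  set b := |v' - v| with hb
  set d := |p' - p| with hdd
  have ha0 : 0 ≤ a := abs_nonneg _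
  have hb0 : 0 ≤ b := abs_nonneg _
  have hd0 : 0 ≤ d := abs_nonneg _
  have e1 : (p' - p) * (v' - v) ≤ d * b := by rw [hdd, hb, ← abs_mul]; exact le_abs_self _
  have e2 : (dX G t x p - dX G t ζ p') * (x' - x) ≤ K * (a + d) * a := by
    refine (le_abs_self _).trans ?_
    rw [abs_mul]
    gcongr
    refine hX'.trans ?_
    gcongr
    linarith
  have e3 : d * (b + K * a) ≤ (2 + 2 * K ^ 2) / m * (a ^ 2 + b ^ 2) := by
    have h1 : d ≤ (b + K * a) / m := by rw [le_div_iff₀ hm]; linarith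
    have hK0 : 0 < K := by positivity
    have h2 : d * (b + K * a) ≤ (b + K * a) / m * (b + K * a) := by gcongr
    refine h2.trans ?_
    rw [div_mul_eq_mul_div, div_mul_eq_mul_div]
    refine div_le_div_of_nonneg_right ?_ hm.le
    linarith [sq_nonneg (b - K * a), mul_nonneg (sq_nonneg K) (sq_nonneg b), sq_nonneg a]
  have hsa : (x' - x) ^ 2 = a ^ 2 := (sq_abs _).symm
  have hsb : (v' - v) ^ 2 = b ^ 2 := (sq_abs _).symm
  rw [hsa, hsb]
  have hLe : lagrangian G t x' v' = p' * v' - G t x' p' := rfl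
  rw [hLe]
  have hKb : 0 ≤ K * b ^ 2 := by positivity
  nlinarith

end IsTonelli

/-! ### Symplectic Euler chains and completeness of the flow -/

/-- Sequences following the symplectic Euler scheme for the Hamiltonian `G` with step `ε`. -/
def IsEulerChain (G : ℝ → ℝ → ℝ → ℝ) (s ε : ℝ) (m : ℕ) (a p : ℕ → ℝ) : Prop :=
  ∀ i < m, p (i + 1) = p i - ε * dX G (s + i * ε) (a i) (p i) ∧
    a (i + 1) = a i + ε * dP G (s + (i + 1) * ε) (a (i + 1)) (p (i + 1))

/-- The evaluation point `r` is left free because the scheme is explicit in one equation and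
implicit in the other: the derivative is taken at the left end for the momentum and at the right end
for the position. -/
theorem exists_uniform_first_order {X X' : ℝ → ℝ} (hX : ∀ t, HasDerivAt X (X' t) t)
    (hc : Continuous X') (a b : ℝ) {η : ℝ} (hη : 0 < η) :
    ∃ δ, 0 < δ ∧ ∀ t r ε, a ≤ t → t + ε ≤ b → 0 < ε → ε < δ → t ≤ r → r ≤ t + ε →
      |X (t + ε) - X t - ε * X' r| ≤ ε * η := by
  obtain ⟨δ, hδ, h⟩ := Metric.uniformContinuousOn_iff.1
    (isCompact_Icc.uniformContinuousOn_of_continuous (hc.continuousOn (s := Icc a b))) η hη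
  refine ⟨δ, hδ, fun t r ε ht htb hε hεδ h1 h2 => ?_⟩
  obtain ⟨ζ, hζ, hζ'⟩ := exists_hasDerivAt_eq_slope X X' (by linarith : t < t + ε)
    (fun s _ => (hX s).continuousAt.continuousWithinAt) (fun s _ => hX s)
  rw [eq_div_iff (by linarith)] at hζ'
  have h3 := h ζ ⟨by linarith [hζ.1], by linarith [hζ.2]⟩ r ⟨by linarith, by linarith⟩ (by
    rw [Real.dist_eq, abs_lt]; constructor <;> linarith [hζ.1, hζ.2])
  rw [Real.dist_eq] at h3
  have : X (t + ε) - X t - ε * X' r = ε * (X' ζ - X' r) := by linarith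
  rw [this, abs_mul, abs_of_pos hε]
  gcongr

/-- Absorbs the implicit term `c * S'`, since `(1 + c) / (1 - c) ≤ 1 + 4 * c` for small `c`. -/
theorem gronwall_step {c e S S' : ℝ} (hc : 0 ≤ c) (hc1 : c ≤ 1 / 4) (he : 0 ≤ e) (hS : 0 ≤ S)
    (h : S' ≤ S + c * S + c * S' + 2 * e) : S' ≤ (1 + 4 * c) * S + 4 * e := by
  have h7 : S * (1 + c) + 2 * e ≤ ((1 + 4 * c) * S + 4 * e) * (1 - c) := by
    have h5 : 0 ≤ S * c * (2 - 4 * c) := mul_nonneg (mul_nonneg hS hc) (by linarith)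
    have h6 : 0 ≤ e * (2 - 4 * c) := mul_nonneg he (by linarith)
    linarith
  have h8 : S' * (1 - c) ≤ S * (1 + c) + 2 * e := by linarith
  exact le_of_mul_le_mul_right (h8.trans h7) (by linarith)

theorem gronwall_exp {ε C r k S : ℝ} (hε : 0 ≤ ε) (hC : 0 ≤ C) (hr : 0 ≤ r) (hk : 0 ≤ k * ε)
    (hS : S ≤ (r + 4 * r * (k * ε)) * Real.exp (4 * C * (k * ε))) :
    (1 + 4 * (ε * C)) * S + 4 * (ε * r) ≤
      (r + 4 * r * ((k + 1) * ε)) * Real.exp (4 * C * ((k + 1) * ε)) := by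
  have hexp1 : 1 + 4 * (ε * C) ≤ Real.exp (4 * C * ε) := by
    have := Real.add_one_le_exp (4 * C * ε); linarith
  have hkε : 0 ≤ (k + 1) * ε := by linarith
  have hexp2 : (1:ℝ) ≤ Real.exp (4 * C * ((k + 1) * ε)) := Real.one_le_exp (by positivity)
  calc (1 + 4 * (ε * C)) * S + 4 * (ε * r)
      ≤ (1 + 4 * (ε * C)) * ((r + 4 * r * (k * ε)) * Real.exp (4 * C * (k * ε)))
        + 4 * (ε * r) * 1 := by rw [mul_one]; gcongr
    _ ≤ Real.exp (4 * C * ε) * ((r + 4 * r * (k * ε)) * Real.exp (4 * C * (k * ε)))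
        + 4 * (ε * r) * Real.exp (4 * C * ((k + 1) * ε)) := by gcongr
    _ = _ := by
        rw [show 4 * C * ((k + 1) * ε) = 4 * C * ε + 4 * C * (k * ε) by ring, Real.exp_add]
        ring

namespace IsTonelli

variable {G : ℝ → ℝ → ℝ → ℝ}

/-- Completeness provides an orbit through `(τ, x₀, p₀)` that is bounded on a compact time interval.
The discrete Grönwall inequality keeps every chain starting close to it within distance `1` for a
unit of time. -/
theorem euler_local_bound (hG : IsTonelli G) (τ x₀ p₀ : ℝ) :
    ∃ U ∈ 𝓝 (τ, x₀, p₀), ∃ P ε₀ : ℝ, 0 < ε₀ ∧ ∀ (s ε : ℝ) (a p : ℕ → ℝ) (m : ℕ), 0 < ε → ε < ε₀ → (m : ℝ) * ε ≤ 1 →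
      (s, a 0, p 0) ∈ U → IsEulerChain G s ε m a p → ∀ i ≤ m, |p i| ≤ P := by
  obtain ⟨X, Q, hX0, hQ0, hXQ⟩ := hG.complete τ x₀ p₀
  have hXc : Continuous X := continuous_iff_continuousAt.2 fun t => (hXQ t).1.continuousAt
  have hQc : Continuous Q := continuous_iff_continuousAt.2 fun t => (hXQ t).2.continuousAt
  obtain ⟨B, hB⟩ := (isCompact_Icc (a := τ - 1) (b := τ + 3)).exists_bound_of_continuousOn
    hQc.continuousOn
  -- The margin is `2` and not `1`: the implicit step uses the Lipschitz bound at `p (k + 1)` before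
  -- the error there is known to be at most `1`.
  obtain ⟨C₁, hC₁, -, hdX⟩ := hG.biperiodic_dX.exists_lipschitz hG.contDiff_dX (B + 2)
  obtain ⟨C₂, hC₂, -, hdP⟩ := hG.biperiodic_dP.exists_lipschitz hG.contDiff_dP (B + 2)
  set C := C₁ + C₂ with hC
  have hC0 : 0 < C := by positivity
  -- After a unit of time an initial error `r` and local errors `ε * r` have grown to at most `5 * r
  -- * exp (4 * C)`, which is `1`.
  set r := Real.exp (-(4 * C)) / 5 with hr
  have hr0 : 0 < r := by positivity
  have hr1 : r ≤ 1 / 5 := by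
    rw [hr]; gcongr; rw [Real.exp_le_one_iff]; linarith
  have hXd : Continuous fun t => dP G t (X t) (Q t) :=
    hG.contDiff_dP.continuous.comp (f := fun t => (t, X t, Q t)) (by fun_prop)
  have hQd : Continuous fun t => -dX G t (X t) (Q t) :=
    (hG.contDiff_dX.continuous.comp (f := fun t => (t, X t, Q t)) (by fun_prop)).neg
  obtain ⟨δ₁, hδ₁, h₁⟩ := exists_uniform_first_order (fun t => (hXQ t).1) hXd (τ - 1) (τ + 3) hr0
  obtain ⟨δ₂, hδ₂, h₂⟩ := exists_uniform_first_order (fun t => (hXQ t).2) hQd (τ - 1) (τ + 3) hr0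
  -- Closeness is measured to the orbit at the starting time of the chain, not at `τ`.
  have hU : {q : ℝ × ℝ × ℝ | |q.1 - τ| < 1 ∧ |q.2.1 - X q.1| + |q.2.2 - Q q.1| < r} ∈
      𝓝 (τ, x₀, p₀) := by
    apply IsOpen.mem_nhds
    · exact (isOpen_lt (f := fun q : ℝ × ℝ × ℝ => |q.1 - τ|) (g := fun _ => 1)
        (by fun_prop) (by fun_prop)).inter
        (isOpen_lt (f := fun q : ℝ × ℝ × ℝ => |q.2.1 - X q.1| + |q.2.2 - Q q.1|) (g := fun _ => r)
        (by fun_prop) (by fun_prop))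
    · simp [hX0, hQ0, hr0]
  refine ⟨_, hU, B + 2, min (min δ₁ δ₂) (min 1 (1 / (4 * C))), by positivity, ?_⟩
  intro s ε a p m hε hε0 hm hs hch
  have hεδ₁ : ε < δ₁ := hε0.trans_le ((min_le_left _ _).trans (min_le_left _ _))
  have hεδ₂ : ε < δ₂ := hε0.trans_le ((min_le_left _ _).trans (min_le_right _ _))
  have hε1 : ε < 1 := hε0.trans_le ((min_le_right _ _).trans (min_le_left _ _))
  have hεC : ε * C ≤ 1 / 4 := by
    have := (hε0.trans_le ((min_le_right _ _).trans (min_le_right _ _))).le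
    rw [le_div_iff₀ (by positivity)] at this
    linarith
  obtain ⟨hs1, hs2⟩ := hs
  rw [abs_lt] at hs1
  simp only at hs1 hs2
  have hQB : ∀ t, τ - 1 ≤ t → t ≤ τ + 3 → |Q t| ≤ B := fun t h h' => hB t ⟨h, h'⟩
  have hexp : Real.exp (4 * C) * (5 * r) = 1 := by
    rw [hr, mul_div_cancel₀ _ (by norm_num : (5:ℝ) ≠ 0), ← Real.exp_add]; simp
  have hgrow : ∀ θ : ℝ, 0 ≤ θ → θ ≤ 1 →
      (r + 4 * r * θ) * Real.exp (4 * C * θ) ≤ (5 * r) * Real.exp (4 * C) := by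
    intro θ h0 h1
    refine mul_le_mul (by nlinarith) (Real.exp_le_exp.2 (by nlinarith)) (by positivity)
      (by positivity)
  have main : ∀ i ≤ m, |a i - X (s + i * ε)| + |p i - Q (s + i * ε)|
      ≤ (r + 4 * r * (i * ε)) * Real.exp (4 * C * (i * ε)) := by
    intro i
    induction i with
    | zero => intro _; simpa using hs2.le
    | succ k ih =>
      intro hk
      have ih := ih (by omega)
      have hkε : ((k : ℝ) + 1) * ε ≤ 1 :=
        le_trans (by gcongr; exact_mod_cast hk) hm
      have hk0 : 0 ≤ (k : ℝ) * ε := by positivity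
      set D := |a k - X (s + k * ε)| with hD
      set E := |p k - Q (s + k * ε)| with hE
      set D' := |a (k + 1) - X (s + (k + 1) * ε)| with hD'
      set E' := |p (k + 1) - Q (s + (k + 1) * ε)| with hE'
      have hD0 : 0 ≤ D := abs_nonneg _
      have hE0 : 0 ≤ E := abs_nonneg _
      have hD0' : 0 ≤ D' := abs_nonneg _
      have hE0' : 0 ≤ E' := abs_nonneg _
      have hS1 : D + E ≤ 1 := by
        refine ih.trans ?_
        have : (r + 4 * r * (k * ε)) * Real.exp (4 * C * (k * ε)) ≤
            (5 * r) * Real.exp (4 * C) := hgrow _ hk0 (by linarith)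
        linarith
      obtain ⟨hp, ha⟩ := hch k (by omega)
      have et : s + (k + 1) * ε = s + k * ε + ε := by ring
      have hQk := hQB (s + k * ε) (by linarith) (by linarith)
      have hQk' := hQB (s + (k + 1) * ε) (by nlinarith) (by nlinarith)
      have hpk : |p k| ≤ B + 2 := by
        have := abs_sub_abs_le_abs_sub (p k) (Q (s + k * ε)); linarith
      have e2 := h₂ (s + k * ε) (s + k * ε) ε (by linarith) (by linarith) hε hεδ₂ le_rfl
        (by linarith)
      have e1 := h₁ (s + k * ε) (s + k * ε + ε) ε (by linarith) (by linarith) hε hεδ₁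
        (by linarith) le_rfl
      rw [← et] at e1 e2
      have f2 := hdX (s + k * ε) (a k) (p k) (s + k * ε) (X (s + k * ε)) (Q (s + k * ε)) hpk
        (by linarith)
      simp only [sub_self, abs_zero, zero_add] at f2
      have hE1 : E' ≤ E + ε * (C * (D + E)) + ε * r := by
        have : p (k + 1) - Q (s + (k + 1) * ε) = (p k - Q (s + k * ε))
            - ε * (dX G (s + k * ε) (a k) (p k) - dX G (s + k * ε) (X (s + k * ε)) (Q (s + k * ε)))
            - (Q (s + (k + 1) * ε) - Q (s + k * ε)
                - ε * -dX G (s + k * ε) (X (s + k * ε)) (Q (s + k * ε))) := by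
          rw [hp]; ring
        refine (hE'.trans (congrArg abs this)).trans_le ?_
        refine (abs_sub _ _).trans (add_le_add ((abs_sub _ _).trans (add_le_add le_rfl ?_)) e2)
        rw [abs_mul, abs_of_pos hε]
        gcongr
        refine f2.trans (mul_le_mul_of_nonneg_right ?_ (add_nonneg (abs_nonneg _) (abs_nonneg _)))
        linarith
      have hpk' : |p (k + 1)| ≤ B + 2 := by
        have := abs_sub_abs_le_abs_sub (p (k + 1)) (Q (s + (k + 1) * ε))
        have h3 : ε * (C * (D + E)) ≤ 1 / 4 := by
          rw [← mul_assoc]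
          calc ε * C * (D + E) ≤ 1 / 4 * 1 := by gcongr
            _ = 1 / 4 := by ring
        have h4 : ε * r ≤ 1 * (1 / 5) := by gcongr
        linarith
      have f1 := hdP (s + (k + 1) * ε) (a (k + 1)) (p (k + 1)) (s + (k + 1) * ε)
        (X (s + (k + 1) * ε)) (Q (s + (k + 1) * ε)) hpk' (by linarith)
      simp only [sub_self, abs_zero, zero_add] at f1
      have hD1 : D' ≤ D + ε * (C * (D' + E')) + ε * r := by
        have : a (k + 1) - X (s + (k + 1) * ε) = (a k - X (s + k * ε))
            + ε * (dP G (s + (k + 1) * ε) (a (k + 1)) (p (k + 1))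
                - dP G (s + (k + 1) * ε) (X (s + (k + 1) * ε)) (Q (s + (k + 1) * ε)))
            - (X (s + (k + 1) * ε) - X (s + k * ε)
                - ε * dP G (s + (k + 1) * ε) (X (s + (k + 1) * ε)) (Q (s + (k + 1) * ε))) := by
          rw [show a (k + 1) - X (s + (k + 1) * ε) = a k + ε * dP G (s + (k + 1) * ε) (a (k + 1))
            (p (k + 1)) - X (s + (k + 1) * ε) by rw [← ha]]
          ring
        refine (hD'.trans (congrArg abs this)).trans_le ?_
        refine (abs_sub _ _).trans (add_le_add ((abs_add_le _ _).trans (add_le_add le_rfl ?_)) e1)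
        rw [abs_mul, abs_of_pos hε]
        gcongr
        refine f1.trans (mul_le_mul_of_nonneg_right ?_ (add_nonneg (abs_nonneg _) (abs_nonneg _)))
        linarith
      have hstep := gronwall_step (by positivity : 0 ≤ ε * C) (by linarith) (by positivity : 0 ≤ ε * r)
        (by positivity : 0 ≤ D + E) (S' := D' + E') (by linarith)
      push_cast
      exact hstep.trans (gronwall_exp hε.le hC0.le hr0.le hk0 ih)
  intro i hi
  have h := main i hi
  have hiε : (i : ℝ) * ε ≤ 1 := le_trans (by gcongr) hm
  have hi0 : 0 ≤ (i : ℝ) * ε := by positivity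
  have h5 : (r + 4 * r * (i * ε)) * Real.exp (4 * C * (i * ε)) ≤ (5 * r) * Real.exp (4 * C) :=
    hgrow _ hi0 hiε
  have h6 := hQB (s + i * ε) (by linarith) (by linarith)
  have := abs_sub_abs_le_abs_sub (p i) (Q (s + i * ε))
  have := abs_nonneg (a i - X (s + i * ε))
  linarith

/-- Momenta of Euler chains stay bounded over a unit of time; this uses completeness of the flow. -/
theorem euler_bound (hG : IsTonelli G) (P₀ : ℝ) :
    ∃ P ε₀ : ℝ, 0 < ε₀ ∧ ∀ (s ε : ℝ) (a p : ℕ → ℝ) (m : ℕ), 0 < ε → ε < ε₀ → (m : ℝ) * ε ≤ 1 →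
      |p 0| ≤ P₀ → IsEulerChain G s ε m a p → ∀ i ≤ m, |p i| ≤ P := by
  have key := (isCompact_Icc.prod (isCompact_Icc.prod isCompact_Icc) :
    IsCompact (Icc (0:ℝ) 1 ×ˢ (Icc (0:ℝ) 1 ×ˢ Icc (-P₀) P₀))).induction_on
    (p := fun U => ∃ P ε₀ : ℝ, 0 < ε₀ ∧ ∀ (s ε : ℝ) (a p : ℕ → ℝ) (m : ℕ), 0 < ε → ε < ε₀ → (m : ℝ) * ε ≤ 1 →
      (s, a 0, p 0) ∈ U → IsEulerChain G s ε m a p → ∀ i ≤ m, |p i| ≤ P)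
    ⟨0, 1, one_pos, fun s ε a p m _ _ _ h => h.elim⟩
    (fun S T hST ⟨P, ε₀, h0, h⟩ => ⟨P, ε₀, h0, fun s ε a p m h1 h2 h3 h4 =>
      h s ε a p m h1 h2 h3 (hST h4)⟩)
    (fun S T ⟨P, ε₀, h0, h⟩ ⟨P', ε₀', h0', h'⟩ => ⟨max P P', min ε₀ ε₀', lt_min h0 h0',
      fun s ε a p m h1 h2 h3 h4 h5 i hi => h4.elim
        (fun h4 => (h s ε a p m h1 (h2.trans_le (min_le_left _ _)) h3 h4 h5 i hi).trans
          (le_max_left _ _))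
        (fun h4 => (h' s ε a p m h1 (h2.trans_le (min_le_right _ _)) h3 h4 h5 i hi).trans
          (le_max_right _ _))⟩)
    (fun q _ => by
      obtain ⟨U, hU, P, ε₀, h0, h⟩ := hG.euler_local_bound q.1 q.2.1 q.2.2
      exact ⟨U, mem_nhdsWithin_of_mem_nhds hU, P, ε₀, h0, h⟩)
  obtain ⟨P, ε₀, h0, h⟩ := key
  refine ⟨P, ε₀, h0, fun s ε a p m h1 h2 h3 h4 h5 => ?_⟩
  have shift : ∀ {F : ℝ → ℝ → ℝ → ℝ}, IsBiperiodic F → ∀ (k l : ℤ) (t x p : ℝ),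
      F (t - k) (x - l) p = F t x p := by
    intro F hF k l t x p
    have e1 := Function.Periodic.sub_int_mul_eq (f := fun t => F t (x - l) p) (c := 1) (x := t)
      (fun t => hF.1 t _ p) k
    have e2 := Function.Periodic.sub_int_mul_eq (f := fun x => F t x p) (c := 1) (x := x)
      (fun x => hF.2 t x p) l
    simp only [mul_one] at e1 e2
    exact e1.trans e2
  -- An integer translation in time and space moves the start of the chain into the compact cell
  -- covered above and preserves the scheme.
  refine h (Int.fract s) ε (fun i => a i - ⌊a 0⌋) p m h1 h2 h3 ⟨⟨Int.fract_nonneg _,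
    (Int.fract_lt_one _).le⟩, ⟨Int.fract_nonneg (a 0), (Int.fract_lt_one (a 0)).le⟩,
    abs_le.1 h4⟩ fun i hi => ?_
  obtain ⟨e1, e2⟩ := h5 i hi
  constructor
  · rw [e1, ← Int.self_sub_floor, show s - ⌊s⌋ + i * ε = s + i * ε - ⌊s⌋ by ring,
      shift hG.biperiodic_dX]
  · rw [← Int.self_sub_floor, show s - ⌊s⌋ + (i + 1) * ε = s + (i + 1) * ε - ⌊s⌋ by ring,
      shift hG.biperiodic_dP]
    linarith

end IsTonelli

/-! ### The discrete Lax–Oleinik scheme and its minimizing chains -/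

/-- One step of length `ε` of the discrete Lax–Oleinik scheme. -/
def laxStep (G : ℝ → ℝ → ℝ → ℝ) (t ε : ℝ) (f : ℝ → ℝ) (x : ℝ) : ℝ :=
  -- The Lagrangian is taken at the starting time and at the arrival point; with this choice the
  -- discrete Euler–Lagrange equation is exactly the symplectic Euler scheme.
  ⨅ y, f y + ε * lagrangian G t x ((x - y) / ε)

/-- The discrete Lax–Oleinik evolution of `f` starting at time `t₀` with step `ε`. -/
def laxScheme (G : ℝ → ℝ → ℝ → ℝ) (t₀ ε : ℝ) (f : ℝ → ℝ) : ℕ → ℝ → ℝ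
  | 0 => f
  | n + 1 => laxStep G (t₀ + n * ε) ε (laxScheme G t₀ ε f n)

/-- Minimizing chains of the discrete Lax–Oleinik evolution. -/
def IsMinChain (G : ℝ → ℝ → ℝ → ℝ) (t₀ ε : ℝ) (f : ℝ → ℝ) (n : ℕ) (ξ : ℕ → ℝ) : Prop :=
  ∀ k < n, laxScheme G t₀ ε f (k + 1) (ξ (k + 1)) = laxScheme G t₀ ε f k (ξ k)
    + ε * lagrangian G (t₀ + k * ε) (ξ (k + 1)) ((ξ (k + 1) - ξ k) / ε)

/-- The discrete momenta along a chain. -/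
def chainMomentum (G : ℝ → ℝ → ℝ → ℝ) (t₀ ε : ℝ) (ξ : ℕ → ℝ) (k : ℕ) : ℝ :=
  momentum G (t₀ + k * ε) (ξ (k + 1)) ((ξ (k + 1) - ξ k) / ε)

/-- Division by `|s|` as `s` tends to `0`. With `A = 0` this is the stationarity condition at a
minimum; with a Lipschitz constant as `A` it bounds the momentum at a free endpoint. -/
theorem abs_le_of_forall_quadratic {A a C r : ℝ} (hr : 0 < r) (hC : 0 ≤ C)
    (h : ∀ s, |s| ≤ r → -(A * |s|) ≤ a * s + C * s ^ 2) : |a| ≤ A := by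
  by_contra hc
  push Not at hc
  set s := min r ((|a| - A) / (2 * (C + 1))) with hs
  have hs0 : 0 < s := lt_min hr (div_pos (by linarith) (by positivity))
  have hsr : s ≤ r := min_le_left _ _
  have hs2 : s * (2 * (C + 1)) ≤ |a| - A := by
    rw [← le_div_iff₀ (by positivity)]; exact min_le_right _ _
  rcases le_total 0 a with ha | ha
  · have := h (-s) (by rw [abs_neg, abs_of_pos hs0]; exact hsr)
    rw [abs_neg, abs_of_pos hs0] at this
    rw [abs_of_nonneg ha] at *
    have h1 : s * (s * (2 * (C + 1))) ≤ s * (a - A) := by gcongr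
    nlinarith
  · have := h s (by rw [abs_of_pos hs0]; exact hsr)
    rw [abs_of_pos hs0] at this
    rw [abs_of_nonpos ha] at *
    have h1 : s * (s * (2 * (C + 1))) ≤ s * (-a - A) := by gcongr
    nlinarith

namespace IsTonelli

variable {G : ℝ → ℝ → ℝ → ℝ}

/-- Linear growth of the Lagrangian confines the minimizing displacements to one compact interval,
the same for all `x`. The infimum is therefore attained, and it depends continuously on `x`. -/
theorem laxStep_spec (hG : IsTonelli G) {f : ℝ → ℝ} (hf : Continuous f)
    (hper : Function.Periodic f 1) (t : ℝ) {ε : ℝ} (hε : 0 < ε) :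
    Continuous (laxStep G t ε f) ∧ Function.Periodic (laxStep G t ε f) 1 ∧
      (∀ x y, laxStep G t ε f x ≤ f y + ε * lagrangian G t x ((x - y) / ε)) ∧
      ∀ x, ∃ y, laxStep G t ε f x = f y + ε * lagrangian G t x ((x - y) / ε) := by
  obtain ⟨C, hC, hlow⟩ := hG.exists_lagrangian_ge 1
  obtain ⟨M, hM, hup⟩ := hG.biperiodic_lagrangian.exists_norm_le hG.continuous_lagrangian 0
  obtain ⟨B, hB⟩ := (isCompact_Icc (a := (0:ℝ)) (b := 1)).exists_bound_of_continuousOn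
    hf.continuousOn
  have hfB : ∀ y, |f y| ≤ B := fun y => by
    obtain ⟨z, hz, hz'⟩ := hper.exists_mem_Ico₀ one_pos y
    rw [hz']; exact hB z (Ico_subset_Icc_self hz)
  -- A displacement `0` costs at most `B + ε * M` and a displacement `w` at least `-B + |w| - ε *
  -- C`, so outside `K` the former is cheaper.
  set K := Icc (-(2 * B + ε * (M + C))) (2 * B + ε * (M + C)) with hK
  have hB0 : 0 ≤ B := (abs_nonneg _).trans (hfB 0)
  have h0K : (0:ℝ) ∈ K := by
    have : 0 ≤ 2 * B + ε * (M + C) := by positivity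
    exact ⟨by linarith, this⟩
  set F : ℝ → ℝ → ℝ := fun x z => f (x - z) + ε * lagrangian G t x (z / ε) with hF
  have hFc : Continuous (Function.uncurry F) :=
    (hf.comp (by fun_prop)).add (continuous_const.mul
      (hG.continuous_lagrangian.comp (f := fun q : ℝ × ℝ => (t, q.1, q.2 / ε)) (by fun_prop)))
  have hmin : ∀ x, ∃ z ∈ K, ∀ w, F x z ≤ F x w := by
    intro x
    obtain ⟨z, hz, hzmin⟩ := (isCompact_Icc : IsCompact K).exists_isMinOn ⟨0, h0K⟩
      (hFc.comp (by fun_prop : Continuous fun z => (x, z))).continuousOn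
    refine ⟨z, hz, fun w => ?_⟩
    by_cases hw : w ∈ K
    · exact hzmin hw
    · have h1 : F x z ≤ F x 0 := hzmin h0K
      have h2 : F x 0 ≤ B + ε * M := by
        simp only [hF, sub_zero, zero_div]
        have := (le_abs_self _).trans (hup t x 0 (by simp))
        have := (le_abs_self _).trans (hfB x)
        gcongr
      have h3 : 2 * B + ε * (M + C) < |w| := by
        by_contra hc
        push Not at hc
        exact hw (abs_le.1 hc)
      have h4 : -B + |w| - ε * C ≤ F x w := by
        have h5 := hlow t x (w / ε)
        rw [one_mul, abs_div, abs_of_pos hε] at h5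
        have h6 := mul_le_mul_of_nonneg_left h5 hε.le
        rw [mul_sub, mul_div_cancel₀ _ hε.ne'] at h6
        have := neg_le_of_abs_le (hfB (x - w))
        simp only [hF]
        linarith
      linarith
  have heq : ∀ x y, f y + ε * lagrangian G t x ((x - y) / ε) = F x (x - y) := fun x y => by
    simp [hF]
  have hspec : ∀ x, (∀ y, laxStep G t ε f x ≤ F x (x - y)) ∧ ∃ z ∈ K, laxStep G t ε f x = F x z := by
    intro x
    obtain ⟨z, hz, hzm⟩ := hmin x
    have hbdd : BddBelow (range fun y => f y + ε * lagrangian G t x ((x - y) / ε)) :=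
      ⟨F x z, by rintro _ ⟨y, rfl⟩; exact (hzm _).trans_eq (heq x y).symm⟩
    refine ⟨fun y => (ciInf_le hbdd y).trans_eq (heq x y), z, hz, le_antisymm ?_ ?_⟩
    · refine (ciInf_le hbdd (x - z)).trans_eq ?_
      rw [heq, sub_sub_cancel]
    · exact le_ciInf fun y => (hzm _).trans_eq (heq x y).symm
  refine ⟨?_, ?_, fun x y => ((hspec x).1 y).trans_eq (heq x y).symm, fun x => ?_⟩
  · have : laxStep G t ε f = fun x => sInf (F x '' K) := by
      funext x
      obtain ⟨h1, z, hz, h2⟩ := hspec x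
      refine (IsLeast.csInf_eq (s := F x '' K) ⟨⟨z, hz, h2.symm⟩, ?_⟩).symm
      rintro _ ⟨w, -, rfl⟩
      have := h1 (x - w)
      rwa [sub_sub_cancel] at this
    rw [this]
    exact isCompact_Icc.continuous_sInf hFc
  · intro x
    unfold laxStep
    refine (Equiv.iInf_congr (Equiv.addRight (1:ℝ)) fun y => ?_).symm
    simp only [Equiv.coe_addRight]
    rw [hper y, hG.biperiodic_lagrangian.2, add_sub_add_right_eq_sub]
  · obtain ⟨-, z, -, h2⟩ := hspec x
    refine ⟨x - z, ?_⟩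
    rw [heq, sub_sub_cancel, h2]

section Scheme

variable (hG : IsTonelli G) {f : ℝ → ℝ} (hf : Continuous f) (hper : Function.Periodic f 1)
  (t₀ : ℝ) {ε : ℝ} (hε : 0 < ε)

include hG hf hper hε

theorem laxScheme_regular (n : ℕ) : Continuous (laxScheme G t₀ ε f n) ∧
    Function.Periodic (laxScheme G t₀ ε f n) 1 := by
  induction n with
  | zero => exact ⟨hf, hper⟩
  | succ n ih =>
    have := hG.laxStep_spec ih.1 ih.2 (t₀ + n * ε) hε
    exact ⟨this.1, this.2.1⟩

theorem laxScheme_succ_le (n : ℕ) (x y : ℝ) : laxScheme G t₀ ε f (n + 1) x ≤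
    laxScheme G t₀ ε f n y + ε * lagrangian G (t₀ + n * ε) x ((x - y) / ε) := by
  obtain ⟨h1, h2⟩ := hG.laxScheme_regular hf hper t₀ hε n
  exact (hG.laxStep_spec h1 h2 (t₀ + n * ε) hε).2.2.1 x y

theorem exists_minChain (n : ℕ) (x : ℝ) : ∃ ξ, ξ n = x ∧ IsMinChain G t₀ ε f n ξ := by
  induction n generalizing x with
  | zero => exact ⟨fun _ => x, rfl, fun k hk => absurd hk (by omega)⟩
  | succ n ih =>
    obtain ⟨h1, h2⟩ := hG.laxScheme_regular hf hper t₀ hε n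
    obtain ⟨y, hy⟩ := (hG.laxStep_spec h1 h2 (t₀ + n * ε) hε).2.2.2 x
    obtain ⟨ξ, hξ, hch⟩ := ih y
    refine ⟨Function.update ξ (n + 1) x, by simp, fun k hk => ?_⟩
    rw [Function.update_of_ne (by omega : k ≠ n + 1)]
    rcases Nat.lt_succ_iff_lt_or_eq.1 hk with hk | rfl
    · rw [Function.update_of_ne (by omega : k + 1 ≠ n + 1)]
      exact hch k hk
    · rw [Function.update_self, hξ]
      exact hy

theorem laxScheme_add_le (j m : ℕ) (η : ℕ → ℝ) : laxScheme G t₀ ε f (j + m) (η m) ≤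
    laxScheme G t₀ ε f j (η 0) + ∑ i ∈ Finset.range m, ε *
      lagrangian G (t₀ + (j + i : ℕ) * ε) (η (i + 1)) ((η (i + 1) - η i) / ε) := by
  induction m with
  | zero => simp
  | succ m ih =>
    rw [Finset.sum_range_succ]
    have := hG.laxScheme_succ_le hf hper t₀ hε (j + m) (η (m + 1)) (η m)
    rw [← add_assoc]
    linarith

omit hG hf hper hε in
theorem minChain_add {n : ℕ} {ξ : ℕ → ℝ} (hξ : IsMinChain G t₀ ε f n ξ) (j m : ℕ)
    (h : j + m ≤ n) : laxScheme G t₀ ε f (j + m) (ξ (j + m)) =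
    laxScheme G t₀ ε f j (ξ j) + ∑ i ∈ Finset.range m, ε *
      lagrangian G (t₀ + (j + i : ℕ) * ε) (ξ (j + i + 1)) ((ξ (j + i + 1) - ξ (j + i)) / ε) := by
  induction m with
  | zero => simp
  | succ m ih =>
    rw [Finset.sum_range_succ, ← add_assoc, ← add_assoc, ← ih (by omega)]
    exact hξ (j + m) (by omega)

/-- The discrete Euler–Lagrange equation: displacing the interior point `ξ (k + 1)` cannot lower the
total cost, so the first order term of the quadratic expansion vanishes. -/
theorem chainMomentum_succ {n : ℕ} {ξ : ℕ → ℝ} (hξ : IsMinChain G t₀ ε f n ξ) {k : ℕ}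
    (hk : k + 1 < n) : chainMomentum G t₀ ε ξ (k + 1) = chainMomentum G t₀ ε ξ k
      - ε * dX G (t₀ + k * ε) (ξ (k + 1)) (chainMomentum G t₀ ε ξ k) := by
  set v := (ξ (k + 1) - ξ k) / ε with hv
  set w := (ξ (k + 2) - ξ (k + 1)) / ε with hw
  obtain ⟨C, hC, hQ⟩ := hG.exists_lagrangian_le_quadratic (|v| + |w| + 1)
  have hq : |chainMomentum G t₀ ε ξ k - chainMomentum G t₀ ε ξ (k + 1)
      - ε * dX G (t₀ + k * ε) (ξ (k + 1)) (chainMomentum G t₀ ε ξ k)| ≤ 0 := by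
    -- A displacement `s` changes one position by `s` and two velocities by `±s / ε`, each weighted
    -- by the step `ε`.
    refine abs_le_of_forall_quadratic (r := ε) (C := C * (ε + 2 / ε)) hε (by positivity)
      fun s hs => ?_
    have hsε : |s / ε| ≤ 1 := by rw [abs_div, abs_of_pos hε, div_le_one hε]; exact hs
    have e1 := hξ k (by omega)
    have e2 := hξ (k + 1) hk
    have i1 := hG.laxScheme_succ_le hf hper t₀ hε k (ξ (k + 1) + s) (ξ k)
    have i2 := hG.laxScheme_succ_le hf hper t₀ hε (k + 1) (ξ (k + 2)) (ξ (k + 1) + s)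
    rw [show (ξ (k + 1) + s - ξ k) / ε = v + s / ε by rw [hv]; ring] at i1
    rw [show (ξ (k + 2) - (ξ (k + 1) + s)) / ε = w - s / ε by rw [hw]; ring] at i2
    have q1 := hQ (t₀ + k * ε) (ξ (k + 1)) (ξ (k + 1) + s) v (v + s / ε)
      (by linarith [abs_nonneg w]) (by linarith [abs_nonneg w, abs_add_le v (s / ε)])
    have q2 := hQ (t₀ + (k + 1 : ℕ) * ε) (ξ (k + 2)) (ξ (k + 2)) w (w - s / ε)
      (by linarith [abs_nonneg v]) (by linarith [abs_nonneg v, abs_sub w (s / ε)])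
    have q1' := mul_le_mul_of_nonneg_left q1 hε.le
    have q2' := mul_le_mul_of_nonneg_left q2 hε.le
    have a1 : ε * (s / ε) = s := mul_div_cancel₀ _ hε.ne'
    have a2 : (s / ε) ^ 2 * ε = s ^ 2 / ε := by field_simp
    have a3 : C * (ε + 2 / ε) * s ^ 2 = C * (ε * s ^ 2) + 2 * C * (s ^ 2 / ε) := by
      field_simp
    rw [a3, ← a2]
    change laxScheme G t₀ ε f (k + 2) (ξ (k + 2)) = _ at e2
    change laxScheme G t₀ ε f (k + 2) (ξ (k + 2)) ≤ _ at i2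
    have m1 : chainMomentum G t₀ ε ξ k = momentum G (t₀ + k * ε) (ξ (k + 1)) v := rfl
    have m2 : chainMomentum G t₀ ε ξ (k + 1)
      = momentum G (t₀ + (k + 1 : ℕ) * ε) (ξ (k + 2)) w := rfl
    rw [m1, m2]
    change _ = _ + ε * lagrangian G _ _ w at e2
    change _ = _ + ε * lagrangian G _ _ v at e1
    generalize momentum G (t₀ + k * ε) (ξ (k + 1)) v = p at *
    generalize momentum G (t₀ + (k + 1 : ℕ) * ε) (ξ (k + 2)) w = p' at *
    generalize dX G (t₀ + k * ε) (ξ (k + 1)) p = D at *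
    have z1 : ε * (p * (s / ε)) = p * s := by rw [mul_left_comm, a1]
    have z2 : ε * (p' * (s / ε)) = p' * s := by rw [mul_left_comm, a1]
    ring_nf at q1' q2' z1 z2 e1 e2 i1 i2 ⊢
    linarith
  have := abs_nonpos_iff.1 hq
  linarith

/-- The starting point of the chain is free. Displacing it by `s` changes the initial cost by at
most `Λ * |s|`, and minimality then bounds the first momentum by `Λ`. -/
theorem abs_chainMomentum_zero_le {Λ : ℝ} (hΛ : ∀ x y, |f x - f y| ≤ Λ * |x - y|) {n : ℕ}
    {ξ : ℕ → ℝ} (hξ : IsMinChain G t₀ ε f n ξ) (hn : 0 < n) :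
    |chainMomentum G t₀ ε ξ 0| ≤ Λ := by
  set w := (ξ 1 - ξ 0) / ε with hw
  obtain ⟨C, hC, hQ⟩ := hG.exists_lagrangian_le_quadratic (|w| + 1)
  rw [← abs_neg]
  refine abs_le_of_forall_quadratic (r := ε) (C := C / ε) hε (by positivity) fun s hs => ?_
  have hsε : |s / ε| ≤ 1 := by rw [abs_div, abs_of_pos hε, div_le_one hε]; exact hs
  have e2 := hξ 0 hn
  have i2 := hG.laxScheme_succ_le hf hper t₀ hε 0 (ξ 1) (ξ 0 + s)
  rw [show (ξ 1 - (ξ 0 + s)) / ε = w - s / ε by rw [hw]; ring] at i2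
  have q2 := hQ (t₀ + (0 : ℕ) * ε) (ξ 1) (ξ 1) w (w - s / ε)
    (by linarith) (by linarith [abs_sub w (s / ε)])
  have q2' := mul_le_mul_of_nonneg_left q2 hε.le
  have a1 : ε * (s / ε) = s := mul_div_cancel₀ _ hε.ne'
  have a2 : C / ε * s ^ 2 = C * ((s / ε) ^ 2 * ε) := by field_simp
  rw [a2]
  have m2 : chainMomentum G t₀ ε ξ 0 = momentum G (t₀ + (0 : ℕ) * ε) (ξ 1) w := rfl
  rw [m2]
  change _ = _ + ε * lagrangian G _ _ w at e2
  have hL := hΛ (ξ 0 + s) (ξ 0)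
  rw [add_sub_cancel_left] at hL
  have hL' := (le_abs_self _).trans hL
  change laxScheme G t₀ ε f 1 (ξ 1) = f (ξ 0) + _ at e2
  change laxScheme G t₀ ε f 1 (ξ 1) ≤ f (ξ 0 + s) + _ at i2
  generalize momentum G (t₀ + (0 : ℕ) * ε) (ξ 1) w = p' at *
  have z2 : ε * (p' * (s / ε)) = p' * s := by rw [mul_left_comm, a1]
  ring_nf at q2' z2 e2 i2 hL' ⊢
  linarith

end Scheme

/-- Along every minimizing chain over a unit of time some momentum is bounded a priori. -/
theorem exists_small_momentum (hG : IsTonelli G) : ∃ P₀, ∀ (f : ℝ → ℝ), Continuous f →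
    Function.Periodic f 1 → ∀ (t₀ ε : ℝ) (N : ℕ), 0 < ε → N * ε = 1 → ∀ (n : ℕ) (ξ : ℕ → ℝ),
      IsMinChain G t₀ ε f n ξ → ∀ j, j + N ≤ n →
        ∃ i < N, |chainMomentum G t₀ ε ξ (j + i)| ≤ P₀ := by
  obtain ⟨C, hC, hlow⟩ := hG.exists_lagrangian_ge 1
  obtain ⟨M, hM, hup⟩ := hG.biperiodic_lagrangian.exists_norm_le hG.continuous_lagrangian 1
  obtain ⟨P₀, hP₀, hmom⟩ := hG.exists_momentum_le (M + C)
  refine ⟨P₀, fun f hf hper t₀ ε N hε hN n ξ hξ j hj => ?_⟩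
  have hN0 : 0 < N := Nat.pos_of_ne_zero fun h => by simp [h] at hN
  set x := ξ (j + N) with hx
  -- The competitor moves with constant velocity `w` in `[0, 1)` and arrives at `x` from an integer
  -- translate of `ξ j`, where the periodic value function is the same. Its cost is at most `M`.
  set w := Int.fract (x - ξ j) with hw
  have hw0 : 0 ≤ w := Int.fract_nonneg _
  have hw1 : w ≤ 1 := (Int.fract_lt_one _).le
  have h1 := hG.laxScheme_add_le hf hper t₀ hε j N (fun i => x - w + i * ε * w)
  have h2 := minChain_add t₀ hξ j N hj
  have hp : laxScheme G t₀ ε f j (x - w) = laxScheme G t₀ ε f j (ξ j) := by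
    have := (hG.laxScheme_regular hf hper t₀ hε j).2.int_mul ⌊x - ξ j⌋ (ξ j)
    rw [mul_one] at this
    rw [← this]; congr 1
    rw [hw, Int.fract]; ring
  simp only [hN, one_mul, sub_add_cancel, Nat.cast_zero, zero_mul, add_zero, hp] at h1
  rw [h2] at h1
  have h3 := le_of_add_le_add_left h1
  have h4 : ∑ i ∈ Finset.range N, ε * lagrangian G (t₀ + (j + i : ℕ) * ε)
      (x - w + (i + 1 : ℕ) * ε * w)
      ((x - w + (i + 1 : ℕ) * ε * w - (x - w + i * ε * w)) / ε) ≤ M := by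
    have : ∀ i ∈ Finset.range N, ε * lagrangian G (t₀ + (j + i : ℕ) * ε)
      (x - w + (i + 1 : ℕ) * ε * w)
      ((x - w + (i + 1 : ℕ) * ε * w - (x - w + i * ε * w)) / ε) ≤ ε * M := by
      intro i _
      have hv : (x - w + (i + 1 : ℕ) * ε * w - (x - w + i * ε * w)) / ε = w := by
        push_cast; field_simp; ring
      rw [hv]
      gcongr
      exact (le_abs_self _).trans (hup _ _ _ (abs_le.2 ⟨by linarith, hw1⟩))
    refine (Finset.sum_le_sum this).trans ?_
    rw [Finset.sum_const, Finset.card_range, nsmul_eq_mul, ← mul_assoc, hN, one_mul]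
  -- Since the total cost is at most `M`, one step costs no more than the average; coercivity then
  -- bounds its velocity by `M + C`.
  have h5 : ∃ i ∈ Finset.range N, ε * lagrangian G (t₀ + (j + i : ℕ) * ε) (ξ (j + i + 1))
      ((ξ (j + i + 1) - ξ (j + i)) / ε) ≤ ε * M := by
    apply Finset.exists_le_of_sum_le (Finset.nonempty_range_iff.2 hN0.ne')
    rw [Finset.sum_const, Finset.card_range, nsmul_eq_mul, ← mul_assoc, hN, one_mul]
    exact h3.trans h4
  obtain ⟨i, hi, hi'⟩ := h5
  refine ⟨i, Finset.mem_range.1 hi, hmom _ _ _ ?_⟩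
  have h6 := le_of_mul_le_mul_left hi' hε
  have h7 := hlow (t₀ + (j + i : ℕ) * ε) (ξ (j + i + 1)) ((ξ (j + i + 1) - ξ (j + i)) / ε)
  linarith

/-- The momenta along minimizing chains are bounded uniformly in the step and in time. -/
theorem exists_momentum_bound (hG : IsTonelli G) (Λ : ℝ) : ∃ P, 0 < P ∧ ∃ N₀ : ℕ, 0 < N₀ ∧
    ∀ (f : ℝ → ℝ), Function.Periodic f 1 → (∀ x y, |f x - f y| ≤ Λ * |x - y|) →
      ∀ (t₀ : ℝ) (N : ℕ), N₀ ≤ N → ∀ (n : ℕ) (ξ : ℕ → ℝ), IsMinChain G t₀ (1 / N) f n ξ →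
        ∀ k < n, |chainMomentum G t₀ (1 / N) ξ k| ≤ P := by
  obtain ⟨P₀, hP₀⟩ := hG.exists_small_momentum
  obtain ⟨P, ε₀, hε₀, hE⟩ := hG.euler_bound (max P₀ Λ)
  obtain ⟨N₀, hN₀⟩ := exists_nat_gt (1 / ε₀)
  refine ⟨max P 1, by positivity, N₀ + 1, by omega, fun f hper hΛ t₀ N hN n ξ hξ k hk => ?_⟩
  refine le_trans ?_ (le_max_left _ _)
  have hNpos : (0:ℝ) < N := by exact_mod_cast (by omega : 0 < N)
  set ε : ℝ := 1 / N with hε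
  have hεpos : 0 < ε := by positivity
  have hNε : N * ε = 1 := by rw [hε]; field_simp
  have hεε : ε < ε₀ := by
    have : (N₀ : ℝ) < N := by exact_mod_cast hN
    rw [hε, div_lt_iff₀ hNpos]
    rw [div_lt_iff₀ hε₀] at hN₀
    nlinarith
  have hf : Continuous f := by
    have : LipschitzWith (Real.toNNReal Λ) f := LipschitzWith.of_dist_le_mul fun x y => by
      rw [Real.dist_eq, Real.dist_eq]
      exact (hΛ x y).trans (mul_le_mul_of_nonneg_right (Real.le_coe_toNNReal Λ) (abs_nonneg _))
    exact this.continuous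
  -- A step with a priori bounded momentum lies at most a unit of time before `k`: the initial one,
  -- bounded by the Lipschitz constant of `f`, or one found in the window of `N` steps ending at
  -- `k`.
  have hj : ∃ j ≤ k, (k - j : ℕ) ≤ N ∧ |chainMomentum G t₀ ε ξ j| ≤ max P₀ Λ := by
    rcases le_or_gt (k + 1) N with h | h
    · exact ⟨0, by omega, by omega, (hG.abs_chainMomentum_zero_le hf hper t₀ hεpos hΛ hξ
        (by omega)).trans (le_max_right _ _)⟩
    · obtain ⟨i, hi, hi'⟩ := hP₀ f hf hper t₀ ε N hεpos hNε n ξ hξ (k + 1 - N) (by omega)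
      exact ⟨k + 1 - N + i, by omega, by omega, hi'.trans (le_max_left _ _)⟩
  obtain ⟨j, hjk, hjN, hjP⟩ := hj
  have hkN : ((k - j : ℕ) : ℝ) * ε ≤ 1 := by
    rw [← hNε]; gcongr
  -- The momentum of index `k` is attached to the arrival point `ξ (k + 1)`, whence the shift of the
  -- positions by one.
  have := hE (t₀ + j * ε) ε (fun i => ξ (j + i + 1)) (fun i => chainMomentum G t₀ ε ξ (j + i))
    (k - j) hεpos hεε hkN hjP (fun i hi => ?_) (k - j) le_rfl
  · simpa only [Nat.add_sub_cancel' hjk] using this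
  · have h1 := hG.chainMomentum_succ hf hper t₀ hεpos hξ (k := j + i) (by omega)
    push_cast at h1
    rw [show t₀ + ((j:ℝ) + i) * ε = t₀ + j * ε + i * ε by ring] at h1
    refine ⟨h1, ?_⟩
    have h2 : dP G (t₀ + (j + (i + 1) : ℕ) * ε) (ξ (j + (i + 1) + 1))
        (chainMomentum G t₀ ε ξ (j + (i + 1)))
        = (ξ (j + (i + 1) + 1) - ξ (j + (i + 1))) / ε := hG.dP_momentum _ _ _
    push_cast at h2
    rw [show t₀ + ((j:ℝ) + (i + 1)) * ε = t₀ + j * ε + (i + 1) * ε by ring] at h2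
    rw [h2, mul_div_cancel₀ _ hεpos.ne']
    simp only [← add_assoc]
    ring

end IsTonelli

/-! ### Estimates uniform in the time step -/

/-- Going from `x` to `y` in `k` equal steps, the quadratic errors add up to `M * |y - x| ^ 2 / k`
and disappear in the limit. The Lipschitz constant is therefore independent of `M`. -/
theorem lipschitz_of_local_supergradient {g : ℝ → ℝ} {Λ M r : ℝ} (hr : 0 < r)
    (h : ∀ x, ∃ q, |q| ≤ Λ ∧ ∀ s, |s| ≤ r → g (x + s) ≤ g x + q * s + M * s ^ 2) (x y : ℝ) :
    |g x - g y| ≤ Λ * |x - y| := by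
  have key : ∀ x y, g y - g x ≤ Λ * |y - x| := by
    intro x y
    have hk : ∀ k : ℕ, ∀ s, |s| ≤ r → g (x + k * s) ≤ g x + k * (Λ * |s| + M * s ^ 2) := by
      intro k s hs
      induction k with
      | zero => simp
      | succ k ih =>
        obtain ⟨q, hq, hq'⟩ := h (x + k * s)
        have h1 := hq' s hs
        have h2 : q * s ≤ Λ * |s| := by
          refine (le_abs_self _).trans ?_
          rw [abs_mul]; gcongr
        rw [show x + (k + 1 : ℕ) * s = x + k * s + s by push_cast; ring]
        push_cast
        linarith
    have h1 : ∀ᶠ k : ℕ in atTop, g y - g x ≤ Λ * |y - x| + M * (y - x) ^ 2 / k := by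
      filter_upwards [tendsto_natCast_atTop_atTop.eventually_ge_atTop (|y - x| / r),
        eventually_gt_atTop 0] with k hk1 hk0
      have hk0' : (0:ℝ) < k := by exact_mod_cast hk0
      have h2 := hk k ((y - x) / k) (by
        rw [abs_div, abs_of_pos hk0', div_le_iff₀ hk0']
        rwa [div_le_iff₀ hr, mul_comm] at hk1)
      rw [mul_div_cancel₀ _ hk0'.ne', add_sub_cancel, abs_div, abs_of_pos hk0'] at h2
      have : (k : ℝ) * (Λ * (|y - x| / k) + M * ((y - x) / k) ^ 2)
          = Λ * |y - x| + M * (y - x) ^ 2 / k := by field_simp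
      linarith
    refine ge_of_tendsto ?_ h1
    have := (tendsto_const_div_atTop_nhds_zero_nat (M * (y - x) ^ 2)).const_add (Λ * |y - x|)
    simpa using this
  rw [abs_le]
  have h1 := key x y
  have h2 := key y x
  rw [abs_sub_comm] at h1
  constructor <;> linarith

theorem continuous_of_abs_sub_le {f : ℝ → ℝ} {Λ : ℝ} (h : ∀ x y, |f x - f y| ≤ Λ * |x - y|) :
    Continuous f := by
  have : LipschitzWith (Real.toNNReal Λ) f := LipschitzWith.of_dist_le_mul fun x y => by
    rw [Real.dist_eq, Real.dist_eq]
    exact (h x y).trans (mul_le_mul_of_nonneg_right (Real.le_coe_toNNReal Λ) (abs_nonneg _))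
  exact this.continuous

/-- The estimates on the discrete evolution which do not depend on the step `1 / N`. -/
structure SchemeEstimates (G : ℝ → ℝ → ℝ → ℝ) (t₀ : ℝ) (f : ℝ → ℝ) (Λ : ℝ) (N : ℕ) : Prop where
  lip : ∀ (n : ℕ) (x y : ℝ), |laxScheme G t₀ (1 / N) f n x - laxScheme G t₀ (1 / N) f n y| ≤ Λ * |x - y|
  lip_time : ∀ (n : ℕ) (x : ℝ), |laxScheme G t₀ (1 / N) f (n + 1) x - laxScheme G t₀ (1 / N) f n x|
    ≤ Λ * (1 / N)
  supergradient : ∀ n m : ℕ, 0 < m → m ≤ n → m ≤ N → ∀ x : ℝ, ∃ q : ℝ, |q| ≤ Λ ∧ ∀ h : ℝ,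
    |h| ≤ m * (1 / N) → laxScheme G t₀ (1 / N) f n (x + h) ≤
      laxScheme G t₀ (1 / N) f n x + q * h + Λ * (1 + 1 / (m * (1 / N))) * h ^ 2
  upper : ∀ (n m : ℕ) (x v B : ℝ), (∀ t' x' : ℝ, t₀ + n * (1 / N) ≤ t' →
      t' ≤ t₀ + (n + m) * (1 / N) → |x' - x| ≤ |v| * (m * (1 / N)) → lagrangian G t' x' v ≤ B) →
    laxScheme G t₀ (1 / N) f (n + m) x ≤
      laxScheme G t₀ (1 / N) f n (x - m * (1 / N) * v) + m * (1 / N) * B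
  lower : ∀ (n m : ℕ) (x p B : ℝ), (∀ t' x' : ℝ, t₀ + n * (1 / N) ≤ t' →
      t' ≤ t₀ + (n + m) * (1 / N) → |x' - x| ≤ Λ * (m * (1 / N)) → G t' x' p ≤ B) →
    ∃ v, |v| ≤ Λ ∧ laxScheme G t₀ (1 / N) f n (x - m * (1 / N) * v)
      + m * (1 / N) * (p * v - B) ≤ laxScheme G t₀ (1 / N) f (n + m) x

namespace IsTonelli

variable {G : ℝ → ℝ → ℝ → ℝ}

/-- The last `m` steps of a minimizing chain are tilted linearly, so that the end moves by `h` while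
the point `m` steps earlier is fixed. With `τ = m * ε` the velocities change by `h / τ`; over a time
`τ` this costs `C * h ^ 2 / τ`, the usual regularizing rate. -/
theorem laxScheme_supergradient (hG : IsTonelli G) {P V C D : ℝ} {f : ℝ → ℝ} (hf : Continuous f)
    (hper : Function.Periodic f 1) (t₀ : ℝ) {ε : ℝ} (hε : 0 < ε) (hC : 0 < C)
    (hQ : ∀ t x x' v v', |v| ≤ V + 1 → |v'| ≤ V + 1 →
      lagrangian G t x' v' ≤ lagrangian G t x v + momentum G t x v * (v' - v)
        - dX G t x (momentum G t x v) * (x' - x) + C * ((x' - x) ^ 2 + (v' - v) ^ 2))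
    (hD : ∀ t x p, |p| ≤ P → |dX G t x p| ≤ D) {n : ℕ} {ξ : ℕ → ℝ}
    (hξ : IsMinChain G t₀ ε f n ξ) (hP : ∀ k < n, |chainMomentum G t₀ ε ξ k| ≤ P)
    (hV : ∀ k < n, |(ξ (k + 1) - ξ k) / ε| ≤ V) {m : ℕ} (hm : 0 < m) (hmn : m ≤ n)
    (hm1 : m * ε ≤ 1) : ∃ q, |q| ≤ P + D ∧ ∀ h, |h| ≤ m * ε →
      laxScheme G t₀ ε f n (ξ n + h) ≤ laxScheme G t₀ ε f n (ξ n) + q * h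
        + C * (1 + 1 / (m * ε)) * h ^ 2 := by
  obtain ⟨j, rfl⟩ := Nat.exists_eq_add_of_le' hmn
  have hm0 : (0:ℝ) < m := by exact_mod_cast hm
  set τ := m * ε with hτ
  have hτ0 : 0 < τ := by positivity
  set p : ℕ → ℝ := fun i => chainMomentum G t₀ ε ξ (j + i) with hp
  set d : ℕ → ℝ := fun i => dX G (t₀ + (j + i : ℕ) * ε) (ξ (j + i + 1)) (p i) with hd
  have hpi : ∀ i ∈ Finset.range m, |p i| ≤ P := fun i hi =>
    hP _ (by have := Finset.mem_range.1 hi; omega)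
  have hmτ : ∑ i ∈ Finset.range m, ε = τ := by simp [hτ]
  have hfrac : ∀ i ∈ Finset.range m, ((i + 1 : ℕ) : ℝ) / m ≤ 1 := fun i hi => by
    rw [div_le_one hm0]; exact_mod_cast Finset.mem_range.1 hi
  refine ⟨∑ i ∈ Finset.range m, ε * (p i / τ - d i * ((i + 1 : ℕ) / m)), ?_, fun h hh => ?_⟩
  · have hle : ∀ i ∈ Finset.range m, |ε * (p i / τ - d i * ((i + 1 : ℕ) / m))|
        ≤ ε * (P / τ + D) := by
      intro i hi
      rw [abs_mul, abs_of_pos hε]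
      gcongr
      refine (abs_sub _ _).trans (add_le_add ?_ ?_)
      · rw [abs_div, abs_of_pos hτ0]; gcongr; exact hpi i hi
      · rw [abs_mul]
        have h1 := hD (t₀ + (j + i : ℕ) * ε) (ξ (j + i + 1)) (p i) (hpi i hi)
        have h2 : |(((i + 1 : ℕ) : ℝ) / m)| ≤ 1 := by
          rw [abs_of_nonneg (by positivity)]; exact hfrac i hi
        calc _ ≤ D * 1 := mul_le_mul h1 h2 (abs_nonneg _) ((abs_nonneg _).trans h1)
          _ = D := mul_one D
    refine (Finset.abs_sum_le_sum_abs _ _).trans ((Finset.sum_le_sum hle).trans ?_)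
    rw [← Finset.sum_mul, hmτ, mul_add, mul_div_cancel₀ _ hτ0.ne']
    have hD0 : 0 ≤ D := (abs_nonneg _).trans (hD 0 0 (p 0) (hpi 0 (Finset.mem_range.2 hm)))
    nlinarith
  · have h1 := hG.laxScheme_add_le hf hper t₀ hε j m (fun i => ξ (j + i) + i / m * h)
    have h2 := minChain_add t₀ hξ j m le_rfl
    simp only [div_self hm0.ne', one_mul, Nat.cast_zero, zero_div, zero_mul, add_zero] at h1
    have hhτ : |h / τ| ≤ 1 := by rw [abs_div, abs_of_pos hτ0, div_le_one hτ0]; exact hh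
    have hterm : ∀ i ∈ Finset.range m, ε * lagrangian G (t₀ + (j + i : ℕ) * ε)
        (ξ (j + (i + 1)) + (i + 1 : ℕ) / m * h)
        ((ξ (j + (i + 1)) + (i + 1 : ℕ) / m * h - (ξ (j + i) + i / m * h)) / ε)
        ≤ ε * lagrangian G (t₀ + (j + i : ℕ) * ε) (ξ (j + i + 1))
          ((ξ (j + i + 1) - ξ (j + i)) / ε) + (ε * (p i / τ - d i * ((i + 1 : ℕ) / m))) * h
          + ε * (C * (1 + 1 / τ ^ 2) * h ^ 2) := by
      intro i hi
      have hin : j + i < j + m := by have := Finset.mem_range.1 hi; omega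
      set v := (ξ (j + i + 1) - ξ (j + i)) / ε with hv
      have ev : (ξ (j + (i + 1)) + (i + 1 : ℕ) / m * h - (ξ (j + i) + i / m * h)) / ε
          = v + h / τ := by
        rw [hv, hτ, ← add_assoc]; push_cast; field_simp; ring
      have hvV := hV (j + i) hin
      have q := hQ (t₀ + (j + i : ℕ) * ε) (ξ (j + i + 1)) (ξ (j + i + 1) + (i + 1 : ℕ) / m * h) v
        (v + h / τ) (by linarith) ((abs_add_le _ _).trans (by linarith))
      have hsq : (((i + 1 : ℕ) : ℝ) / m * h) ^ 2 ≤ h ^ 2 := by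
        rw [mul_pow]
        have : (((i + 1 : ℕ) : ℝ) / m) ^ 2 ≤ 1 := pow_le_one₀ (by positivity) (hfrac i hi)
        nlinarith [sq_nonneg h]
      rw [ev, ← add_assoc]
      have hpm : momentum G (t₀ + (j + i : ℕ) * ε) (ξ (j + i + 1)) v = p i := rfl
      rw [hpm] at q
      change _ ≤ _ - d i * _ + _ at q
      rw [add_sub_cancel_left, add_sub_cancel_left] at q
      have e2 : (h / τ) ^ 2 = 1 / τ ^ 2 * h ^ 2 := by ring
      rw [e2] at q
      have q2 : lagrangian G (t₀ + (j + i : ℕ) * ε) (ξ (j + i + 1) + (i + 1 : ℕ) / m * h)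
          (v + h / τ) ≤ lagrangian G (t₀ + (j + i : ℕ) * ε) (ξ (j + i + 1)) v
          + (p i / τ - d i * ((i + 1 : ℕ) / m)) * h + C * (1 + 1 / τ ^ 2) * h ^ 2 := by
        have := mul_le_mul_of_nonneg_left hsq hC.le
        have e3 : p i * (h / τ) = p i / τ * h := by ring
        rw [e3] at q
        linarith
      have := mul_le_mul_of_nonneg_left q2 hε.le
      linarith
    have h3 := h1.trans (add_le_add_right (Finset.sum_le_sum hterm) _)
    rw [Finset.sum_add_distrib, Finset.sum_add_distrib, ← Finset.sum_mul, ← Finset.sum_mul, hmτ,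
      ← add_assoc, ← add_assoc, ← h2] at h3
    refine h3.trans (add_le_add le_rfl ?_)
    have e4 : τ * (C * (1 + 1 / τ ^ 2) * h ^ 2) = C * (τ + 1 / τ) * h ^ 2 := by field_simp
    rw [e4]
    gcongr

/-- The bound `P` on the momenta bounds the velocities and `∂ₓG` along minimizing chains, so every
constant depends only on `G` and `Λ₀`. One `Λ` is taken large enough for all the estimates. -/
theorem exists_schemeEstimates (hG : IsTonelli G) (Λ₀ : ℝ) : ∃ Λ : ℝ, 0 < Λ ∧ ∃ N₀ : ℕ, 0 < N₀ ∧
    ∀ (f : ℝ → ℝ), Function.Periodic f 1 → (∀ x y, |f x - f y| ≤ Λ₀ * |x - y|) →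
      ∀ (t₀ : ℝ) (N : ℕ), N₀ ≤ N → SchemeEstimates G t₀ f Λ N := by
  obtain ⟨P, hP, N₀, hN₀, hPb⟩ := hG.exists_momentum_bound Λ₀
  obtain ⟨V, hV, hVb⟩ := hG.biperiodic_dP.exists_norm_le hG.contDiff_dP.continuous P
  obtain ⟨D, hD, hDb⟩ := hG.biperiodic_dX.exists_norm_le hG.contDiff_dX.continuous P
  obtain ⟨C, hC, hQ⟩ := hG.exists_lagrangian_le_quadratic (V + 1)
  obtain ⟨M, hM, hMb⟩ := hG.biperiodic_lagrangian.exists_norm_le hG.continuous_lagrangian V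
  set Λ₁ := max Λ₀ (P + D) with hΛ₁
  have hΛ₁0 : 0 < Λ₁ := lt_max_of_lt_right (by positivity)
  refine ⟨Λ₁ + C + V + (M + Λ₁ * V), by positivity, N₀, hN₀, fun f hper hLip t₀ N hN => ?_⟩
  have hMV : 0 < M + Λ₁ * V := by positivity
  have hf : Continuous f := continuous_of_abs_sub_le hLip
  have hN0 : (0:ℝ) < N := by exact_mod_cast (by omega : 0 < N)
  have hNε : (N:ℝ) * (1 / N) = 1 := by field_simp
  have hε : (0:ℝ) < 1 / N := by positivity
  set ε : ℝ := 1 / N with hεdef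
  have hvel : ∀ n ξ, IsMinChain G t₀ ε f n ξ → ∀ k < n, |(ξ (k + 1) - ξ k) / ε| ≤ V := by
    intro n ξ hξ k hk
    have := hVb (t₀ + k * ε) (ξ (k + 1)) _ (hPb f hper hLip t₀ N hN n ξ hξ k hk)
    rwa [chainMomentum, hG.dP_momentum] at this
  have hsup : ∀ n m : ℕ, 0 < m → m ≤ n → m ≤ N → ∀ x : ℝ, ∃ q : ℝ, |q| ≤ P + D ∧ ∀ h,
      |h| ≤ m * ε → laxScheme G t₀ ε f n (x + h) ≤
      laxScheme G t₀ ε f n x + q * h + C * (1 + 1 / (m * ε)) * h ^ 2 := by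
    intro n m hm hmn hmN x
    obtain ⟨ξ, hξ, hch⟩ := hG.exists_minChain hf hper t₀ hε n x
    rw [← hξ]
    exact hG.laxScheme_supergradient hf hper t₀ hε hC hQ hDb hch
      (hPb f hper hLip t₀ N hN n ξ hch) (hvel n ξ hch) hm hmn
      (by rw [← hNε]; gcongr)
  have hlip : ∀ n x y, |laxScheme G t₀ ε f n x - laxScheme G t₀ ε f n y| ≤ Λ₁ * |x - y| := by
    intro n x y
    rcases Nat.eq_zero_or_pos n with rfl | hn
    · exact (hLip x y).trans (by gcongr; exact le_max_left _ _)
    -- With a single step the quadratic constant grows like `N`, but only the slope bound `P + D`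
    -- enters the Lipschitz constant.
    · refine (lipschitz_of_local_supergradient (Λ := P + D) (r := ((1:ℕ):ℝ) * ε) (by simpa using hε)
        (hsup n 1 one_pos hn (by omega)) x y).trans ?_
      gcongr
      exact le_max_right _ _
  have hlow : ∀ n m x, ∃ ξ : ℕ → ℝ, ξ (n + m) = x ∧ (∀ i ≤ m, |ξ (n + i) - x| ≤ V * (m * ε)) ∧
      |x - ξ n| ≤ V * (m * ε) ∧ laxScheme G t₀ ε f (n + m) x = laxScheme G t₀ ε f n (ξ n) +
      ∑ i ∈ Finset.range m, ε * lagrangian G (t₀ + (n + i : ℕ) * ε) (ξ (n + i + 1))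
        ((ξ (n + i + 1) - ξ (n + i)) / ε) := by
    intro n m x
    obtain ⟨ξ, hξ, hch⟩ := hG.exists_minChain hf hper t₀ hε (n + m) x
    have hd : ∀ i ≤ m, |ξ (n + m) - ξ (n + m - i)| ≤ V * (i * ε) := by
      intro i
      induction i with
      | zero => simp
      | succ i ih =>
        intro hi
        have h1 := ih (by omega)
        have h2 := hvel _ ξ hch (n + m - (i + 1)) (by omega)
        rw [show n + m - (i + 1) + 1 = n + m - i by omega, abs_div, abs_of_pos hε,
          div_le_iff₀ hε] at h2
        have h3 := abs_sub_le (ξ (n + m)) (ξ (n + m - i)) (ξ (n + m - (i + 1)))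
        push_cast
        linarith
    have hd' : ∀ i ≤ m, |ξ (n + i) - x| ≤ V * (m * ε) := by
      intro i hi
      have := hd (m - i) (by omega)
      rw [show n + m - (m - i) = n + i by omega, hξ, abs_sub_comm] at this
      refine this.trans ?_
      gcongr
      omega
    refine ⟨ξ, hξ, hd', ?_, ?_⟩
    · have := hd' 0 (by omega)
      rwa [add_zero, abs_sub_comm] at this
    · have := minChain_add t₀ hch n m le_rfl
      rwa [hξ] at this
  refine ⟨fun n x y => (hlip n x y).trans (by gcongr; linarith), ?_, ?_, ?_, ?_⟩
  · intro n x
    have h1 := hG.laxScheme_succ_le hf hper t₀ hε n x x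
    rw [sub_self, zero_div] at h1
    have h2 := (le_abs_self _).trans (hMb (t₀ + n * ε) x 0 (by simpa using hV.le))
    obtain ⟨ξ, hξ, -, hdist, heq⟩ := hlow n 1 x
    rw [Finset.sum_range_one, add_zero] at heq
    have hξV := hdist
    rw [Nat.cast_one, one_mul] at hdist
    have h3 := neg_le_of_abs_le (hMb (t₀ + n * ε) (ξ (n + 1)) ((ξ (n + 1) - ξ n) / ε) (by
      rw [hξ, abs_div, abs_of_pos hε, div_le_iff₀ hε]; exact hdist))
    have h4 := neg_le_of_abs_le (hlip n (ξ n) x)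
    rw [abs_sub_comm] at h4
    have h5 : Λ₁ * |x - ξ n| ≤ Λ₁ * (V * ε) := by gcongr
    have h6 := mul_le_mul_of_nonneg_left h2 hε.le
    have h7 := mul_le_mul_of_nonneg_left h3 hε.le
    have h8 : 0 ≤ ε * (Λ₁ + C + V) := by positivity
    have h9 : 0 ≤ ε * (Λ₁ * V) := by positivity
    rw [abs_le]
    constructor
    · rw [heq]; linarith
    · linarith
  · intro n m hm hmn hmN x
    obtain ⟨q, hq, hq'⟩ := hsup n m hm hmn hmN x
    refine ⟨q, hq.trans ?_, fun h hh => (hq' h hh).trans ?_⟩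
    · have := le_max_right Λ₀ (P + D); linarith
    · gcongr; linarith
  · intro n m x v B hB
    -- The competitor is the straight chain of velocity `v` arriving at `x`.
    have h1 := hG.laxScheme_add_le hf hper t₀ hε n m (fun i => x - (m - i) * ε * v)
    simp only [sub_self, zero_mul, sub_zero, Nat.cast_zero] at h1
    refine h1.trans (add_le_add le_rfl ?_)
    have : ∀ i ∈ Finset.range m, ε * lagrangian G (t₀ + (n + i : ℕ) * ε)
        (x - (m - (i + 1 : ℕ)) * ε * v)
        ((x - (m - (i + 1 : ℕ)) * ε * v - (x - (m - i) * ε * v)) / ε) ≤ ε * B := by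
      intro i hi
      have him : ((i : ℝ) + 1) ≤ m := by exact_mod_cast Finset.mem_range.1 hi
      have hv : (x - (m - (i + 1 : ℕ)) * ε * v - (x - (m - i) * ε * v)) / ε = v := by
        push_cast; field_simp; ring
      rw [hv]
      gcongr
      apply hB
      · push_cast
        have : 0 ≤ (i:ℝ) * ε := by positivity
        linarith
      · push_cast
        gcongr
        exact (Finset.mem_range.1 hi).le
      · rw [sub_sub_cancel_left, abs_neg, abs_mul, mul_comm]
        gcongr
        push_cast
        rw [abs_of_nonneg (by have : 0 ≤ (m:ℝ) - (i + 1) := by linarith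
                              positivity)]
        gcongr
        linarith [(Nat.cast_nonneg i : (0:ℝ) ≤ i)]
    refine (Finset.sum_le_sum this).trans_eq ?_
    rw [Finset.sum_const, Finset.card_range, nsmul_eq_mul, mul_assoc]
  · intro n m x p B hB
    obtain ⟨ξ, hξ, hξi, hdist, heq⟩ := hlow n m x
    rcases Nat.eq_zero_or_pos m with rfl | hm
    · exact ⟨0, by simp; positivity, by simp⟩
    have hm0 : (0:ℝ) < m := by exact_mod_cast hm
    have hτ : 0 < m * ε := by positivity
    -- The witness is the mean velocity of the minimizing chain: after Fenchel's inequality with the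
    -- fixed slope `p`, the terms linear in the velocity telescope.
    refine ⟨(x - ξ n) / (m * ε), ?_, ?_⟩
    · rw [abs_div, abs_of_pos hτ, div_le_iff₀ hτ]
      refine hdist.trans ?_
      gcongr
      linarith
    · rw [mul_div_cancel₀ _ hτ.ne', sub_sub_cancel, heq]
      refine add_le_add le_rfl ?_
      have e1 : m * ε * (p * ((x - ξ n) / (m * ε)) - B) =
          ∑ i ∈ Finset.range m, (p * (ξ (n + (i + 1)) - ξ (n + i)) - ε * B) := by
        rw [Finset.sum_sub_distrib, ← Finset.mul_sum,
          Finset.sum_range_sub (fun i => ξ (n + i)), hξ, Finset.sum_const, Finset.card_range,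
          nsmul_eq_mul, add_zero]
        field_simp
      rw [e1]
      refine Finset.sum_le_sum fun i hi => ?_
      have him : ((i : ℝ) + 1) ≤ m := by exact_mod_cast Finset.mem_range.1 hi
      have hfen := hG.fenchel (t₀ + (n + i : ℕ) * ε) (ξ (n + i + 1)) p
        ((ξ (n + i + 1) - ξ (n + i)) / ε)
      have hGB := hB (t₀ + (n + i : ℕ) * ε) (ξ (n + i + 1)) (by
          push_cast
          have : 0 ≤ (i:ℝ) * ε := by positivity
          linarith) (by push_cast; gcongr; exact (Finset.mem_range.1 hi).le) (by
          refine (hξi (i + 1) (by have := Finset.mem_range.1 hi; omega)).trans ?_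
          gcongr
          linarith)
      have h1 := mul_le_mul_of_nonneg_left (sub_le_iff_le_add.1 hfen) hε.le
      have h2 := mul_le_mul_of_nonneg_left hGB hε.le
      have e2 : ε * (p * ((ξ (n + i + 1) - ξ (n + i)) / ε)) = p * (ξ (n + i + 1) - ξ (n + i)) := by
        field_simp
      rw [← add_assoc]
      linarith

end IsTonelli

/-! ### The continuous-time limit -/

/-- The properties of the limit of the discrete Lax–Oleinik evolution of `f`: it is Lipschitz,
semiconcave at positive times, and satisfies infinitesimal forms of the two inequalities in the
dynamic programming principle. -/
structure IsLaxOleinik (G : ℝ → ℝ → ℝ → ℝ) (t₀ : ℝ) (f : ℝ → ℝ) (Λ : ℝ) (u : ℝ → ℝ → ℝ) :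
    Prop where
  pos : 0 < Λ
  init : ∀ x, u t₀ x = f x
  periodic : ∀ t, t₀ ≤ t → Function.Periodic (u t) 1
  lip : ∀ t, t₀ ≤ t → ∀ x y, |u t x - u t y| ≤ Λ * |x - y|
  lip_time : ∀ s t, t₀ ≤ s → t₀ ≤ t → ∀ x, |u s x - u t x| ≤ Λ * |s - t|
  semiconcave : ∀ t, t₀ < t → ∀ x, ∃ q, |q| ≤ Λ ∧
    ∀ h, u t (x + h) ≤ u t x + q * h + Λ * (1 + 1 / (t - t₀)) * h ^ 2
  upper : ∀ t x p η, t₀ ≤ t → 0 < η → ∃ δ, 0 < δ ∧ ∀ s s' x', t₀ ≤ s → s < s' → |s - t| ≤ δ →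
    |s' - t| ≤ δ → |x' - x| ≤ δ → u s' x' ≤ u s (x' - (s' - s) * dP G t x p)
      + (s' - s) * (p * dP G t x p - G t x p + η)
  lower : ∀ t x p η, t₀ ≤ t → 0 < η → ∃ δ, 0 < δ ∧ ∀ s s' x', t₀ ≤ s → s < s' → |s - t| ≤ δ →
    |s' - t| ≤ δ → |x' - x| ≤ δ → ∃ v, |v| ≤ Λ ∧ u s (x' - (s' - s) * v)
      + (s' - s) * (p * v - G t x p - η) ≤ u s' x'

theorem exists_tendsto_of_eventually_bounded {α : Type*} (U : Ultrafilter α) {s : α → ℝ} {B : ℝ}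
    (h : ∀ᶠ n in (U : Filter α), |s n| ≤ B) : ∃ a, Tendsto s U (𝓝 a) := by
  have h1 : ((U.map s : Ultrafilter ℝ) : Filter ℝ) ≤ 𝓟 (Icc (-B) B) := by
    rw [le_principal_iff]
    exact h.mono fun n hn => abs_le.1 hn
  obtain ⟨a, -, ha⟩ := isCompact_Icc.ultrafilter_le_nhds (U.map s) h1
  exact ⟨a, ha⟩

/-- The number of steps of length `1 / N` between the times `t₀` and `t`. -/
def stepCount (t₀ t : ℝ) (N : ℕ) : ℕ := ⌊(t - t₀) * N⌋₊

theorem stepCount_le {t₀ t : ℝ} (ht : t₀ ≤ t) {N : ℕ} (hN : 0 < N) :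
    stepCount t₀ t N * (1 / N : ℝ) ≤ t - t₀ := by
  have hN' : (0:ℝ) < N := by exact_mod_cast hN
  have := Nat.floor_le (mul_nonneg (sub_nonneg.2 ht) hN'.le)
  rw [mul_one_div, div_le_iff₀ hN']
  exact this

theorem lt_stepCount {t₀ t : ℝ} {N : ℕ} (hN : 0 < N) :
    t - t₀ < stepCount t₀ t N * (1 / N : ℝ) + 1 / N := by
  have hN' : (0:ℝ) < N := by exact_mod_cast hN
  have := Nat.lt_floor_add_one ((t - t₀) * N)
  have e : (stepCount t₀ t N * (1 / N : ℝ) + 1 / N) = (stepCount t₀ t N + 1) / N := by ring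
  rw [e, lt_div_iff₀ hN']
  exact this

theorem stepCount_mono {t₀ s t : ℝ} (h : s ≤ t) (N : ℕ) : stepCount t₀ s N ≤ stepCount t₀ t N :=
  Nat.floor_le_floor (by gcongr)

theorem tendsto_stepCount {t₀ t : ℝ} (ht : t₀ ≤ t) :
    Tendsto (fun N : ℕ => stepCount t₀ t N * (1 / N : ℝ)) atTop (𝓝 (t - t₀)) := by
  have h1 : Tendsto (fun N : ℕ => (t - t₀) - 1 / (N : ℝ)) atTop (𝓝 (t - t₀)) := by
    simpa using tendsto_one_div_atTop_nhds_zero_nat.const_sub (t - t₀)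
  refine tendsto_of_tendsto_of_tendsto_of_le_of_le' h1 tendsto_const_nhds ?_ ?_
  · filter_upwards [eventually_gt_atTop 0] with N hN
    have := lt_stepCount (t₀ := t₀) (t := t) hN
    linarith
  · filter_upwards [eventually_gt_atTop 0] with N hN using stepCount_le ht hN

theorem SchemeEstimates.abs_sub_steps_le {G : ℝ → ℝ → ℝ → ℝ} {t₀ Λ : ℝ} {f : ℝ → ℝ} {N : ℕ}
    (h : SchemeEstimates G t₀ f Λ N) (n m : ℕ) (x : ℝ) :
    |laxScheme G t₀ (1 / N) f (n + m) x - laxScheme G t₀ (1 / N) f n x|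
      ≤ Λ * (m * (1 / N)) := by
  induction m with
  | zero => simp
  | succ m ih =>
    have h1 := h.lip_time (n + m) x
    have h2 := abs_sub_le (laxScheme G t₀ (1 / N) f (n + (m + 1)) x)
      (laxScheme G t₀ (1 / N) f (n + m) x) (laxScheme G t₀ (1 / N) f n x)
    rw [← add_assoc] at *
    push_cast
    linarith

/-- Along a free ultrafilter all bounded sequences converge, so the limit exists at every point
without extracting subsequences. The supergradients and the velocities depending on `N` are bounded
and converge along it too. -/
theorem IsTonelli.exists_isLaxOleinik {G : ℝ → ℝ → ℝ → ℝ} (hG : IsTonelli G) (t₀ : ℝ) {f : ℝ → ℝ}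
    {Λ₀ : ℝ} (hper : Function.Periodic f 1) (hf : ∀ x y, |f x - f y| ≤ Λ₀ * |x - y|) :
    ∃ u Λ, IsLaxOleinik G t₀ f Λ u := by
  obtain ⟨Λ, hΛ, N₀, hN₀, hS⟩ := hG.exists_schemeEstimates Λ₀
  have hfc := continuous_of_abs_sub_le hf
  set U : Ultrafilter ℕ := hyperfilter ℕ with hU
  have hUle : (U : Filter ℕ) ≤ atTop := by
    rw [hU, ← Nat.cofinite_eq_atTop]; exact hyperfilter_le_cofinite
  have hev : ∀ᶠ N in (U : Filter ℕ), N₀ ≤ N := hUle (eventually_ge_atTop N₀)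
  have hpos : ∀ᶠ N : ℕ in (U : Filter ℕ), 0 < N := hUle (eventually_gt_atTop 0)
  have hεlim : Tendsto (fun N : ℕ => (1 / N : ℝ)) U (𝓝 0) :=
    tendsto_one_div_atTop_nhds_zero_nat.mono_left hUle
  have hclim : ∀ t, t₀ ≤ t → Tendsto (fun N : ℕ => stepCount t₀ t N * (1 / N : ℝ)) U
    (𝓝 (t - t₀)) := fun t ht => (tendsto_stepCount ht).mono_left hUle
  set w : ℕ → ℝ → ℝ → ℝ := fun N t x => laxScheme G t₀ (1 / N) f (stepCount t₀ t N) x with hw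
  have hex : ∀ t x, ∃ a, t₀ ≤ t → Tendsto (fun N => w N t x) U (𝓝 a) := by
    intro t x
    by_cases ht : t₀ ≤ t
    · obtain ⟨a, ha⟩ := exists_tendsto_of_eventually_bounded U (s := fun N => w N t x)
        (B := |f x| + Λ * (t - t₀)) (by
          filter_upwards [hev, hpos] with N hN hN0
          have h1 := (hS f hper hf t₀ N hN).abs_sub_steps_le 0 (stepCount t₀ t N) x
          rw [zero_add] at h1
          have h2 := mul_le_mul_of_nonneg_left (stepCount_le ht hN0) hΛ.le
          have h3 := abs_sub_abs_le_abs_sub (w N t x) (f x)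
          change |w N t x - f x| ≤ _ at h1
          linarith)
      exact ⟨a, fun _ => ha⟩
    · exact ⟨0, fun h => absurd h ht⟩
  choose u hu using hex
  have hlip : ∀ t, t₀ ≤ t → ∀ x y, |u t x - u t y| ≤ Λ * |x - y| := fun t ht x y => by
    refine le_of_tendsto ((hu t x ht).sub (hu t y ht)).abs ?_
    filter_upwards [hev] with N hN using (hS f hper hf t₀ N hN).lip _ x y
  -- The uniform Lipschitz bound allows the evaluation point to vary with `N`.
  have hmove : ∀ t, t₀ ≤ t → ∀ (y : ℕ → ℝ) (z : ℝ), Tendsto y U (𝓝 z) →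
      Tendsto (fun N => w N t (y N)) U (𝓝 (u t z)) := by
    intro t ht y z hy
    have h1 : Tendsto (fun N => w N t (y N) - w N t z) U (𝓝 0) := by
      have h2 : Tendsto (fun N => Λ * |y N - z|) U (𝓝 0) := by
        simpa using ((hy.sub_const z).abs).const_mul Λ
      refine squeeze_zero_norm' ?_ h2
      filter_upwards [hev] with N hN
      exact (hS f hper hf t₀ N hN).lip _ _ _
    simpa using h1.add (hu t z ht)
  refine ⟨u, 2 * Λ + 2 * Λ, by positivity, fun x => ?_, fun t ht x => ?_, fun t ht x y => ?_,
    fun s t hs ht x => ?_, fun t ht x => ?_, fun t x p η ht hη => ?_, fun t x p η ht hη => ?_⟩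
  · refine tendsto_nhds_unique (hu t₀ x le_rfl) (tendsto_const_nhds.congr fun N => ?_)
    simp [hw, stepCount, laxScheme]
  · refine tendsto_nhds_unique (hu t _ ht) ((hu t x ht).congr' ?_)
    filter_upwards [hpos] with N hN
    exact ((hG.laxScheme_regular hfc hper t₀ (ε := 1 / N)
      (by have : (0:ℝ) < N := by exact_mod_cast hN
          positivity) _).2 x).symm
  · exact (hlip t ht x y).trans (by gcongr; linarith)
  · suffices H : ∀ s t, t₀ ≤ s → s ≤ t → |u t x - u s x| ≤ Λ * |t - s| by
      rcases le_total s t with h | h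
      · rw [abs_sub_comm, abs_sub_comm s t]
        exact (H s t hs h).trans (by gcongr; linarith)
      · exact (H t s ht h).trans (by gcongr; linarith)
    intro s t hs hst
    have ht := hs.trans hst
    rw [abs_of_nonneg (sub_nonneg.2 hst)]
    have hlim : Tendsto (fun N : ℕ => Λ * (stepCount t₀ t N * (1 / N : ℝ)
        - stepCount t₀ s N * (1 / N : ℝ))) U (𝓝 (Λ * (t - s))) := by
      have := ((hclim t ht).sub (hclim s hs)).const_mul Λ
      rwa [sub_sub_sub_cancel_right] at this
    refine le_of_tendsto_of_tendsto ((hu t x ht).sub (hu s x hs)).abs hlim ?_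
    filter_upwards [hev] with N hN
    obtain ⟨m, hm⟩ := Nat.exists_eq_add_of_le (stepCount_mono (t₀ := t₀) hst N)
    have := (hS f hper hf t₀ N hN).abs_sub_steps_le (stepCount t₀ s N) m x
    simp only [hw, hm]
    push_cast
    rwa [add_mul, add_sub_cancel_left]
  -- The discrete supergradient inequality reaches back at most a unit of time and holds for
  -- displacements up to the time used.
  · set τ := min (t - t₀) 1 with hτ
    have hτ0 : 0 < τ := lt_min (by linarith) one_pos
    set m : ℕ → ℕ := fun N => min (stepCount t₀ t N) N with hm
    have hmlim : Tendsto (fun N => (m N : ℝ) * (1 / N : ℝ)) U (𝓝 τ) := by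
      refine ((hclim t ht.le).min (tendsto_const_nhds (x := (1:ℝ)))).congr' ?_
      filter_upwards [hpos] with N hN
      have hN' : (0:ℝ) < N := by exact_mod_cast hN
      rw [hm]
      push_cast
      rw [min_mul_of_nonneg _ _ (by positivity), mul_one_div_cancel hN'.ne']
    have hmpos : ∀ᶠ N in (U : Filter ℕ), 0 < m N := by
      filter_upwards [hmlim.eventually (lt_mem_nhds hτ0)] with N hN
      refine Nat.pos_of_ne_zero fun h => ?_
      simp [h] at hN
    have hq : ∀ N, ∃ q, N₀ ≤ N → 0 < m N → |q| ≤ Λ ∧ ∀ h, |h| ≤ m N * (1 / N : ℝ) →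
        w N t (x + h) ≤ w N t x + q * h + Λ * (1 + 1 / (m N * (1 / N : ℝ))) * h ^ 2 := by
      intro N
      by_cases hN : N₀ ≤ N ∧ 0 < m N
      · obtain ⟨q, hq⟩ := (hS f hper hf t₀ N hN.1).supergradient _ (m N) hN.2 (min_le_left _ _)
          (min_le_right _ _) x
        exact ⟨q, fun _ _ => hq⟩
      · exact ⟨0, fun h h' => absurd ⟨h, h'⟩ hN⟩
    choose Q hQ using hq
    have hQb : ∀ᶠ N in (U : Filter ℕ), |Q N| ≤ Λ := by
      filter_upwards [hev, hmpos] with N h1 h2 using (hQ N h1 h2).1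
    obtain ⟨q, hq⟩ := exists_tendsto_of_eventually_bounded U hQb
    have hqΛ : |q| ≤ Λ := le_of_tendsto hq.abs hQb
    refine ⟨q, hqΛ.trans (by linarith), fun h => ?_⟩
    have hκ : 1 / τ ≤ 1 + 1 / (t - t₀) := by
      rcases min_choice (t - t₀) 1 with h | h <;> rw [hτ, h]
      · linarith
      · have : 0 < 1 / (t - t₀) := one_div_pos.2 (by linarith)
        simp only [div_one]; linarith
    have hκ1 : 1 ≤ 1 + 1 / (t - t₀) := by
      have : 0 < 1 / (t - t₀) := one_div_pos.2 (by linarith)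
      linarith
    set κ := 1 + 1 / (t - t₀) with hκdef
    rcases lt_or_ge |h| τ with hh | hh
    · have h1 : u t (x + h) ≤ u t x + q * h + Λ * (1 + 1 / τ) * h ^ 2 := by
        refine le_of_tendsto_of_tendsto (hu t _ ht.le) (((hu t x ht.le).add (hq.mul_const h)).add
          ((((tendsto_const_nhds (x := (1:ℝ))).div hmlim hτ0.ne').const_add 1).const_mul Λ
            |>.mul_const (h ^ 2))) ?_
        filter_upwards [hev, hmpos, hmlim.eventually (lt_mem_nhds hh)] with N h1 h2 h3
        exact (hQ N h1 h2).2 h h3.le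
      refine h1.trans (add_le_add le_rfl ?_)
      gcongr ?_ * h ^ 2
      nlinarith
    -- For `|h| ≥ τ` the Lipschitz bound suffices, because then `|h| ≤ h ^ 2 / τ`.
    · have h1 := (le_abs_self _).trans (hlip t ht.le (x + h) x)
      rw [add_sub_cancel_left] at h1
      have h2 : -(Λ * |h|) ≤ q * h := by
        have := neg_abs_le (q * h)
        rw [abs_mul] at this
        have := mul_le_mul_of_nonneg_right hqΛ (abs_nonneg h)
        linarith
      have h3 : |h| ≤ κ * h ^ 2 := by
        have : |h| ≤ 1 / τ * h ^ 2 := by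
          rw [← sq_abs, div_mul_eq_mul_div, le_div_iff₀ hτ0, one_mul, sq]
          gcongr
        exact this.trans (by gcongr)
      have h4 := mul_le_mul_of_nonneg_left h3 hΛ.le
      have h5 : 0 ≤ Λ * (κ * h ^ 2) := by positivity
      linarith
  · set v := dP G t x p with hv
    have hcont : ContinuousAt (fun q : ℝ × ℝ => lagrangian G q.1 q.2 v) (t, x) :=
      (hG.continuous_lagrangian.comp (by fun_prop : Continuous fun q : ℝ × ℝ => (q.1, q.2, v))).continuousAt
    have hL : lagrangian G t x v = p * v - G t x p := hG.lagrangian_dP t x p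
    obtain ⟨δ₀, hδ₀, hδ⟩ := Metric.eventually_nhds_iff.1
      (hcont.eventually (gt_mem_nhds (lt_add_of_pos_right _ hη)))
    -- The discrete duration is at most `s' - s` plus one step, hence less than `3 * δ`; a path of
    -- velocity `v` then stays within `δ + 3 * δ * |v| < δ₀` of `x`.
    set δ := δ₀ / (4 * (1 + |v|)) with hδdef
    have hδpos : 0 < δ := by positivity
    have hδ1 : δ * (4 * (1 + |v|)) = δ₀ := by rw [hδdef]; field_simp
    have hδv : 0 ≤ δ * |v| := by positivity
    refine ⟨δ, hδpos, fun s s' x' hs hss h1 h2 h3 => ?_⟩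
    have hs' := hs.trans hss.le
    have hmlim : Tendsto (fun N : ℕ => ((stepCount t₀ s' N - stepCount t₀ s N : ℕ) : ℝ)
        * (1 / N : ℝ)) U (𝓝 (s' - s)) := by
      have := (hclim s' hs').sub (hclim s hs)
      rw [sub_sub_sub_cancel_right] at this
      refine this.congr fun N => ?_
      rw [Nat.cast_sub (stepCount_mono hss.le N)]; ring
    have hy := ((hmlim.mul_const v).const_sub x')
    refine le_of_tendsto_of_tendsto (hu s' x' hs') ((hmove s hs _ _ hy).add
      (hmlim.mul_const _)) ?_
    filter_upwards [hev, hpos, hεlim.eventually (gt_mem_nhds hδpos)] with N hN hN0 hNδ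
    have hN' : (0:ℝ) < N := by exact_mod_cast hN0
    have hsum : stepCount t₀ s N + (stepCount t₀ s' N - stepCount t₀ s N) = stepCount t₀ s' N :=
      Nat.add_sub_cancel' (stepCount_mono hss.le N)
    have hc1 := lt_stepCount (t₀ := t₀) (t := s) hN0
    have hc2 := stepCount_le hs' hN0
    have := (hS f hper hf t₀ N hN).upper (stepCount t₀ s N) (stepCount t₀ s' N - stepCount t₀ s N)
      x' v (p * v - G t x p + η) (by
        intro t' x'' ht1 ht2 hx
        have e : ((stepCount t₀ s N : ℝ) + (stepCount t₀ s' N - stepCount t₀ s N : ℕ))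
            = stepCount t₀ s' N := by exact_mod_cast hsum
        have e2 : ((stepCount t₀ s' N - stepCount t₀ s N : ℕ) : ℝ) * (1 / N)
          = stepCount t₀ s' N * (1 / N) - stepCount t₀ s N * (1 / N) := by rw [← e]; ring
        rw [e] at ht2
        rw [e2] at hx
        rw [abs_le] at h1 h2
        have hv3 : |v| * (stepCount t₀ s' N * (1 / N) - stepCount t₀ s N * (1 / N : ℝ))
            ≤ |v| * (3 * δ) := by
          gcongr; linarith
        have hx2 := abs_sub_le x'' x' x
        rw [← hL]
        refine (@hδ (t', x'') ?_).le
        rw [Prod.dist_eq, max_lt_iff, Real.dist_eq, Real.dist_eq, abs_lt]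
        exact ⟨⟨by dsimp only; linarith, by dsimp only; linarith⟩, by dsimp only; linarith⟩)
    rw [hsum] at this
    exact this
  · have hcont : ContinuousAt (fun q : ℝ × ℝ => G q.1 q.2 p) (t, x) :=
      (hG.continuous.comp (by fun_prop : Continuous fun q : ℝ × ℝ => (q.1, q.2, p))).continuousAt
    obtain ⟨δ₀, hδ₀, hδ⟩ := Metric.eventually_nhds_iff.1
      (hcont.eventually (gt_mem_nhds (lt_add_of_pos_right _ hη)))
    set δ := δ₀ / (4 * (1 + Λ)) with hδdef
    have hδpos : 0 < δ := by positivity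
    have hδ1 : δ * (4 * (1 + Λ)) = δ₀ := by rw [hδdef]; field_simp
    have hδv : 0 ≤ δ * Λ := by positivity
    refine ⟨δ, hδpos, fun s s' x' hs hss h1 h2 h3 => ?_⟩
    have hs' := hs.trans hss.le
    have hmlim : Tendsto (fun N : ℕ => ((stepCount t₀ s' N - stepCount t₀ s N : ℕ) : ℝ)
        * (1 / N : ℝ)) U (𝓝 (s' - s)) := by
      have := (hclim s' hs').sub (hclim s hs)
      rw [sub_sub_sub_cancel_right] at this
      refine this.congr fun N => ?_
      rw [Nat.cast_sub (stepCount_mono hss.le N)]; ring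
    have hvex : ∀ N : ℕ, ∃ v, N₀ ≤ N → 0 < N → 1 / (N:ℝ) < δ → |v| ≤ Λ ∧
        w N s (x' - ((stepCount t₀ s' N - stepCount t₀ s N : ℕ) : ℝ) * (1 / N) * v)
        + ((stepCount t₀ s' N - stepCount t₀ s N : ℕ) : ℝ) * (1 / N) * (p * v - (G t x p + η))
        ≤ w N s' x' := by
      intro N
      by_cases hNN : N₀ ≤ N ∧ 0 < N ∧ 1 / (N:ℝ) < δ
      swap
      · exact ⟨0, fun h1 h2 h3 => absurd ⟨h1, h2, h3⟩ hNN⟩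
      obtain ⟨hN, hN0, hNδ⟩ := hNN
      have hN' : (0:ℝ) < N := by exact_mod_cast hN0
      have hsum : stepCount t₀ s N + (stepCount t₀ s' N - stepCount t₀ s N) = stepCount t₀ s' N :=
        Nat.add_sub_cancel' (stepCount_mono hss.le N)
      have hc1 := lt_stepCount (t₀ := t₀) (t := s) hN0
      have hc2 := stepCount_le hs' hN0
      obtain ⟨v, hv⟩ := (hS f hper hf t₀ N hN).lower (stepCount t₀ s N)
        (stepCount t₀ s' N - stepCount t₀ s N) x' p (G t x p + η) (by
          intro t' x'' ht1 ht2 hx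
          have e : ((stepCount t₀ s N : ℝ) + (stepCount t₀ s' N - stepCount t₀ s N : ℕ))
              = stepCount t₀ s' N := by exact_mod_cast hsum
          have e2 : ((stepCount t₀ s' N - stepCount t₀ s N : ℕ) : ℝ) * (1 / N)
            = stepCount t₀ s' N * (1 / N) - stepCount t₀ s N * (1 / N) := by rw [← e]; ring
          rw [e] at ht2
          rw [e2] at hx
          rw [abs_le] at h1 h2
          have hv3 : Λ * (stepCount t₀ s' N * (1 / N) - stepCount t₀ s N * (1 / N : ℝ))
              ≤ Λ * (3 * δ) := by
            gcongr; linarith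
          have hx2 := abs_sub_le x'' x' x
          refine (@hδ (t', x'') ?_).le
          rw [Prod.dist_eq, max_lt_iff, Real.dist_eq, Real.dist_eq, abs_lt]
          exact ⟨⟨by dsimp only; linarith, by dsimp only; linarith⟩, by dsimp only; linarith⟩)
      rw [hsum] at hv
      exact ⟨v, fun _ _ _ => hv⟩
    choose vN hvN using hvex
    have hevδ := hεlim.eventually (gt_mem_nhds hδpos)
    have hvb : ∀ᶠ N in (U : Filter ℕ), |vN N| ≤ Λ := by
      filter_upwards [hev, hpos, hevδ] with N h1 h2 h3 using (hvN N h1 h2 h3).1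
    obtain ⟨v, hv⟩ := exists_tendsto_of_eventually_bounded U hvb
    refine ⟨v, (le_of_tendsto hv.abs hvb).trans (by linarith), ?_⟩
    have hy := ((hmlim.mul hv).const_sub x')
    have := le_of_tendsto_of_tendsto ((hmove s hs _ _ hy).add
      (hmlim.mul ((hv.const_mul p).sub_const (G t x p + η)))) (hu s' x' hs') (by
        filter_upwards [hev, hpos, hevδ] with N h1 h2 h3 using (hvN N h1 h2 h3).2)
    rwa [sub_sub]

/-! ### From dynamic programming to the equation -/

/-- Viscosity subsolutions of `∂ₜ u + G(t,x,∂ₓ u) = 0` at times after `t₀`. -/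
def IsSubsolution (G : ℝ → ℝ → ℝ → ℝ) (t₀ : ℝ) (u : ℝ → ℝ → ℝ) : Prop :=
  ∀ φ : ℝ × ℝ → ℝ, ContDiff ℝ 1 φ → ∀ t x : ℝ, t₀ < t →
    IsLocalMax (fun q : ℝ × ℝ => u q.1 q.2 - φ q) (t, x) →
    deriv (fun s => φ (s, x)) t + G t x (deriv (fun z => φ (t, z)) x) ≤ 0

/-- Viscosity supersolutions of `∂ₜ u + G(t,x,∂ₓ u) = 0` at times after `t₀`. -/
def IsSupersolution (G : ℝ → ℝ → ℝ → ℝ) (t₀ : ℝ) (u : ℝ → ℝ → ℝ) : Prop :=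
  ∀ φ : ℝ × ℝ → ℝ, ContDiff ℝ 1 φ → ∀ t x : ℝ, t₀ < t →
    IsLocalMin (fun q : ℝ × ℝ => u q.1 q.2 - φ q) (t, x) →
    0 ≤ deriv (fun s => φ (s, x)) t + G t x (deriv (fun z => φ (t, z)) x)

/-- First order expansion of a differentiable function of two variables. -/
theorem exists_first_order {φ : ℝ × ℝ → ℝ} {t x : ℝ} (hφ : DifferentiableAt ℝ φ (t, x)) {η : ℝ}
    (hη : 0 < η) : ∃ δ, 0 < δ ∧ ∀ s y, |s| ≤ δ → |y| ≤ δ →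
      |φ (t + s, x + y) - φ (t, x) - s * deriv (fun s => φ (s, x)) t
        - y * deriv (fun z => φ (t, z)) x| ≤ η * (|s| + |y|) := by
  have h1 : deriv (fun s => φ (s, x)) t = fderiv ℝ φ (t, x) (1, 0) :=
    (hφ.hasFDerivAt.comp_hasDerivAt t (f := fun s => (s, x))
      ((hasDerivAt_id t).prodMk (hasDerivAt_const t x))).deriv
  have h2 : deriv (fun z => φ (t, z)) x = fderiv ℝ φ (t, x) (0, 1) :=
    (hφ.hasFDerivAt.comp_hasDerivAt x (f := fun z => (t, z))
      ((hasDerivAt_const x t).prodMk (hasDerivAt_id x))).deriv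
  have h3 := hφ.hasFDerivAt.isLittleO.def hη
  obtain ⟨δ, hδ, h⟩ := Metric.eventually_nhds_iff.1 h3
  refine ⟨δ / 2, by positivity, fun s y hs hy => ?_⟩
  have h4 := @h (t + s, x + y) (by
    rw [Prod.dist_eq, max_lt_iff, Real.dist_eq, Real.dist_eq, add_sub_cancel_left,
      add_sub_cancel_left]
    exact ⟨by linarith, by linarith⟩)
  rw [Prod.mk_sub_mk, add_sub_cancel_left, add_sub_cancel_left,
    show ((s, y) : ℝ × ℝ) = s • (1, 0) + y • (0, 1) by simp, map_add, map_smul, map_smul,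
    smul_eq_mul, smul_eq_mul, ← h1, ← h2, Real.norm_eq_abs, ← sub_sub] at h4
  refine h4.trans ?_
  gcongr
  rw [show s • ((1:ℝ), (0:ℝ)) + y • ((0:ℝ), (1:ℝ)) = (s, y) by simp, Prod.norm_mk]
  exact max_le (by simp) (by simp)

theorem nonpos_of_forall_le_mul {a C : ℝ} (h : ∀ η, 0 < η → a ≤ η * C) : a ≤ 0 := by
  by_contra hc
  push Not at hc
  have h1 := h (a / (2 * (|C| + 1))) (by positivity)
  have h2 : a / (2 * (|C| + 1)) * C ≤ a / (2 * (|C| + 1)) * (|C| + 1) := by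
    gcongr
    linarith [le_abs_self C]
  have h3 : a / (2 * (|C| + 1)) * (|C| + 1) = a / 2 := by field_simp
  linarith

namespace IsLaxOleinik

variable {G : ℝ → ℝ → ℝ → ℝ} {t₀ Λ : ℝ} {f : ℝ → ℝ} {u : ℝ → ℝ → ℝ}

/-- A short backward path is followed with the velocity conjugate to the slope `b` of the test
function; for that velocity Fenchel's inequality is an equality. -/
theorem isSubsolution (hu : IsLaxOleinik G t₀ f Λ u) : IsSubsolution G t₀ u := by
  intro φ hφ t x ht hmax
  set b := deriv (fun z => φ (t, z)) x
  set v := dP G t x b with hv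
  refine nonpos_of_forall_le_mul (C := 2 + |v|) fun η hη => ?_
  obtain ⟨δ₁, hδ₁, h1⟩ := exists_first_order (hφ.differentiable one_ne_zero (t, x)) hη
  obtain ⟨δ₂, hδ₂, h2⟩ := hu.upper t x b η ht.le hη
  obtain ⟨δ₃, hδ₃, h3⟩ := Metric.eventually_nhds_iff.1 hmax
  set m := min (min δ₁ δ₂) (min δ₃ (t - t₀)) with hm
  have hm0 : 0 < m := by
    have := sub_pos.2 ht
    positivity
  set h := m / (2 * (1 + |v|)) with hh
  have hh0 : 0 < h := by positivity
  have hhm : h * (1 + |v|) = m / 2 := by rw [hh]; field_simp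
  have hhv : 0 ≤ h * |v| := by positivity
  have hmδ₁ : m ≤ δ₁ := (min_le_left _ _).trans (min_le_left _ _)
  have hmδ₂ : m ≤ δ₂ := (min_le_left _ _).trans (min_le_right _ _)
  have hmδ₃ : m ≤ δ₃ := (min_le_right _ _).trans (min_le_left _ _)
  have hmt : m ≤ t - t₀ := (min_le_right _ _).trans (min_le_right _ _)
  have e1 := h1 (-h) (-(h * v)) (by rw [abs_neg, abs_of_pos hh0]; linarith)
    (by rw [abs_neg, abs_mul, abs_of_pos hh0]; linarith)
  have e2 := h2 (t - h) t x (by linarith) (by linarith)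
    (by rw [sub_sub_cancel_left, abs_neg, abs_of_pos hh0]; linarith) (by simpa using hδ₂.le)
    (by simpa using hδ₂.le)
  have e3 := @h3 (t - h, x - h * v) (by
    rw [Prod.dist_eq, max_lt_iff, Real.dist_eq, Real.dist_eq, sub_sub_cancel_left,
      sub_sub_cancel_left, abs_neg, abs_neg, abs_mul, abs_of_pos hh0]
    exact ⟨by linarith, by linarith⟩)
  rw [abs_neg, abs_neg, abs_mul, abs_of_pos hh0] at e1
  rw [sub_sub_cancel, ← hv] at e2
  rw [← sub_eq_add_neg, ← sub_eq_add_neg] at e1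
  have e4 := (abs_le.1 e1).2
  dsimp only at e3
  refine le_of_mul_le_mul_left (a := h) ?_ hh0
  linarith

/-- The velocity `v` in the lower inequality is unknown, but taking the slope `b` of the test
function as `p` makes `b * v` cancel against the first order change of the test function. Only the
bound on `v` is used, to control the remainder. -/
theorem isSupersolution (hu : IsLaxOleinik G t₀ f Λ u) : IsSupersolution G t₀ u := by
  intro φ hφ t x ht hmin
  set b := deriv (fun z => φ (t, z)) x
  have hΛ := hu.pos
  rw [← neg_nonpos]
  refine nonpos_of_forall_le_mul (C := 2 + Λ) fun η hη => ?_
  obtain ⟨δ₁, hδ₁, h1⟩ := exists_first_order (hφ.differentiable one_ne_zero (t, x)) hη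
  obtain ⟨δ₂, hδ₂, h2⟩ := hu.lower t x b η ht.le hη
  obtain ⟨δ₃, hδ₃, h3⟩ := Metric.eventually_nhds_iff.1 hmin
  set m := min (min δ₁ δ₂) (min δ₃ (t - t₀)) with hm
  have hm0 : 0 < m := by
    have := sub_pos.2 ht
    positivity
  set h := m / (2 * (1 + Λ)) with hh
  have hh0 : 0 < h := by positivity
  have hhm : h * (1 + Λ) = m / 2 := by rw [hh]; field_simp
  have hhv : 0 ≤ h * Λ := by positivity
  have hmδ₁ : m ≤ δ₁ := (min_le_left _ _).trans (min_le_left _ _)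
  have hmδ₂ : m ≤ δ₂ := (min_le_left _ _).trans (min_le_right _ _)
  have hmδ₃ : m ≤ δ₃ := (min_le_right _ _).trans (min_le_left _ _)
  have hmt : m ≤ t - t₀ := (min_le_right _ _).trans (min_le_right _ _)
  obtain ⟨v, hv, e2⟩ := h2 (t - h) t x (by linarith) (by linarith)
    (by rw [sub_sub_cancel_left, abs_neg, abs_of_pos hh0]; linarith) (by simpa using hδ₂.le)
    (by simpa using hδ₂.le)
  have hvΛ : h * |v| ≤ h * Λ := by gcongr
  have e1 := h1 (-h) (-(h * v)) (by rw [abs_neg, abs_of_pos hh0]; linarith)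
    (by rw [abs_neg, abs_mul, abs_of_pos hh0]; linarith)
  have e3 := @h3 (t - h, x - h * v) (by
    rw [Prod.dist_eq, max_lt_iff, Real.dist_eq, Real.dist_eq, sub_sub_cancel_left,
      sub_sub_cancel_left, abs_neg, abs_neg, abs_mul, abs_of_pos hh0]
    exact ⟨by linarith, by linarith⟩)
  rw [abs_neg, abs_neg, abs_mul, abs_of_pos hh0] at e1
  rw [sub_sub_cancel] at e2
  rw [← sub_eq_add_neg, ← sub_eq_add_neg] at e1
  have e4 := (abs_le.1 e1).1
  dsimp only at e3
  have e5 := mul_le_mul_of_nonneg_left hvΛ hη.le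
  refine le_of_mul_le_mul_left (a := h) ?_ hh0
  linarith

/-- At a point of differentiability in space, the function has a one-sided space-time expansion
given by the equation. -/
theorem expansion (hu : IsLaxOleinik G t₀ f Λ u) {t x q : ℝ} (ht : t₀ ≤ t)
    (hq : HasDerivAt (u t) q x) (C : ℝ) {η : ℝ} (hη : 0 < η) :
    ∃ δ, 0 < δ ∧ ∀ h z, 0 < h → h < δ → |z| ≤ C * h →
      |u (t + h) (x + z) - u t x - q * z + h * G t x q| ≤ η * h := by
  set v := dP G t x q with hv
  have hΛ := hu.pos
  set K := 1 + |C| + |v| + Λ with hK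
  have hK0 : 0 < K := by positivity
  set θ := η / K with hθ
  have hθ0 : 0 < θ := by positivity
  have hθK : θ * K = η := by rw [hθ]; field_simp
  obtain ⟨δ₁, hδ₁, h1⟩ := hu.upper t x q θ ht hθ0
  obtain ⟨δ₂, hδ₂, h2⟩ := hu.lower t x q θ ht hθ0
  obtain ⟨δ₃, hδ₃, h3⟩ := Metric.eventually_nhds_iff.1 (hq.isLittleO.def hθ0)
  set m := min (min δ₁ δ₂) δ₃ with hm
  have hmδ₁ : m ≤ δ₁ := (min_le_left _ _).trans (min_le_left _ _)
  have hmδ₂ : m ≤ δ₂ := (min_le_left _ _).trans (min_le_right _ _)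
  have hmδ₃ : m ≤ δ₃ := min_le_right _ _
  have hm0 : 0 < m := by positivity
  have h3' : ∀ y, |y| < δ₃ → |u t (x + y) - u t x - q * y| ≤ θ * |y| := by
    intro y hy
    have := @h3 (x + y) (by rwa [Real.dist_eq, add_sub_cancel_left])
    rw [add_sub_cancel_left, smul_eq_mul, Real.norm_eq_abs, Real.norm_eq_abs] at this
    rwa [mul_comm q]
  refine ⟨m / K, by positivity, fun h z hh hhδ hz => ?_⟩
  rw [lt_div_iff₀ hK0] at hhδ
  have hz' : |z| ≤ |C| * h := hz.trans (by gcongr; exact le_abs_self C)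
  have hC0 : 0 ≤ h * |C| := by positivity
  have hv0 : 0 ≤ h * |v| := by positivity
  have hΛ0 : 0 ≤ h * Λ := by positivity
  -- The starting points at time `t` are within `O(h)` of `x`, where `u t` is affine up to `o(h)`.
  -- The terms `q * w` then cancel, so the upper and lower inequalities agree to first order.
  have hbase : ∀ w, |w| ≤ |v| + Λ → |u t (x + z - h * w) - u t x - q * (z - h * w)|
      ≤ θ * (h * (|C| + |w|)) := by
    intro w hw
    have hw' : |z - h * w| ≤ h * (|C| + |w|) := by
      have := abs_sub z (h * w)
      rw [abs_mul, abs_of_pos hh] at this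
      linarith
    have h5 : h * |w| ≤ h * (|v| + Λ) := by gcongr
    have := h3' (z - h * w) (by linarith)
    rw [← add_sub_assoc] at this
    exact this.trans (by gcongr)
  have e1 := h1 t (t + h) (x + z) ht (by linarith) (by simpa using hδ₁.le)
    (by rw [add_sub_cancel_left, abs_of_pos hh]; linarith)
    (by rw [add_sub_cancel_left]; linarith)
  obtain ⟨w, hw, e2⟩ := h2 t (t + h) (x + z) ht (by linarith) (by simpa using hδ₂.le)
    (by rw [add_sub_cancel_left, abs_of_pos hh]; linarith)
    (by rw [add_sub_cancel_left]; linarith)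
  rw [add_sub_cancel_left] at e1 e2
  have b1 := (abs_le.1 (hbase v (by linarith))).2
  have b2 := (abs_le.1 (hbase w (by linarith [abs_nonneg v]))).1
  rw [← hv] at e1
  have hwΛ : θ * (h * |w|) ≤ θ * (h * Λ) := by gcongr
  have hθh : 0 ≤ θ * (h * |v|) := by positivity
  have hθΛ : 0 ≤ θ * (h * Λ) := by positivity
  have hηh : η * h = θ * h + θ * (h * |C|) + θ * (h * |v|) + θ * (h * Λ) := by
    rw [← hθK, hK]; ring
  rw [abs_le, hηh]
  constructor <;> linarith

end IsLaxOleinik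

/-! ### The comparison principle -/

set_option maxHeartbeats 1000000 in
/-- Comparison of viscosity sub- and supersolutions one of which is Lipschitz in space. -/
theorem IsTonelli.comparison {G : ℝ → ℝ → ℝ → ℝ} (hG : IsTonelli G) {t₀ Λ : ℝ} {u v : ℝ → ℝ → ℝ}
    (hu : IsSubsolution G t₀ u) (hv : IsSupersolution G t₀ v)
    (huc : ContinuousOn (fun q : ℝ × ℝ => u q.1 q.2) (Ici t₀ ×ˢ univ))
    (hvc : ContinuousOn (fun q : ℝ × ℝ => v q.1 q.2) (Ici t₀ ×ˢ univ))
    (hup : ∀ t, t₀ ≤ t → Function.Periodic (u t) 1)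
    (hvp : ∀ t, t₀ ≤ t → Function.Periodic (v t) 1)
    (hlip : (∀ t, t₀ ≤ t → ∀ x y, |u t x - u t y| ≤ Λ * |x - y|) ∨
      ∀ t, t₀ ≤ t → ∀ x y, |v t x - v t y| ≤ Λ * |x - y|)
    (hinit : ∀ x, u t₀ x ≤ v t₀ x) (t x : ℝ) (ht : t₀ ≤ t) : u t x ≤ v t x := by
  by_contra hcon
  push Not at hcon
  set T := t + 1 with hT
  -- One third of the gap is spent on the time penalty; at the initial time another third is lost to
  -- the modulus of continuity.
  set σ := (u t x - v t x) / 3 with hσ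
  have hσ0 : 0 < σ := by rw [hσ]; linarith
  have hsub : Icc t₀ (T + 1) ×ˢ (Icc (-1:ℝ) 2) ⊆ Ici t₀ ×ˢ univ :=
    prod_mono Icc_subset_Ici_self (subset_univ _)
  have hKc : IsCompact (Icc t₀ (T + 1) ×ˢ (Icc (-1:ℝ) 2)) := isCompact_Icc.prod isCompact_Icc
  obtain ⟨Bu, hBu⟩ := hKc.exists_bound_of_continuousOn (huc.mono hsub)
  obtain ⟨Bv, hBv⟩ := hKc.exists_bound_of_continuousOn (hvc.mono hsub)
  set B := max (max Bu Bv) 1 with hB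
  have hB1 : 1 ≤ B := le_max_right _ _
  have hshift : ∀ (w : ℝ → ℝ → ℝ), (∀ t, t₀ ≤ t → Function.Periodic (w t) 1) →
      ∀ t, t₀ ≤ t → ∀ (k : ℤ) (z : ℝ), w t (z - k) = w t z := by
    intro w hw t ht k z
    have := (hw t ht).sub_int_mul_eq (x := z) k
    rwa [mul_one] at this
  have hbound : ∀ (w : ℝ → ℝ → ℝ) (b : ℝ), (∀ t, t₀ ≤ t → Function.Periodic (w t) 1) →
      (∀ q ∈ Icc t₀ (T + 1) ×ˢ (Icc (-1:ℝ) 2), ‖w q.1 q.2‖ ≤ b) → b ≤ B →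
      ∀ t z, t₀ ≤ t → t ≤ T + 1 → |w t z| ≤ B := by
    intro w b hw hb hbB t z ht htT
    rw [← hshift w hw t ht ⌊z⌋ z, Int.self_sub_floor]
    refine (hb (t, Int.fract z) ⟨⟨ht, htT⟩, ?_, ?_⟩).trans hbB
    · linarith [Int.fract_nonneg z]
    · linarith [Int.fract_lt_one z]
  have huB := hbound u Bu hup hBu ((le_max_left _ _).trans (le_max_left _ _))
  have hvB := hbound v Bv hvp hBv ((le_max_right _ _).trans (le_max_left _ _))
  -- the time penalty
  set g : ℝ → ℝ := fun s => σ * Real.exp ((2 * B / σ) * (s - t)) with hg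
  have hgt : g t = σ := by simp [hg]
  -- The penalty at `T` exceeds any value of `u - v`, which keeps the maximum away from the final
  -- time.
  have hgT : 2 * B < g T := by
    have h1 := Real.add_one_le_exp ((2 * B / σ) * (T - t))
    have h2 : (2 * B / σ) * (T - t) = 2 * B / σ := by
      rw [hT, add_sub_cancel_left, mul_one]
    have h3 : σ * (2 * B / σ + 1) ≤ g T := by
      simp only [hg]; rw [h2] at h1 ⊢; gcongr
    have h4 : σ * (2 * B / σ + 1) = 2 * B + σ := by field_simp
    linarith
  have hg0 : ∀ s, 0 < g s := fun s => by simp only [hg]; positivity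
  have hgd : ∀ s, HasDerivAt g (2 * B * Real.exp ((2 * B / σ) * (s - t))) s := by
    intro s
    have h1 : HasDerivAt (fun s => (2 * B / σ) * (s - t)) (2 * B / σ) s := by
      simpa using ((hasDerivAt_id s).sub_const t).const_mul (2 * B / σ)
    have h2 := h1.exp.const_mul σ
    have h3 : σ * (Real.exp (2 * B / σ * (s - t)) * (2 * B / σ))
        = 2 * B * Real.exp ((2 * B / σ) * (s - t)) := by
      rw [mul_left_comm, mul_div_cancel₀ _ hσ0.ne', mul_comm]
    rwa [h3] at h2
  -- The least slope of the penalty on the relevant times; this is the strict margin that produces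
  -- the contradiction.
  set γ := 2 * B * Real.exp ((2 * B / σ) * (t₀ - t)) with hγ
  have hγ0 : 0 < γ := by positivity
  obtain ⟨C, hC, -, hCl⟩ := hG.biperiodic.exists_lipschitz
    (hG.contDiff.of_le (by norm_num)) (2 * |Λ|)
  obtain ⟨δu, hδu, hucu⟩ := Metric.uniformContinuousOn_iff.1
    (hKc.uniformContinuousOn_of_continuous (huc.mono hsub)) σ hσ0
  obtain ⟨δv, hδv, hucv⟩ := Metric.uniformContinuousOn_iff.1
    (hKc.uniformContinuousOn_of_continuous (hvc.mono hsub)) σ hσ0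
  -- The scale at which the doubled points must agree: below both moduli of continuity for `σ`, and
  -- so small that moving the base point of `G` by `r` in time and space costs at most `γ / 2`.
  set r := min (min (δu / 2) (δv / 2)) (min (1 / 2) (γ / (4 * C))) with hr
  have hr0 : 0 < r := by positivity
  have hru : r < δu := ((min_le_left _ _).trans (min_le_left _ _)).trans_lt (by linarith)
  have hrv : r < δv := ((min_le_left _ _).trans (min_le_right _ _)).trans_lt (by linarith)
  have hr1 : r ≤ 1 / 2 := (min_le_right _ _).trans (min_le_left _ _)
  have hrγ : r * (4 * C) ≤ γ := by
    rw [← le_div_iff₀ (by positivity)]; exact (min_le_right _ _).trans (min_le_right _ _)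
  -- Since `u - v` is at most `2 * B`, this weight forces the squared distance of the doubled points
  -- to be at most `r ^ 2`.
  set ε := r ^ 2 / (4 * B) with hε
  have hε0 : 0 < ε := by positivity
  have hεB : 2 * B * (2 * ε) = r ^ 2 := by rw [hε]; field_simp; ring
  set Φ : (ℝ × ℝ) × (ℝ × ℝ) → ℝ := fun q => u q.1.1 q.1.2 - v q.2.1 q.2.2
    - ((q.1.2 - q.2.2) ^ 2 + (q.1.1 - q.2.1) ^ 2) / (2 * ε) - g q.1.1 with hΦ
  -- The box of the second point is larger, so that this point lies before `T + 1` once the first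
  -- lies before `T`.
  set S : Set ((ℝ × ℝ) × (ℝ × ℝ)) :=
    (Icc t₀ T ×ˢ Icc (0:ℝ) 1) ×ˢ (Icc t₀ (T + 1) ×ˢ Icc (-1:ℝ) 2) with hS
  have hScomp : IsCompact S := (isCompact_Icc.prod isCompact_Icc).prod
    (isCompact_Icc.prod isCompact_Icc)
  have hgs : ContDiff ℝ 1 g := by simp only [hg]; fun_prop
  have hgc : Continuous g := by simp only [hg]; fun_prop
  have hΦc : ContinuousOn Φ S := by
    have c1 : ContinuousOn (fun q : (ℝ × ℝ) × (ℝ × ℝ) => u q.1.1 q.1.2) S :=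
      huc.comp (f := fun q : (ℝ × ℝ) × (ℝ × ℝ) => q.1) (by fun_prop)
        fun q hq => ⟨hq.1.1.1, trivial⟩
    have c2 : ContinuousOn (fun q : (ℝ × ℝ) × (ℝ × ℝ) => v q.2.1 q.2.2) S :=
      hvc.comp (f := fun q : (ℝ × ℝ) × (ℝ × ℝ) => q.2) (by fun_prop)
        fun q hq => ⟨hq.2.1.1, trivial⟩
    refine ((c1.sub c2).sub ?_).sub ?_
    · exact Continuous.continuousOn (by fun_prop)
    · exact Continuous.continuousOn (by fun_prop)
  obtain ⟨q₀, hq₀, hmax⟩ := hScomp.exists_isMaxOn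
    ⟨((t, 0), (t, 0)), ⟨⟨⟨ht, by simp [hT]⟩, by simp⟩, ⟨ht, by dsimp only; linarith⟩, by simp⟩⟩ hΦc
  obtain ⟨⟨a, y⟩, ⟨b, z⟩⟩ := q₀
  obtain ⟨⟨⟨ha1, ha2⟩, hy1, hy2⟩, ⟨hb1, hb2⟩, hz1, hz2⟩ := hq₀
  dsimp only at ha1 ha2 hy1 hy2 hb1 hb2 hz1 hz2
  -- the maximum is large
  have hbig : 2 * σ ≤ Φ ((a, y), (b, z)) := by
    have h1 : Φ ((t, Int.fract x), (t, Int.fract x)) ≤ Φ ((a, y), (b, z)) := hmax (by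
      have f0 := Int.fract_nonneg x
      have f1 := Int.fract_lt_one x
      simp only [hS, mem_prod, mem_Icc]
      exact ⟨⟨⟨ht, by linarith⟩, f0, f1.le⟩, ⟨ht, by linarith⟩, by linarith, by linarith⟩)
    have h2 : Φ ((t, Int.fract x), (t, Int.fract x)) = 2 * σ := by
      have e1 := hshift u hup t ht ⌊x⌋ x
      have e2 := hshift v hvp t ht ⌊x⌋ x
      rw [Int.self_sub_floor] at e1 e2
      simp only [hΦ, e1, e2, hgt]
      rw [hσ]; ring
    linarith
  -- The maximum over the box is global in space: a common integer translation brings `y'` into `[0,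
  -- 1]`, and if the other point then falls outside `[-1, 2]` the quadratic penalty alone is at
  -- least `2 * B`.
  have hglob : ∀ a' y' b' z', t₀ ≤ a' → a' ≤ T → t₀ ≤ b' → b' ≤ T + 1 →
      Φ ((a', y'), (b', z')) ≤ Φ ((a, y), (b, z)) := by
    intro a' y' b' z' h1 h2 h3 h4
    have e : Φ ((a', y'), (b', z')) = Φ ((a', Int.fract y'), (b', z' - ⌊y'⌋)) := by
      have e1 := hshift u hup a' h1 ⌊y'⌋ y'
      have e2 := hshift v hvp b' h3 ⌊y'⌋ z'
      simp only [hΦ, ← Int.self_sub_floor, e1, e2, sub_sub_sub_cancel_right]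
    rw [e]
    have hf0 := Int.fract_nonneg y'
    have hf1 := Int.fract_lt_one y'
    by_cases hz' : z' - ⌊y'⌋ ∈ Icc (-1:ℝ) 2
    · exact hmax ⟨⟨⟨h1, h2⟩, hf0, hf1.le⟩, ⟨h3, h4⟩, hz'⟩
    · refine le_trans ?_ (hbig.trans' (by positivity : (0:ℝ) ≤ 2 * σ))
      have h5 : 1 ≤ (Int.fract y' - (z' - ⌊y'⌋)) ^ 2 := by
        rw [mem_Icc, not_and_or, not_le, not_le] at hz'
        rw [one_le_sq_iff_one_le_abs, le_abs]
        rcases hz' with h | h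
        · left; linarith
        · right; linarith
      have h6 : 2 * B ≤ ((Int.fract y' - (z' - ⌊y'⌋)) ^ 2 + (a' - b') ^ 2) / (2 * ε) := by
        rw [le_div_iff₀ (by positivity), hεB]
        have := sq_nonneg (a' - b')
        have : r ^ 2 ≤ 1 := pow_le_one₀ hr0.le (by linarith)
        linarith
      have h7 := (le_abs_self _).trans (huB a' (Int.fract y') h1 (by linarith))
      have h8 := (neg_le_abs _).trans (hvB b' (z' - ⌊y'⌋) h3 h4)
      have h9 := hg0 a'
      simp only [hΦ]
      linarith
  have hua := (le_abs_self _).trans (huB a y ha1 (by linarith))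
  have hvb := (neg_le_abs _).trans (hvB b z hb1 hb2)
  have hga := hg0 a
  have hquad : (y - z) ^ 2 + (a - b) ^ 2 ≤ r ^ 2 := by
    rw [← hεB, ← div_le_iff₀ (by positivity)]
    simp only [hΦ] at hbig
    linarith
  have hyz : |y - z| ≤ r := abs_le_of_sq_le_sq (by linarith [sq_nonneg (a - b)]) hr0.le
  have hab : |a - b| ≤ r := abs_le_of_sq_le_sq (by linarith [sq_nonneg (y - z)]) hr0.le
  have hquad0 : 0 ≤ ((y - z) ^ 2 + (a - b) ^ 2) / (2 * ε) := by positivity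
  have hdist : dist (a, y) (b, z) ≤ r := by
    rw [Prod.dist_eq, Real.dist_eq, Real.dist_eq]; exact max_le hab hyz
  -- the maximum is not attained at the boundary in time
  have hmemy : (a, y) ∈ Icc t₀ (T + 1) ×ˢ Icc (-1:ℝ) 2 :=
    ⟨⟨ha1, by dsimp only; linarith⟩, by dsimp only; linarith, by dsimp only; linarith⟩
  have hmemz : (b, z) ∈ Icc t₀ (T + 1) ×ˢ Icc (-1:ℝ) 2 := ⟨⟨hb1, hb2⟩, hz1, hz2⟩
  have hu' := hucu _ hmemy _ hmemz (hdist.trans_lt hru)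
  have hv' := hucv _ hmemy _ hmemz (hdist.trans_lt hrv)
  rw [Real.dist_eq] at hu' hv'
  dsimp only at hu' hv'
  rw [abs_lt] at hu' hv'
  have ha0 : t₀ < a := by
    refine lt_of_le_of_ne ha1 fun h => ?_
    have : u a y ≤ v a y := by rw [← h]; exact hinit y
    simp only [hΦ] at hbig
    linarith
  have hb0 : t₀ < b := by
    refine lt_of_le_of_ne hb1 fun h => ?_
    have := hinit z
    simp only [hΦ] at hbig
    rw [h] at this
    linarith
  have haT : a < T := by
    refine lt_of_le_of_ne ha2 fun h => ?_
    simp only [hΦ] at hbig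
    rw [← h] at hgT
    linarith
  have hbT : b < T + 1 := by
    have := (abs_le.1 hab).1
    linarith
  -- the common slope is bounded
  set p := (y - z) / ε with hp
  have hpb : |p| ≤ 2 * |Λ| := by
    have key : (y - z) ^ 2 / (2 * ε) ≤ |Λ| * |y - z| := by
      have habs : Λ * |y - z| ≤ |Λ| * |y - z| := by gcongr; exact le_abs_self _
      have hsplit : ((y - z) ^ 2 + (a - b) ^ 2) / (2 * ε)
          = (y - z) ^ 2 / (2 * ε) + (a - b) ^ 2 / (2 * ε) := add_div _ _ _
      -- Merging the two space points at `z` uses the Lipschitz bound of `u`, merging them at `y`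
      -- that of `v`. Both test functions share the slope `p`, so either bound is enough.
      rcases hlip with hl | hl
      · have h1 := hglob a z b z ha1 ha2 hb1 hb2
        have h2 := (le_abs_self _).trans (hl a ha1 y z)
        simp only [hΦ, hsplit, sub_self] at h1
        rw [zero_pow two_ne_zero, zero_add] at h1
        linarith
      · have h1 := hglob a y b y ha1 ha2 hb1 hb2
        have h2 := (le_abs_self _).trans (hl b hb1 y z)
        simp only [hΦ, hsplit, sub_self] at h1
        rw [zero_pow two_ne_zero, zero_add] at h1
        linarith
    rw [hp, abs_div, abs_of_pos hε0, div_le_iff₀ hε0]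
    rw [div_le_iff₀ (by positivity), ← sq_abs] at key
    rcases eq_or_lt_of_le (abs_nonneg (y - z)) with h | h
    · rw [← h]; positivity
    · refine le_of_mul_le_mul_left (a := |y - z|) ?_ h
      linarith
  have hderiv : ∀ (c w : ℝ), HasDerivAt (fun s : ℝ => (s - w) ^ 2 / (2 * ε)) ((c - w) / ε) c := by
    intro c w
    have h1 := (((hasDerivAt_id c).sub_const w).pow 2).div_const (2 * ε)
    have h2 : ((2 : ℕ) : ℝ) * (id c - w) ^ (2 - 1) * 1 / (2 * ε) = (c - w) / ε := by
      simp only [id]; norm_num; field_simp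
    rw [h2] at h1
    exact h1
  -- the subsolution test
  have hsubt := hu (fun q => (q.2 - z) ^ 2 / (2 * ε) + (q.1 - b) ^ 2 / (2 * ε) + g q.1)
    (by fun_prop) a y ha0 (by
      have hnhds : Ioo t₀ T ×ˢ (univ : Set ℝ) ∈ 𝓝 (a, y) :=
        prod_mem_nhds (Ioo_mem_nhds ha0 haT) univ_mem
      filter_upwards [hnhds] with q hq
      have := hglob q.1 q.2 b z hq.1.1.le hq.1.2.le hb1 hb2
      simp only [hΦ, add_div] at this
      linarith)
  have d1 : deriv (fun s => (y - z) ^ 2 / (2 * ε) + (s - b) ^ 2 / (2 * ε) + g s) a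
      = (a - b) / ε + 2 * B * Real.exp ((2 * B / σ) * (a - t)) :=
    (((hderiv a b).const_add _).add (hgd a)).deriv
  have d2 : deriv (fun s => (s - z) ^ 2 / (2 * ε) + (a - b) ^ 2 / (2 * ε) + g a) y = p :=
    (((hderiv y z).add_const _).add_const _).deriv
  dsimp only at hsubt
  rw [d1, d2] at hsubt
  have hsupt := hv (fun q => -((y - q.2) ^ 2 / (2 * ε)) + -((a - q.1) ^ 2 / (2 * ε)))
    (by fun_prop) b z hb0 (by
      have hnhds : Ioo t₀ (T + 1) ×ˢ (univ : Set ℝ) ∈ 𝓝 (b, z) :=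
        prod_mem_nhds (Ioo_mem_nhds hb0 hbT) univ_mem
      filter_upwards [hnhds] with q hq
      have := hglob a y q.1 q.2 ha1 ha2 hq.1.1.le hq.1.2.le
      simp only [hΦ, add_div] at this
      linarith)
  have d3 : deriv (fun s => -((y - z) ^ 2 / (2 * ε)) + -((a - s) ^ 2 / (2 * ε))) b
      = -((b - a) / ε) := by
    simp only [sub_sq_comm a]
    exact ((hderiv b a).neg.const_add _).deriv
  have d4 : deriv (fun s => -((y - s) ^ 2 / (2 * ε)) + -((a - b) ^ 2 / (2 * ε))) z
      = -((z - y) / ε) := by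
    simp only [sub_sq_comm y]
    exact ((hderiv z y).neg.add_const _).deriv
  dsimp only at hsupt
  rw [d3, d4] at hsupt
  have ep : -((z - y) / ε) = p := by rw [hp]; ring
  have et : -((b - a) / ε) = (a - b) / ε := by ring
  rw [ep, et] at hsupt
  have hGl := (le_abs_self _).trans (hCl b z p a y p hpb hpb)
  rw [sub_self, abs_zero, add_zero, abs_sub_comm b, abs_sub_comm z] at hGl
  have hexp : γ ≤ 2 * B * Real.exp ((2 * B / σ) * (a - t)) := by
    rw [hγ]; gcongr
  have h1 : C * (|a - b| + |y - z|) ≤ C * (r + r) := by gcongr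
  linarith

/-! ### Transfer between the circle and the line; primitives -/

theorem ae_circle_of_ae {P : UnitAddCircle → Prop} (h : ∀ᵐ x : ℝ, P (x : UnitAddCircle)) :
    ∀ᵐ x : UnitAddCircle, P x := by
  have h1 : Measure.QuasiMeasurePreserving (Subtype.val : Ioc (0:ℝ) (0 + 1) → ℝ)
      (Measure.comap Subtype.val volume) volume := by
    refine ⟨measurable_subtype_coe, ?_⟩
    rw [map_comap_subtype_coe measurableSet_Ioc]
    exact Measure.absolutelyContinuous_of_le Measure.restrict_le_self
  have h2 := (AddCircle.measurePreserving_equivIoc (T := 1) (a := 0)).quasiMeasurePreserving.ae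
    (h1.ae h)
  filter_upwards [h2] with x hx
  rwa [AddCircle.coe_equivIoc] at hx

theorem ae_of_ae_circle {P : UnitAddCircle → Prop} (h : ∀ᵐ x : UnitAddCircle, P x) :
    ∀ᵐ x : ℝ, P (x : UnitAddCircle) := by
  rw [← Measure.restrict_univ (μ := (volume : Measure ℝ)), ← iUnion_Ioc_intCast ℝ,
    ae_restrict_iUnion_iff]
  intro n
  have := (AddCircle.measurePreserving_mk (1:ℝ) n).quasiMeasurePreserving.ae h
  exact this

theorem intervalIntegral_coe (f : UnitAddCircle → ℝ) :
    ∫ x in (0:ℝ)..1, f (x : UnitAddCircle) = ∫ x : UnitAddCircle, f x := by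
  have := UnitAddCircle.intervalIntegral_preimage 0 f
  rwa [zero_add] at this

theorem coe_periodic {E : Type*} (f : UnitAddCircle → E) :
    Function.Periodic (fun x : ℝ => f (x : UnitAddCircle)) 1 := by
  intro x
  simp only [AddCircle.coe_add_period]

theorem intervalIntegrable_coe {f : UnitAddCircle → ℝ} (hf : Integrable f volume) (a b : ℝ) :
    IntervalIntegrable (fun x : ℝ => f (x : UnitAddCircle)) volume a b := by
  refine (coe_periodic f).intervalIntegrable one_ne_zero (t := 0) ?_ a b
  rw [intervalIntegrable_iff_integrableOn_Ioc_of_le (by norm_num)]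
  exact (AddCircle.measurePreserving_mk (1:ℝ) 0).integrable_comp_of_integrable hf

theorem circleDeriv_coe (f : UnitAddCircle → ℝ) (x : ℝ) :
    circleDeriv f (x : UnitAddCircle) = deriv (fun s : ℝ => f (s : UnitAddCircle)) x := by
  have := deriv_comp_const_add (f := fun s : ℝ => f (s : UnitAddCircle)) x 0
  rw [add_zero] at this
  rw [← this]
  rfl

/-- The momentum is translated by `c`, and so are the orbits. Superlinearity survives because `|p| ≤
2 * |c + p|` for large `p`. -/
theorem IsAdmissibleHamiltonian.isTonelli {H : ℝ → UnitAddCircle → ℝ → ℝ}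
    (hH : IsAdmissibleHamiltonian H) (c : ℝ) :
    IsTonelli (fun t x p => H t (x : UnitAddCircle) (c + p)) where
  contDiff := by
    have : ContDiff ℝ 2 (fun q : ℝ × ℝ × ℝ => (q.1, q.2.1, c + q.2.2)) := by fun_prop
    exact hH.contDiff.comp this
  periodic_time t x p := hH.periodic t _ _
  periodic_space t x p := by simp only [AddCircle.coe_add_period]
  deriv2_pos t x p := by
    have := congrFun (iteratedDeriv_comp_const_add 2 (H t (x : UnitAddCircle)) c) p
    rw [this]
    exact hH.deriv2_pos t x (c + p)
  superlinear t x := by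
    have h1 : Tendsto (fun p : ℝ => c + p) (cocompact ℝ) (cocompact ℝ) :=
      (Homeomorph.addLeft c).isClosedEmbedding.tendsto_cocompact
    have h2 : Tendsto (fun p : ℝ => |p|) (cocompact ℝ) atTop := tendsto_norm_cocompact_atTop
    rw [tendsto_atTop]
    intro R
    filter_upwards [(tendsto_atTop.1 ((hH.superlinear t x).comp h1)) (2 * |R|),
      (tendsto_atTop.1 h2) (2 * |c| + 1)] with p hp1 hp2
    have h3 : |p| ≤ 2 * |c + p| := by
      have := abs_sub (c + p) c
      rw [add_sub_cancel_left] at this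
      linarith
    have h4 : 0 < |p| := by linarith [abs_nonneg c]
    have h5 : 0 < |c + p| := by linarith
    simp only [Function.comp_apply] at hp1
    rw [le_div_iff₀ h5] at hp1
    rw [le_div_iff₀ h4]
    have h6 := mul_le_mul_of_nonneg_left h3 (abs_nonneg R)
    have h7 := mul_le_mul_of_nonneg_right (le_abs_self R) h4.le
    linarith
  complete s x₀ p₀ := by
    obtain ⟨x, p, hx, hp, h⟩ := hH.complete s x₀ (c + p₀)
    refine ⟨x, fun t => p t - c, hx, by simp [hp], fun t => ⟨?_, ?_⟩⟩
    · have := (h t).1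
      unfold dP
      rw [deriv_comp_const_add, add_sub_cancel]
      exact this
    · have := (h t).2
      rw [circleDeriv_coe] at this
      simpa only [dX, add_sub_cancel] using this.sub_const c

theorem continuous_circle_of_lipschitz {F : UnitAddCircle → ℝ} {Λ : ℝ}
    (hF : ∀ x y : ℝ, |F x - F y| ≤ Λ * |x - y|) : Continuous F := by
  have : Continuous (fun x : ℝ => F x) := continuous_of_abs_sub_le hF
  exact continuous_coinduced_dom.2 this

/-- Integration by parts on the circle for Lipschitz functions. -/
theorem isWeakDeriv_of_lipschitz {f g : UnitAddCircle → ℝ} {Λ : ℝ} (hΛ : 0 ≤ Λ)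
    (hf : ∀ x y : ℝ, |f x - f y| ≤ Λ * |x - y|)
    (hg : ∀ᵐ x : ℝ, HasDerivAt (fun s : ℝ => f s) (g x) x) (hgi : Integrable g volume) :
    IsWeakDeriv f g := by
  have hfc := continuous_circle_of_lipschitz hf
  refine ⟨hfc.integrable_of_hasCompactSupport (HasCompactSupport.of_compactSpace f), hgi,
    fun ψ hψ => ?_⟩
  have hψ1 : ContDiff ℝ 1 (fun s : ℝ => ψ s) := hψ.of_le (by exact_mod_cast le_top)
  have hac : AbsolutelyContinuousOnInterval (fun x : ℝ => f x) 0 1 := by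
    refine LipschitzOnWith.absolutelyContinuousOnInterval (K := Λ.toNNReal) ?_
    refine LipschitzOnWith.of_dist_le_mul fun x _ y _ => ?_
    rw [Real.coe_toNNReal _ hΛ]
    exact hf x y
  have hψac : AbsolutelyContinuousOnInterval (fun x : ℝ => ψ x) 0 1 :=
    hψ1.contDiffOn.absolutelyContinuousOnInterval
  have key := hac.integral_mul_deriv_eq_deriv_mul hψac
  rw [← intervalIntegral_coe, ← intervalIntegral_coe]
  simp_rw [circleDeriv_coe]
  have h01 := AddCircle.coe_add_period (1:ℝ) (0:ℝ)
  rw [zero_add] at h01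
  rw [key, h01, sub_self, zero_sub]
  congr 1
  refine intervalIntegral.integral_congr_ae ?_
  filter_upwards [hg] with x hx _
  rw [hx.deriv]

/-- A function with quadratic supporting inequalities from above has right derivatives, and these
are supergradients. -/
theorem exists_hasDerivWithinAt_of_semiconcave {f : ℝ → ℝ} {C : ℝ}
    (hf : ∀ x, ∃ q, ∀ h, f (x + h) ≤ f x + q * h + C * h ^ 2) (x : ℝ) :
    ∃ q, HasDerivWithinAt f q (Ioi x) x ∧ ∀ h, f (x + h) ≤ f x + q * h + C * h ^ 2 := by
  -- Subtracting `f` from a parabola turns its quadratic supports from above into affine supports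
  -- from below, so `g` is convex. The parabola has zero slope at `x`.
  set g : ℝ → ℝ := fun z => C * (z - x) ^ 2 - f z with hg
  have hsup : ∀ z, ∃ l, ∀ w, g z + l * (w - z) ≤ g w := by
    intro z
    obtain ⟨q, hq⟩ := hf z
    refine ⟨2 * C * (z - x) - q, fun w => ?_⟩
    have := hq (w - z)
    rw [add_sub_cancel] at this
    simp only [hg]
    nlinarith
  have hconv : ConvexOn ℝ univ g := by
    refine ⟨convex_univ, fun a _ b _ s t hs ht hst => ?_⟩
    obtain ⟨l, hl⟩ := hsup (s • a + t • b)
    have h1 := mul_le_mul_of_nonneg_left (hl a) hs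
    have h2 := mul_le_mul_of_nonneg_left (hl b) ht
    simp only [smul_eq_mul] at h1 h2 ⊢
    have h3 : s * (g (s * a + t * b) + l * (a - (s * a + t * b)))
        + t * (g (s * a + t * b) + l * (b - (s * a + t * b))) = g (s * a + t * b) := by
      have : t = 1 - s := by linarith
      subst this; ring
    linarith
  have hint : x ∈ interior (univ : Set ℝ) := by simp
  have hd := hconv.hasDerivWithinAt_rightDeriv_of_mem_interior hint
  have hdsub : ∀ w, g x + derivWithin g (Ioi x) x * (w - x) ≤ g w := by
    intro w
    rcases lt_trichotomy w x with h | h | h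
    · have h1 := hconv.slope_le_leftDeriv_of_mem_interior (mem_univ w) hint h
      have h2 := hconv.leftDeriv_le_rightDeriv_of_mem_interior hint
      have h3 := h1.trans h2
      rw [slope_def_field, div_le_iff₀ (by linarith)] at h3
      linarith
    · subst h; simp
    · have h1 := hconv.rightDeriv_le_slope_of_mem_interior hint (mem_univ w) h
      rw [slope_def_field, le_div_iff₀ (by linarith)] at h1
      linarith
  refine ⟨-derivWithin g (Ioi x) x, ?_, fun h => ?_⟩
  · have h1 : HasDerivAt (fun z : ℝ => C * (z - x) ^ 2) 0 x := by
      have := (((hasDerivAt_id x).sub_const x).pow 2).const_mul C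
      simpa using this
    have := h1.hasDerivWithinAt (s := Ioi x) |>.sub hd
    rw [zero_sub] at this
    refine this.congr_of_eventuallyEq (Eventually.of_forall fun z => ?_) ?_ <;> simp [hg]
  · have := hdsub (x + h)
    simp only [hg, add_sub_cancel_left, sub_self] at this ⊢
    nlinarith

theorem IsLaxOleinik.congr {G : ℝ → ℝ → ℝ → ℝ} {t₀ Λ : ℝ} {f : ℝ → ℝ} {u v : ℝ → ℝ → ℝ}
    (hu : IsLaxOleinik G t₀ f Λ u) (h : ∀ t, t₀ ≤ t → v t = u t) : IsLaxOleinik G t₀ f Λ v where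
  pos := hu.pos
  init x := by rw [h t₀ le_rfl, hu.init]
  periodic t ht := by rw [h t ht]; exact hu.periodic t ht
  lip t ht := by rw [h t ht]; exact hu.lip t ht
  lip_time s t hs ht := by rw [h t ht, h s hs]; exact hu.lip_time s t hs ht
  semiconcave t ht := by rw [h t ht.le]; exact hu.semiconcave t ht
  upper t x p η ht hη := by
    obtain ⟨δ, hδ, H⟩ := hu.upper t x p η ht hη
    refine ⟨δ, hδ, fun s s' x' hs hss' => ?_⟩
    rw [h s hs, h s' (hs.trans hss'.le)]
    exact H s s' x' hs hss'
  lower t x p η ht hη := by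
    obtain ⟨δ, hδ, H⟩ := hu.lower t x p η ht hη
    refine ⟨δ, hδ, fun s s' x' hs hss' => ?_⟩
    rw [h s hs, h s' (hs.trans hss'.le)]
    exact H s s' x' hs hss'

theorem exists_coe_eq_abs_sub (x y : ℝ) : ∃ y' : ℝ, (y' : UnitAddCircle) = (y : UnitAddCircle) ∧
    ‖(x : UnitAddCircle) - (y : UnitAddCircle)‖ = |x - y'| := by
  refine ⟨y + round (x - y), ?_, ?_⟩
  · have := (coe_periodic (fun z : UnitAddCircle => z)).int_mul (round (x - y)) y
    rwa [mul_one] at this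
  · rw [← AddCircle.coe_sub, UnitAddCircle.norm_eq]
    congr 1; ring

theorem abs_sub_le_norm_of_coe {f : UnitAddCircle → ℝ} {Λ : ℝ}
    (hf : ∀ x y : ℝ, |f x - f y| ≤ Λ * |x - y|) (a b : UnitAddCircle) :
    |f a - f b| ≤ Λ * ‖a - b‖ := by
  induction a using QuotientAddGroup.induction_on with | H x =>
  induction b using QuotientAddGroup.induction_on with | H y =>
  obtain ⟨y', h1, h2⟩ := exists_coe_eq_abs_sub x y
  have := hf x y'
  rw [h1] at this
  exact this.trans_eq (congrArg _ h2.symm)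

theorem exists_bound_of_memLp_top {α : Type*} [MeasurableSpace α] {μ : Measure α} {f : α → ℝ}
    (hf : MemLp f ⊤ μ) : ∃ M, 0 < M ∧ ∀ᵐ x ∂μ, |f x| ≤ M := by
  refine ⟨(eLpNormEssSup f μ).toReal + 1, by positivity, ?_⟩
  have h1 : eLpNormEssSup f μ ≠ ⊤ := by
    have := hf.eLpNorm_ne_top
    rwa [eLpNorm_exponent_top] at this
  filter_upwards [ae_le_eLpNormEssSup (f := f) (μ := μ)] with x hx
  have := ENNReal.toReal_mono h1 hx
  rw [toReal_enorm, Real.norm_eq_abs] at this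
  linarith

/-- The normalized primitive of a function of mean `c` on the circle. -/
def primitive (g : UnitAddCircle → ℝ) (c x : ℝ) : ℝ := ∫ s in (0:ℝ)..x, (g s - c)

theorem intervalIntegrable_coe_sub {g : UnitAddCircle → ℝ} (hg : Integrable g volume) (c a b : ℝ) :
    IntervalIntegrable (fun s : ℝ => g s - c) volume a b :=
  (intervalIntegrable_coe hg a b).sub intervalIntegrable_const

theorem primitive_sub {g : UnitAddCircle → ℝ} (hg : Integrable g volume) (c a b : ℝ) :
    primitive g c b - primitive g c a = ∫ s in a..b, (g s - c) :=
  intervalIntegral.integral_interval_sub_left (intervalIntegrable_coe_sub hg c _ _)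
    (intervalIntegrable_coe_sub hg c _ _)

theorem primitive_periodic {g : UnitAddCircle → ℝ} (hg : Integrable g volume) {c : ℝ}
    (hc : ∫ x, g x = c) : Function.Periodic (primitive g c) 1 := by
  intro x
  have h1 := primitive_sub hg c x (x + 1)
  have h2 := UnitAddCircle.intervalIntegral_preimage x (fun z => g z - c)
  have h3 : ∫ z : UnitAddCircle, (g z - c) = 0 := by
    rw [integral_sub hg (integrable_const _), hc, integral_const, measureReal_def,
      UnitAddCircle.measure_univ]
    simp
  rw [h3] at h2
  linarith

theorem ae_hasDerivAt_primitive {g : UnitAddCircle → ℝ} (hg : Integrable g volume) (c : ℝ) :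
    ∀ᵐ x : ℝ, HasDerivAt (primitive g c) (g x - c) x := by
  have : LocallyIntegrable (fun s : ℝ => g s - c) volume := by
    intro x
    refine ⟨Ioc (x - 1) (x + 1), Ioc_mem_nhds (by linarith) (by linarith), ?_⟩
    rw [← intervalIntegrable_iff_integrableOn_Ioc_of_le (by linarith)]
    exact intervalIntegrable_coe_sub hg c _ _
  filter_upwards [LocallyIntegrable.ae_hasDerivAt_integral this] with x hx
  exact hx 0

theorem primitive_lipschitz {g : UnitAddCircle → ℝ} (hg : Integrable g volume) (c : ℝ) {M : ℝ}
    (hM : ∀ᵐ x, |g x| ≤ M) (x y : ℝ) :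
    |primitive g c x - primitive g c y| ≤ (M + |c|) * |x - y| := by
  rw [primitive_sub hg, ← Real.norm_eq_abs]
  refine intervalIntegral.norm_integral_le_of_norm_le_const_ae ?_
  filter_upwards [ae_of_ae_circle hM] with s hs _
  exact (abs_sub _ _).trans (by linarith)

/-! ### The solution `y` as a space derivative, and its regularity -/

/-- A viscosity solution `w` constructed from the Lax–Oleinik evolution, together with a pointwise
representative `y` of `c + ∂ₓ w`. -/
structure IsEntropyPair (H : ℝ → UnitAddCircle → ℝ → ℝ) (c t₀ : ℝ) (y₀ : UnitAddCircle → ℝ)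
    (Λ : ℝ) (w y : ℝ → UnitAddCircle → ℝ) : Prop where
  lax : IsLaxOleinik (fun t x p => H t (x : UnitAddCircle) (c + p)) t₀ (primitive y₀ c) Λ
    (fun t x => w t (x : UnitAddCircle))
  continuous : Continuous (fun q : ℝ × UnitAddCircle => w q.1 q.2)
  init : y t₀ = y₀
  ae_hasDerivAt : ∀ t, t₀ ≤ t → ∀ᵐ x : ℝ, HasDerivAt (fun s : ℝ => w t s) (y t x - c) x
  supergradient : ∀ t, t₀ < t → ∀ x h : ℝ, w t ((x + h : ℝ) : UnitAddCircle)
    ≤ w t x + (y t x - c) * h + Λ * (1 + 1 / (t - t₀)) * h ^ 2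
  bound : ∀ t, t₀ < t → ∀ x, |y t x - c| ≤ Λ
  aesm : AEStronglyMeasurable (fun q : ℝ × UnitAddCircle => y q.1 q.2)
    (volume.restrict (timeSpace t₀))
  aesm_slice : ∀ t, t₀ ≤ t → AEStronglyMeasurable (y t) volume

theorem volume_restrict_timeSpace (t₀ : ℝ) :
    (volume.restrict (timeSpace t₀) : Measure (ℝ × UnitAddCircle))
      = (volume.restrict (Ioi t₀)).prod volume := by
  rw [timeSpace, Measure.volume_eq_prod, ← Measure.prod_restrict, Measure.restrict_univ,
    restrict_Ioi_eq_restrict_Ici]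

/-- By semiconcavity `w(t,·)` has a right derivative everywhere for `t > t₀`, and this derivative is
a supergradient. Choosing it as representative gives inequalities at every point, and joint
measurability as a limit of difference quotients. -/
theorem exists_isEntropyPair {H : ℝ → UnitAddCircle → ℝ → ℝ} (hH : IsAdmissibleHamiltonian H)
    (t₀ : ℝ) {y₀ : UnitAddCircle → ℝ} (hy₀ : MemLp y₀ ⊤ (volume : Measure UnitAddCircle)) {c : ℝ}
    (hc : ∫ x, y₀ x = c) : ∃ Λ w y, IsEntropyPair H c t₀ y₀ Λ w y := by
  have hyi : Integrable y₀ volume := hy₀.integrable le_top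
  obtain ⟨M, -, hM⟩ := exists_bound_of_memLp_top hy₀
  obtain ⟨u, Λ, hu⟩ := (hH.isTonelli c).exists_isLaxOleinik t₀ (primitive_periodic hyi hc)
    (primitive_lipschitz hyi c hM)
  have hΛ := hu.pos
  have hmax : ∀ t, t₀ ≤ max t t₀ := fun t => le_max_right _ _
  -- Freezing the time at `t₀` for earlier `t` makes `w` continuous on the whole of `ℝ × 𝕋`.
  set w : ℝ → UnitAddCircle → ℝ := fun t => (hu.periodic _ (hmax t)).lift with hw
  have hwu : ∀ t (x : ℝ), w t x = u (max t t₀) x := fun t x => Function.Periodic.lift_coe _ _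
  have hlax : IsLaxOleinik (fun t x p => H t (x : UnitAddCircle) (c + p)) t₀ (primitive y₀ c) Λ
      (fun t x => w t (x : UnitAddCircle)) := by
    refine hu.congr fun t ht => ?_
    funext x
    rw [hwu, max_eq_left ht]
  have hcont : Continuous (fun q : ℝ × UnitAddCircle => w q.1 q.2) := by
    have : LipschitzWith (2 * Λ).toNNReal (fun q : ℝ × UnitAddCircle => w q.1 q.2) := by
      refine LipschitzWith.of_dist_le_mul fun q r => ?_
      rw [Real.coe_toNNReal _ (by positivity), Real.dist_eq, Prod.dist_eq, Real.dist_eq,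
        dist_eq_norm]
      have h1 : |w q.1 q.2 - w q.1 r.2| ≤ Λ * ‖q.2 - r.2‖ := by
        refine abs_sub_le_norm_of_coe (fun x y => ?_) _ _
        rw [hwu, hwu]
        exact hu.lip _ (hmax _) x y
      have h2 : |w q.1 r.2 - w r.1 r.2| ≤ Λ * |q.1 - r.1| := by
        obtain ⟨x, hx⟩ := QuotientAddGroup.mk_surjective r.2
        have := hu.lip_time (max q.1 t₀) (max r.1 t₀) (hmax _) (hmax _) x
        rw [← hwu, ← hwu] at this
        change |w q.1 (x : UnitAddCircle) - w r.1 (x : UnitAddCircle)| ≤ _ at this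
        rw [show (x : UnitAddCircle) = r.2 from hx] at this
        exact this.trans (mul_le_mul_of_nonneg_left (abs_max_sub_max_le_abs _ _ _) hΛ.le)
      have h3 := abs_sub_le (w q.1 q.2) (w q.1 r.2) (w r.1 r.2)
      have h4 := mul_le_mul_of_nonneg_left (le_max_left |q.1 - r.1| ‖q.2 - r.2‖) hΛ.le
      have h5 := mul_le_mul_of_nonneg_left (le_max_right |q.1 - r.1| ‖q.2 - r.2‖) hΛ.le
      linarith
    exact this.continuous
  set y : ℝ → UnitAddCircle → ℝ := fun t x => if t ≤ t₀ then y₀ x else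
    c + derivWithin (fun s : ℝ => w t (x + (s : UnitAddCircle))) (Ioi 0) 0 with hy
  have hyt : ∀ t, t₀ < t → ∀ x, y t x
      = c + derivWithin (fun s : ℝ => w t (x + (s : UnitAddCircle))) (Ioi 0) 0 := by
    intro t ht x
    simp only [hy, if_neg (not_le.2 ht)]
  have hsc : ∀ t, t₀ < t → ∀ x : ℝ,
      HasDerivWithinAt (fun s : ℝ => w t ((x : UnitAddCircle) + (s : UnitAddCircle))) (y t x - c)
        (Ioi 0) 0 ∧ ∀ h : ℝ, w t ((x + h : ℝ) : UnitAddCircle)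
          ≤ w t x + (y t x - c) * h + Λ * (1 + 1 / (t - t₀)) * h ^ 2 := by
    intro t ht x
    obtain ⟨q, hq1, hq2⟩ := exists_hasDerivWithinAt_of_semiconcave
      (fun z => (hlax.semiconcave t ht z).imp fun q hq => hq.2) x
    have h1 : HasDerivWithinAt (fun s : ℝ => w t ((x : UnitAddCircle) + (s : UnitAddCircle))) q
        (Ioi 0) 0 := by
      have h2 : HasDerivWithinAt (fun s : ℝ => x + s) 1 (Ioi 0) 0 :=
        ((hasDerivAt_id (0:ℝ)).const_add x).hasDerivWithinAt
      have h3 : HasDerivWithinAt (fun s : ℝ => w t (s : UnitAddCircle)) q (Ioi x) (x + 0) := by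
        rwa [add_zero]
      have := h3.scomp (0:ℝ) h2 (fun s hs => by simpa using hs)
      simp only [smul_eq_mul, one_mul] at this
      exact this
    have h2 : y t x - c = q := by
      rw [hyt t ht, add_sub_cancel_left]
      exact h1.derivWithin (uniqueDiffWithinAt_Ioi 0)
    rw [h2]
    exact ⟨h1, hq2⟩
  have hderiv : ∀ t, t₀ < t → ∀ x : ℝ, HasDerivWithinAt (fun s : ℝ => w t s) (y t x - c)
      (Ioi x) x := by
    intro t ht x
    have h1 := (hsc t ht x).1
    have h2 : HasDerivWithinAt (fun s : ℝ => s - x) 1 (Ioi x) x :=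
        ((hasDerivAt_id x).sub_const x).hasDerivWithinAt
    have h3 : HasDerivWithinAt (fun s : ℝ => w t ((x : UnitAddCircle) + (s : UnitAddCircle)))
        (y t x - c) (Ioi 0) (x - x) := by rwa [sub_self]
    have := h3.scomp (h := fun s : ℝ => s - x) x h2 (fun s hs => mem_Ioi.2 (sub_pos.2 hs))
    simp only [smul_eq_mul, one_mul] at this
    refine this.congr_of_eventuallyEq (Eventually.of_forall fun s => ?_) ?_
    · simp only [Function.comp_apply]
      rw [← AddCircle.coe_add, add_sub_cancel]
    · simp
  have hlim : ∀ t, t₀ < t → ∀ x : UnitAddCircle, Tendsto (fun n : ℕ =>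
      c + ((n:ℝ) + 1) * (w t (x + ((1 / ((n:ℝ) + 1) : ℝ) : UnitAddCircle)) - w t x)) atTop
        (𝓝 (y t x)) := by
    intro t ht x
    obtain ⟨x, rfl⟩ := QuotientAddGroup.mk_surjective x
    have h1 := (hasDerivWithinAt_iff_tendsto_slope' (by simp)).1 (hsc t ht x).1
    have h2 : Tendsto (fun n : ℕ => 1 / ((n:ℝ) + 1)) atTop (𝓝[>] 0) := by
      refine tendsto_nhdsWithin_iff.2 ⟨tendsto_one_div_add_atTop_nhds_zero_nat,
        Eventually.of_forall fun n => ?_⟩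
      simp only [mem_Ioi]
      positivity
    have h3 := (h1.comp h2).const_add c
    rw [add_sub_cancel] at h3
    refine h3.congr fun n => ?_
    simp only [Function.comp_apply, slope_def_field, AddCircle.coe_zero, add_zero, sub_zero]
    rw [div_div_eq_mul_div, div_one, mul_comm]
  refine ⟨Λ, w, y, hlax, hcont, ?_, ?_, fun t ht x h => (hsc t ht x).2 h, ?_, ?_, ?_⟩
  · funext x
    simp [hy]
  · intro t ht
    rcases ht.eq_or_lt with rfl | ht
    · filter_upwards [ae_hasDerivAt_primitive hyi c] with x hx
      have h1 : (fun s : ℝ => w t₀ s) = primitive y₀ c := by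
        funext s; exact hlax.init s
      rw [h1]
      simpa [hy] using hx
    · have hl : LipschitzWith Λ.toNNReal (fun s : ℝ => w t s) := by
        refine LipschitzWith.of_dist_le_mul fun a b => ?_
        rw [Real.coe_toNNReal _ hΛ.le]
        exact hlax.lip t ht.le a b
      filter_upwards [hl.ae_differentiableAt_real] with x hx
      have h1 := hx.hasDerivAt
      have h2 := (uniqueDiffWithinAt_Ioi x).eq_deriv _ (hderiv t ht x) h1.hasDerivWithinAt
      rwa [h2]
  · intro t ht x
    refine le_of_tendsto (((hlim t ht x).sub_const c).abs) (Eventually.of_forall fun n => ?_)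
    rw [add_sub_cancel_left, abs_mul, abs_of_pos (by positivity)]
    obtain ⟨x, rfl⟩ := QuotientAddGroup.mk_surjective x
    have := hlax.lip t ht.le (x + 1 / ((n:ℝ) + 1)) x
    rw [AddCircle.coe_add, add_sub_cancel_left, abs_of_pos (a := 1 / ((n:ℝ) + 1))
      (by positivity)] at this
    have h2 := mul_le_mul_of_nonneg_left this (show 0 ≤ (n:ℝ) + 1 by positivity)
    refine h2.trans_eq ?_
    field_simp
  · set F : ℝ × UnitAddCircle → ℝ := (Ioi t₀ ×ˢ univ).indicator (fun q => y q.1 q.2) with hF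
    have hms : MeasurableSet (Ioi t₀ ×ˢ univ : Set (ℝ × UnitAddCircle)) :=
      measurableSet_Ioi.prod MeasurableSet.univ
    have hFm : Measurable F := by
      refine measurable_of_tendsto_metrizable (f := fun (n : ℕ) =>
        (Ioi t₀ ×ˢ univ).indicator (fun q : ℝ × UnitAddCircle =>
          c + ((n:ℝ) + 1) * (w q.1 (q.2 + ((1 / ((n:ℝ) + 1) : ℝ) : UnitAddCircle)) - w q.1 q.2)))
        (fun n => Measurable.indicator ?_ hms) ?_
      · have h1 : Continuous (fun q : ℝ × UnitAddCircle =>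
            w q.1 (q.2 + ((1 / ((n:ℝ) + 1) : ℝ) : UnitAddCircle))) :=
          hcont.comp (continuous_fst.prodMk (continuous_snd.add continuous_const))
        exact (continuous_const.add (continuous_const.mul (h1.sub hcont))).measurable
      · rw [tendsto_pi_nhds]
        rintro ⟨t, x⟩
        by_cases ht : t₀ < t
        · have hmem : (t, x) ∈ (Ioi t₀ ×ˢ univ : Set (ℝ × UnitAddCircle)) := ⟨ht, trivial⟩
          simp only [hF, indicator_of_mem hmem]
          exact hlim t ht x
        · have hmem : (t, x) ∉ (Ioi t₀ ×ˢ univ : Set (ℝ × UnitAddCircle)) := fun h => ht h.1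
          simp only [hF, indicator_of_notMem hmem]
          exact tendsto_const_nhds
    refine ⟨F, hFm.stronglyMeasurable, ?_⟩
    have : (volume.restrict (timeSpace t₀) : Measure (ℝ × UnitAddCircle))
        = volume.restrict (Ioi t₀ ×ˢ univ) := by
      rw [volume_restrict_timeSpace, Measure.volume_eq_prod, ← Measure.prod_restrict,
        Measure.restrict_univ]
    rw [this]
    exact (ae_restrict_iff' hms).2 (Eventually.of_forall fun q hq => by
      rw [hF, indicator_of_mem hq])
  · intro t ht
    rcases ht.eq_or_lt with rfl | ht
    · have : y t₀ = y₀ := by funext x; simp [hy]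
      rw [this]
      exact hy₀.1
    · have : Measurable (y t) := by
        refine measurable_of_tendsto_metrizable (fun n => ?_) (tendsto_pi_nhds.2 (hlim t ht))
        have h0 : Continuous (fun x : UnitAddCircle => w t x) :=
          hcont.comp (continuous_const.prodMk continuous_id)
        have h1 : Continuous (fun x : UnitAddCircle =>
            w t (x + ((1 / ((n:ℝ) + 1) : ℝ) : UnitAddCircle))) :=
          h0.comp (continuous_id.add continuous_const)
        exact (continuous_const.add (continuous_const.mul (h1.sub h0))).measurable
      exact this.aestronglyMeasurable

theorem ae_lt_of_restrict_timeSpace (t₀ : ℝ) :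
    ∀ᵐ q : ℝ × UnitAddCircle ∂(volume.restrict (timeSpace t₀)), t₀ < q.1 := by
  rw [volume_restrict_timeSpace]
  exact Measure.quasiMeasurePreserving_fst.ae (ae_restrict_mem measurableSet_Ioi)

theorem isOpenQuotientMap_coe : IsOpenQuotientMap ((↑) : ℝ → UnitAddCircle) :=
  QuotientAddGroup.isOpenQuotientMap_mk

theorem continuous_of_coe_snd {X : Type*} [TopologicalSpace X] {f : ℝ × UnitAddCircle → X}
    (hf : Continuous (fun q : ℝ × ℝ => f (q.1, q.2))) : Continuous f :=
  (IsOpenQuotientMap.id.prodMap isOpenQuotientMap_coe).isQuotientMap.continuous_iff.2 hf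

theorem IsAdmissibleHamiltonian.continuous {H : ℝ → UnitAddCircle → ℝ → ℝ}
    (hH : IsAdmissibleHamiltonian H) :
    Continuous (fun q : ℝ × UnitAddCircle × ℝ => H q.1 q.2.1 q.2.2) :=
  (IsOpenQuotientMap.id.prodMap
    (isOpenQuotientMap_coe.prodMap IsOpenQuotientMap.id)).isQuotientMap.continuous_iff.2
      hH.contDiff.continuous

theorem IsAdmissibleHamiltonian.exists_abs_le {H : ℝ → UnitAddCircle → ℝ → ℝ}
    (hH : IsAdmissibleHamiltonian H) (P : ℝ) : ∃ C, 0 < C ∧ ∀ t x p, |p| ≤ P → |H t x p| ≤ C := by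
  obtain ⟨C, hC, h⟩ := (hH.isTonelli 0).biperiodic.exists_norm_le (hH.isTonelli 0).continuous P
  refine ⟨C, hC, fun t x p hp => ?_⟩
  obtain ⟨x, rfl⟩ := QuotientAddGroup.mk_surjective x
  have := h t x p hp
  rwa [zero_add] at this

theorem locallyIntegrableOn_timeSpace_of_memLp {t₀ : ℝ} {f : ℝ × UnitAddCircle → ℝ}
    (hf : MemLp f ⊤ (volume.restrict (timeSpace t₀))) :
    LocallyIntegrableOn f (timeSpace t₀) volume :=
  locallyIntegrableOn_of_locallyIntegrable_restrict (hf.locallyIntegrable le_top)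

theorem IsLaxOleinik.isViscositySolution {H : ℝ → UnitAddCircle → ℝ → ℝ} {c t₀ Λ : ℝ}
    {f : ℝ → ℝ} {w : ℝ → UnitAddCircle → ℝ}
    (h : IsLaxOleinik (fun t x p => H t (x : UnitAddCircle) (c + p)) t₀ f Λ (fun t x => w t x))
    (hw : Continuous (fun q : ℝ × UnitAddCircle => w q.1 q.2)) :
    IsViscositySolution H c t₀ w :=
  ⟨hw.continuousOn, h.isSubsolution, h.isSupersolution⟩

namespace IsEntropyPair

variable {H : ℝ → UnitAddCircle → ℝ → ℝ} {c t₀ Λ : ℝ} {y₀ : UnitAddCircle → ℝ}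
  {w y : ℝ → UnitAddCircle → ℝ}

/-- The supergradient inequalities at the two ends of the interval are added: the values of `w`
cancel and twice the semiconcavity constant remains. -/
theorem oleinik (hp : IsEntropyPair H c t₀ y₀ Λ w y) :
    ∃ K : ℝ → ℝ, (∀ t, t₀ < t → 0 < K t) ∧ AntitoneOn K (Ioi t₀) ∧
    ∀ t, t₀ < t → ∀ (x : UnitAddCircle) (δ : ℝ), 0 < δ →
      y t (x + (δ : UnitAddCircle)) - y t x ≤ K t * δ := by
  have hΛ := hp.lax.pos
  refine ⟨fun t => 2 * (Λ * (1 + 1 / (t - t₀))), fun t ht => ?_, fun s hs t ht hst => ?_,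
    fun t ht x δ hδ => ?_⟩
  · have : 0 < t - t₀ := by linarith
    positivity
  · have h1 : 0 < s - t₀ := by linarith [mem_Ioi.1 hs]
    have h2 : 1 / (t - t₀) ≤ 1 / (s - t₀) := one_div_le_one_div_of_le h1 (by linarith)
    dsimp only
    gcongr
  · obtain ⟨x, rfl⟩ := QuotientAddGroup.mk_surjective x
    have h1 := hp.supergradient t ht x δ
    have h2 := hp.supergradient t ht (x + δ) (-δ)
    rw [add_neg_cancel_right] at h2
    change y t ((x : UnitAddCircle) + (δ : UnitAddCircle)) - y t (x : UnitAddCircle) ≤ _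
    rw [← AddCircle.coe_add]
    refine le_of_mul_le_mul_right ?_ hδ
    nlinarith

theorem ae_abs_sub_le (hp : IsEntropyPair H c t₀ y₀ Λ w y) {t : ℝ} (ht : t₀ ≤ t) :
    ∀ᵐ x : UnitAddCircle, |y t x - c| ≤ Λ := by
  refine ae_circle_of_ae ?_
  filter_upwards [hp.ae_hasDerivAt t ht] with x hx
  have := hx.le_of_lip' hp.lax.pos.le (Eventually.of_forall fun s => hp.lax.lip t ht s x)
  exact this

theorem ae_abs_le (hp : IsEntropyPair H c t₀ y₀ Λ w y) {t : ℝ} (ht : t₀ ≤ t) :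
    ∀ᵐ x : UnitAddCircle, |y t x| ≤ Λ + |c| := by
  filter_upwards [hp.ae_abs_sub_le ht] with x hx
  have := abs_add_le (y t x - c) c
  rw [sub_add_cancel] at this
  linarith

theorem memLp (hp : IsEntropyPair H c t₀ y₀ Λ w y) {t : ℝ} (ht : t₀ ≤ t) :
    MemLp (y t) ⊤ volume :=
  memLp_top_of_bound (hp.aesm_slice t ht) (Λ + |c|) (hp.ae_abs_le ht)

theorem integrable (hp : IsEntropyPair H c t₀ y₀ Λ w y) {t : ℝ} (ht : t₀ ≤ t) :
    Integrable (y t) volume := (hp.memLp ht).integrable le_top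

theorem isWeakDeriv (hp : IsEntropyPair H c t₀ y₀ Λ w y) {t : ℝ} (ht : t₀ ≤ t) :
    IsWeakDeriv (w t) (fun x => y t x - c) :=
  isWeakDeriv_of_lipschitz hp.lax.pos.le (hp.lax.lip t ht) (hp.ae_hasDerivAt t ht)
    ((hp.integrable ht).sub (integrable_const c))

theorem ae_timeSpace_abs_le (hp : IsEntropyPair H c t₀ y₀ Λ w y) :
    ∀ᵐ q : ℝ × UnitAddCircle ∂(volume.restrict (timeSpace t₀)), |y q.1 q.2| ≤ Λ + |c| := by
  filter_upwards [ae_lt_of_restrict_timeSpace t₀] with q hq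
  have := abs_add_le (y q.1 q.2 - c) c
  rw [sub_add_cancel] at this
  linarith [hp.bound q.1 hq q.2]

theorem isBoundedOn (hp : IsEntropyPair H c t₀ y₀ Λ w y) : IsBoundedOn t₀ y :=
  memLp_top_of_bound hp.aesm (Λ + |c|) hp.ae_timeSpace_abs_le

theorem aesm_flux (hH : IsAdmissibleHamiltonian H) (hp : IsEntropyPair H c t₀ y₀ Λ w y) :
    AEStronglyMeasurable (fun q : ℝ × UnitAddCircle => H q.1 q.2 (y q.1 q.2))
      (volume.restrict (timeSpace t₀)) :=
  hH.continuous.comp_aestronglyMeasurable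
    (continuous_fst.aestronglyMeasurable.prodMk
      (continuous_snd.aestronglyMeasurable.prodMk hp.aesm))

theorem isBoundedOn_flux (hH : IsAdmissibleHamiltonian H) (hp : IsEntropyPair H c t₀ y₀ Λ w y) :
    IsBoundedOn t₀ (fun t x => H t x (y t x)) := by
  obtain ⟨C, -, hC⟩ := hH.exists_abs_le (Λ + |c|)
  refine memLp_top_of_bound (hp.aesm_flux hH) C ?_
  filter_upwards [hp.ae_timeSpace_abs_le] with q hq
  exact hC _ _ _ hq

/-- At points where `w t` is differentiable, `y` is continuous in time. -/
theorem tendsto_of_hasDerivAt (hp : IsEntropyPair H c t₀ y₀ Λ w y) {t x : ℝ} (ht : t₀ ≤ t)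
    (hd : HasDerivAt (fun s : ℝ => w t s) (y t x - c) x) :
    Tendsto (fun s => y s (x : UnitAddCircle)) (𝓝[Ici t₀] t) (𝓝 (y t x)) := by
  have hΛ := hp.lax.pos
  rw [Metric.tendsto_nhdsWithin_nhds]
  intro ε hε
  rcases ht.eq_or_lt with rfl | ht
  -- At the initial time the semiconcavity constant blows up like `1 / h`. Displacements `±η * h`
  -- balance it: the quadratic term is then of order `η ^ 2 * h`, like the allowed error of the
  -- expansion.
  · set η := ε / (4 * (1 + Λ)) with hη
    have hη0 : 0 < η := by positivity
    have hηε : η * (2 + 2 * Λ) = ε / 2 := by rw [hη]; field_simp; ring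
    obtain ⟨δ, hδ, hexp⟩ := hp.lax.expansion le_rfl hd η (mul_pos hη0 hη0)
    refine ⟨min δ 1, by positivity, fun {s} hs hst => ?_⟩
    rcases (mem_Ici.1 hs).eq_or_lt with rfl | hs
    · simpa using hε
    set h := s - t₀ with hh
    have hh0 : 0 < h := by rw [hh]; linarith
    rw [Real.dist_eq, ← hh, abs_of_pos hh0, lt_min_iff] at hst
    have e0 := hexp h 0 hh0 hst.1 (by rw [abs_zero]; positivity)
    have e1 := hexp h (η * h) hh0 hst.1 (abs_of_pos (by positivity)).le
    have e2 := hexp h (-(η * h)) hh0 hst.1 (by rw [abs_neg]; exact (abs_of_pos (by positivity)).le)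
    rw [show t₀ + h = s by rw [hh]; ring] at e0 e1 e2
    have s1 := hp.supergradient s hs x (η * h)
    have s2 := hp.supergradient s hs x (-(η * h))
    rw [add_zero] at e0
    rw [← hh] at s1 s2
    have e3 : Λ * (1 + 1 / h) * (η * h) ^ 2 = Λ * η ^ 2 * h * (h + 1) := by field_simp
    have e4 : Λ * η ^ 2 * h * (h + 1) ≤ Λ * η ^ 2 * h * 2 := by
      gcongr; linarith
    rw [e3] at s1
    rw [neg_sq, e3] at s2
    rw [abs_le] at e0 e1 e2
    rw [Real.dist_eq]
    have hlt : ε / 2 < ε := by linarith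
    refine lt_of_le_of_lt ?_ hlt
    rw [← hηε, abs_le]
    have hηh : 0 < η * h := by positivity
    constructor
    · refine le_of_mul_le_mul_right ?_ hηh
      linarith [e0.2, e1.1]
    · refine le_of_mul_le_mul_right ?_ hηh
      linarith [e0.2, e2.1]
  -- At a later time the semiconcavity constant is bounded by `κ` for nearby `s`. The supergradient
  -- `y s x` is squeezed between difference quotients of `w s` at a fixed scale `δ`, which are close
  -- to those of `w t`.
  · set κ := Λ * (1 + 2 / (t - t₀)) with hκ
    have htt : 0 < t - t₀ := by linarith
    have hκ0 : 0 < κ := by positivity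
    obtain ⟨r, hr, hdr⟩ := Metric.eventually_nhds_iff.1
      ((hasDerivAt_iff_isLittleO.1 hd).bound (show 0 < ε / 8 by positivity))
    set δ := min (r / 2) (ε / (8 * κ)) with hδ
    have hδ0 : 0 < δ := by positivity
    have hδκ : κ * δ ≤ ε / 8 := by
      have := mul_le_mul_of_nonneg_left (min_le_right (r / 2) (ε / (8 * κ))) hκ0.le
      refine this.trans_eq ?_
      field_simp
    have hδr : δ < r := (min_le_left _ _).trans_lt (by linarith)
    have d1 := hdr (y := x + δ) (by simpa [Real.dist_eq, abs_of_pos hδ0] using hδr)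
    have d2 := hdr (y := x + -δ) (by simpa [Real.dist_eq, abs_of_pos hδ0] using hδr)
    simp only [add_sub_cancel_left, smul_eq_mul, Real.norm_eq_abs, abs_neg,
      abs_of_pos hδ0] at d1 d2
    refine ⟨min ((t - t₀) / 2) (ε * δ / (16 * Λ)), by positivity, fun {s} hs hst => ?_⟩
    rw [Real.dist_eq, lt_min_iff] at hst
    have hts : (t - t₀) / 2 ≤ s - t₀ := by linarith [(abs_lt.1 hst.1).1]
    have hs0 : t₀ < s := by linarith
    have hκs : Λ * (1 + 1 / (s - t₀)) * δ ^ 2 ≤ ε / 8 * δ := by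
      have h1 : 1 / (s - t₀) ≤ 2 / (t - t₀) := by
        rw [div_le_div_iff₀ (by linarith) htt]; linarith
      have h2 : Λ * (1 + 1 / (s - t₀)) ≤ κ := by rw [hκ]; gcongr
      have h3 := mul_le_mul_of_nonneg_right h2 (sq_nonneg δ)
      have h4 := mul_le_mul_of_nonneg_right hδκ hδ0.le
      linarith
    have s1 := hp.supergradient s hs0 x δ
    have s2 := hp.supergradient s hs0 x (-δ)
    have hΛs : Λ * |s - t| ≤ ε / 16 * δ := by
      have := mul_le_mul_of_nonneg_left hst.2.le hΛ.le
      refine this.trans_eq ?_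
      field_simp
    have l0 := hp.lax.lip_time s t hs ht.le x
    have l1 := hp.lax.lip_time s t hs ht.le (x + δ)
    have l2 := hp.lax.lip_time s t hs ht.le (x + -δ)
    rw [neg_sq] at s2
    rw [abs_le] at d1 d2 l0 l1 l2
    rw [Real.dist_eq]
    have hlt : ε / 2 < ε := by linarith
    refine lt_of_le_of_lt ?_ hlt
    rw [abs_le]
    constructor
    · refine le_of_mul_le_mul_right ?_ hδ0
      linarith [l0.1, l1.1, d1.1, l0.2, l1.2, d1.2]
    · refine le_of_mul_le_mul_right ?_ hδ0
      linarith [l0.1, l2.1, d2.1, l0.2, l2.2, d2.2]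

/-- Dominated convergence: for fixed `t`, at almost every `x` the function `w t` is differentiable,
and there `y` is continuous in time at `t`. -/
theorem isContinuousL1 (hp : IsEntropyPair H c t₀ y₀ Λ w y) : IsContinuousL1 t₀ y := by
  refine ⟨fun t ht => (hp.memLp ht).mono_exponent le_top, fun t ht => ?_⟩
  simp_rw [eLpNorm_one_eq_lintegral_enorm]
  rw [show (0 : ENNReal) = ∫⁻ _ : UnitAddCircle, 0 by simp]
  refine tendsto_lintegral_filter_of_dominated_convergence'
    (fun _ => ENNReal.ofReal (2 * (Λ + |c|))) ?_ ?_ ?_ ?_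
  · filter_upwards [self_mem_nhdsWithin] with s hs
    exact ((hp.aesm_slice s hs).sub (hp.aesm_slice t ht)).enorm
  · filter_upwards [self_mem_nhdsWithin] with s hs
    filter_upwards [hp.ae_abs_le hs, hp.ae_abs_le ht] with x h1 h2
    rw [← ofReal_norm, Pi.sub_apply, Real.norm_eq_abs]
    exact ENNReal.ofReal_le_ofReal ((abs_sub _ _).trans (by linarith))
  · rw [lintegral_const, UnitAddCircle.measure_univ, mul_one]
    exact ENNReal.ofReal_ne_top
  · refine ae_circle_of_ae ?_
    filter_upwards [hp.ae_hasDerivAt t ht] with x hx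
    have := (hp.tendsto_of_hasDerivAt ht hx).sub_const (y t x)
    rw [sub_self] at this
    have := this.enorm
    rwa [enorm_zero] at this

end IsEntropyPair

/-! ### The weak form of the conservation law -/

/-- Smooth functions on `ℝ × 𝕋`. -/
def IsSmooth (φ : ℝ → UnitAddCircle → ℝ) : Prop :=
  ContDiff ℝ (⊤ : ℕ∞) (fun q : ℝ × ℝ => φ q.1 (q.2 : UnitAddCircle))

namespace IsSmooth

variable {φ : ℝ → UnitAddCircle → ℝ}

theorem continuous (hφ : IsSmooth φ) : Continuous (fun q : ℝ × UnitAddCircle => φ q.1 q.2) :=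
  continuous_of_coe_snd (ContDiff.continuous hφ)

theorem differentiable (hφ : IsSmooth φ) :
    Differentiable ℝ (fun q : ℝ × ℝ => φ q.1 (q.2 : UnitAddCircle)) :=
  ContDiff.differentiable hφ (by simp)

theorem slice (hφ : IsSmooth φ) (t : ℝ) :
    ContDiff ℝ (⊤ : ℕ∞) (fun s : ℝ => φ t (s : UnitAddCircle)) :=
  ContDiff.comp (g := fun q : ℝ × ℝ => φ q.1 (q.2 : UnitAddCircle)) hφ
    (contDiff_const.prodMk contDiff_id)

theorem hasDerivAt_time_coe (hφ : IsSmooth φ) (t x : ℝ) :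
    HasDerivAt (fun s => φ s (x : UnitAddCircle))
      (fderiv ℝ (fun q : ℝ × ℝ => φ q.1 (q.2 : UnitAddCircle)) (t, x) (1, 0)) t := by
  have h1 : HasDerivAt (fun s : ℝ => (s, x)) ((1 : ℝ), (0 : ℝ)) t :=
    (hasDerivAt_id t).prodMk (hasDerivAt_const t x)
  exact (hφ.differentiable (t, x)).hasFDerivAt.comp_hasDerivAt t h1

theorem hasDerivAt_space_coe (hφ : IsSmooth φ) (t x : ℝ) :
    HasDerivAt (fun s : ℝ => φ t (s : UnitAddCircle))
      (fderiv ℝ (fun q : ℝ × ℝ => φ q.1 (q.2 : UnitAddCircle)) (t, x) (0, 1)) x := by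
  have h1 : HasDerivAt (fun s : ℝ => (t, s)) ((0 : ℝ), (1 : ℝ)) x :=
    (hasDerivAt_const x t).prodMk (hasDerivAt_id x)
  exact (hφ.differentiable (t, x)).hasFDerivAt.comp_hasDerivAt x h1

theorem hasDerivAt_time (hφ : IsSmooth φ) (t : ℝ) (x : UnitAddCircle) :
    HasDerivAt (fun s => φ s x) (deriv (fun s => φ s x) t) t := by
  obtain ⟨x, rfl⟩ := QuotientAddGroup.mk_surjective x
  exact (hφ.hasDerivAt_time_coe t x).differentiableAt.hasDerivAt

theorem continuous_deriv_time (hφ : IsSmooth φ) :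
    Continuous (fun q : ℝ × UnitAddCircle => deriv (fun s => φ s q.2) q.1) := by
  refine continuous_of_coe_snd ?_
  simp_rw [fun q : ℝ × ℝ => (hφ.hasDerivAt_time_coe q.1 q.2).deriv]
  exact (ContDiff.continuous_fderiv hφ (by simp)).clm_apply continuous_const

theorem continuous_circleDeriv (hφ : IsSmooth φ) :
    Continuous (fun q : ℝ × UnitAddCircle => circleDeriv (φ q.1) q.2) := by
  refine continuous_of_coe_snd ?_
  simp_rw [circleDeriv_coe, fun q : ℝ × ℝ => (hφ.hasDerivAt_space_coe q.1 q.2).deriv]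
  exact (ContDiff.continuous_fderiv hφ (by simp)).clm_apply continuous_const

end IsSmooth

theorem exists_abs_le_of_continuous {f : ℝ × UnitAddCircle → ℝ} (hf : Continuous f) (a b : ℝ) :
    ∃ C, 0 < C ∧ ∀ t, a ≤ t → t ≤ b → ∀ x, |f (t, x)| ≤ C := by
  obtain ⟨C, hC⟩ := ((isCompact_Icc (a := a) (b := b)).prod
    (isCompact_univ (X := UnitAddCircle))).exists_bound_of_continuousOn hf.continuousOn
  exact ⟨max C 1, by positivity, fun t h1 h2 x =>
    (hC (t, x) ⟨⟨h1, h2⟩, trivial⟩).trans (le_max_left _ _)⟩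

theorem integrable_of_continuous_circle {f : UnitAddCircle → ℝ} (hf : Continuous f) :
    Integrable f volume :=
  hf.integrable_of_hasCompactSupport (HasCompactSupport.of_compactSpace f)

theorem exists_time_bound_of_hasCompactSupport {φ : ℝ → UnitAddCircle → ℝ}
    (hφ : HasCompactSupport (fun q : ℝ × UnitAddCircle => φ q.1 q.2)) (t₀ : ℝ) :
    ∃ T, t₀ < T ∧ ∀ t, T ≤ t → ∀ x, φ t x = 0 := by
  obtain ⟨B, hB⟩ := (IsCompact.image hφ continuous_fst).bddAbove
  refine ⟨max B t₀ + 1, by linarith [le_max_right B t₀], fun t ht x => ?_⟩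
  by_contra h
  have := hB ⟨(t, x), subset_tsupport _ h, rfl⟩
  dsimp only at this
  linarith [le_max_left B t₀]

namespace IsEntropyPair

variable {H : ℝ → UnitAddCircle → ℝ → ℝ} {c t₀ Λ : ℝ} {y₀ : UnitAddCircle → ℝ}
  {w y : ℝ → UnitAddCircle → ℝ}

theorem continuous_slice (hp : IsEntropyPair H c t₀ y₀ Λ w y) (t : ℝ) : Continuous (w t) :=
  hp.continuous.comp (continuous_const.prodMk continuous_id)

/-- The space derivative is moved to the test function, so time regularity of the pairing is read
off from `w`. The times of `y` and of `φ` are kept separate for use in difference quotients. -/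
theorem integral_mul_slice (hp : IsEntropyPair H c t₀ y₀ Λ w y) {φ : ℝ → UnitAddCircle → ℝ}
    (hφ : IsSmooth φ) {t : ℝ} (ht : t₀ ≤ t) (s : ℝ) :
    ∫ x, y t x * φ s x = c * (∫ x, φ s x) - ∫ x, w t x * circleDeriv (φ s) x := by
  have h1 := (hp.isWeakDeriv ht).2.2 (φ s) (hφ.slice s)
  have hc : Continuous (φ s) := hφ.continuous.comp (continuous_const.prodMk continuous_id)
  have hi : Integrable (fun x => (y t x - c) * φ s x) volume := by
    obtain ⟨C, hC⟩ := isCompact_univ.exists_bound_of_continuousOn hc.continuousOn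
    exact ((hp.integrable ht).sub (integrable_const c)).mul_bdd hc.aestronglyMeasurable
      (Eventually.of_forall fun x => hC x trivial)
  have h2 : ∫ x, y t x * φ s x = ∫ x, ((y t x - c) * φ s x + c * φ s x) := by
    congr 1; funext x; ring
  rw [h2, integral_add hi ((integrable_of_continuous_circle hc).const_mul c),
    integral_const_mul, h1]
  ring

theorem tendsto_slope_of_hasDerivAt (hp : IsEntropyPair H c t₀ y₀ Λ w y) {t x : ℝ} (ht : t₀ ≤ t)
    (hd : HasDerivAt (fun s : ℝ => w t s) (y t x - c) x) :
    Tendsto (fun s => (w s x - w t x) / (s - t)) (𝓝[>] t) (𝓝 (-H t x (y t x))) := by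
  rw [Metric.tendsto_nhdsWithin_nhds]
  intro ε hε
  obtain ⟨δ, hδ, hexp⟩ := hp.lax.expansion ht hd 0 (half_pos hε)
  refine ⟨δ, hδ, fun {s} hs hst => ?_⟩
  have hs0 : 0 < s - t := by linarith [mem_Ioi.1 hs]
  rw [Real.dist_eq, abs_of_pos hs0] at hst
  have := hexp (s - t) 0 hs0 hst (by simp)
  rw [add_sub_cancel, add_zero, mul_zero, sub_zero, add_sub_cancel] at this
  rw [Real.dist_eq]
  have h2 : (w s x - w t x) / (s - t) - -H t x (y t x)
      = (w s x - w t x + (s - t) * H t x (y t x)) / (s - t) := by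
    field_simp
    ring
  rw [h2, abs_div, abs_of_pos hs0, div_lt_iff₀ hs0]
  refine this.trans_lt ?_
  gcongr
  linarith

/-- The pairing of `y` with a test function has the right derivative given by the equation. -/
theorem hasDerivWithinAt_integral_mul (hp : IsEntropyPair H c t₀ y₀ Λ w y)
    {φ : ℝ → UnitAddCircle → ℝ} (hφ : IsSmooth φ) {t : ℝ} (ht : t₀ ≤ t) :
    HasDerivWithinAt (fun s => ∫ x, y s x * φ s x)
      (∫ x, (y t x * deriv (fun s => φ s x) t + H t x (y t x) * circleDeriv (φ t) x))
      (Ioi t) t := by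
  have hΛ := hp.lax.pos
  rw [hasDerivWithinAt_iff_tendsto_slope' (by simp)]
  obtain ⟨C₁, hC₁, h₁⟩ := exists_abs_le_of_continuous hφ.continuous_deriv_time t (t + 1)
  obtain ⟨C₂, hC₂, h₂⟩ := exists_abs_le_of_continuous hφ.continuous_circleDeriv t (t + 1)
  have hφc : ∀ s, Continuous (φ s) := fun s =>
    hφ.continuous.comp (continuous_const.prodMk continuous_id)
  have hφd : ∀ s, Continuous (circleDeriv (φ s)) := fun s =>
    hφ.continuous_circleDeriv.comp (continuous_const.prodMk continuous_id)
  have hi1 : ∀ s, Integrable (fun x => y t x * φ s x) volume := by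
    intro s
    obtain ⟨C, hC⟩ := isCompact_univ.exists_bound_of_continuousOn (hφc s).continuousOn
    exact (hp.integrable ht).mul_bdd (hφc s).aestronglyMeasurable
      (Eventually.of_forall fun x => hC x trivial)
  have hi2 : ∀ s s', Integrable (fun x => w s x * circleDeriv (φ s') x) volume := fun s s' =>
    integrable_of_continuous_circle ((hp.continuous_slice s).mul (hφd s'))
  have hnear : ∀ᶠ s in 𝓝[>] t, t < s ∧ s ≤ t + 1 := by
    filter_upwards [self_mem_nhdsWithin,
      nhdsWithin_le_nhds (Iic_mem_nhds (show t < t + 1 by linarith))] with s h1 h2 using ⟨h1, h2⟩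
  -- In the product rule `y` stays frozen at time `t`, and its increment appears as the increment of
  -- `w` paired with `∂ₓφ`. Each factor then has a pointwise limit and a uniform bound.
  have hslope : (fun s => ∫ x, (y t x * ((φ s x - φ t x) / (s - t))
      - (w s x - w t x) / (s - t) * circleDeriv (φ s) x)) =ᶠ[𝓝[>] t]
      slope (fun s => ∫ x, y s x * φ s x) t := by
    filter_upwards [hnear] with s hs
    have e1 : (fun x => y t x * ((φ s x - φ t x) / (s - t))
        - (w s x - w t x) / (s - t) * circleDeriv (φ s) x)
        = fun x => (s - t)⁻¹ * ((y t x * φ s x - y t x * φ t x)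
          - (w s x * circleDeriv (φ s) x - w t x * circleDeriv (φ s) x)) := by
      funext x; rw [div_eq_mul_inv, div_eq_mul_inv]; ring
    have e0 := integral_sub ((hi1 s).sub (hi1 t)) ((hi2 s s).sub (hi2 t s))
    simp only [Pi.sub_apply] at e0
    rw [e1, integral_const_mul, e0, integral_sub (hi1 s) (hi1 t), integral_sub (hi2 s s) (hi2 t s), slope_def_field,
      div_eq_inv_mul]
    congr 1
    have e2 := hp.integral_mul_slice hφ ht s
    have e3 := hp.integral_mul_slice hφ (ht.trans hs.1.le) s
    linarith
  refine Tendsto.congr' hslope ?_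
  have hae : ∀ᵐ x : UnitAddCircle, Tendsto (fun s => (w s x - w t x) / (s - t)) (𝓝[>] t)
      (𝓝 (-H t x (y t x))) := by
    refine ae_circle_of_ae ?_
    filter_upwards [hp.ae_hasDerivAt t ht] with x hx using hp.tendsto_slope_of_hasDerivAt ht hx
  refine tendsto_integral_filter_of_dominated_convergence
    (fun _ => (Λ + |c|) * C₁ + Λ * C₂) ?_ ?_ (integrable_const _) ?_
  · refine Eventually.of_forall fun s => ?_
    exact ((hp.aesm_slice t ht).mul
        (((hφc s).sub (hφc t)).div_const _).aestronglyMeasurable).sub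
      ((((hp.continuous_slice s).sub (hp.continuous_slice t)).div_const _).mul
        (hφd s)).aestronglyMeasurable
  · filter_upwards [hnear] with s hs
    have hst : 0 < s - t := by linarith [hs.1]
    filter_upwards [hp.ae_abs_le ht] with x hx
    have b1 : |(φ s x - φ t x) / (s - t)| ≤ C₁ := by
      rw [abs_div, abs_of_pos hst, div_le_iff₀ hst]
      have := (convex_Icc t (t + 1)).norm_image_sub_le_of_norm_hasDerivWithin_le
        (f := fun s => φ s x) (C := C₁) (fun r hr => (hφ.hasDerivAt_time r x).hasDerivWithinAt)
        (fun r hr => h₁ r hr.1 hr.2 x) (left_mem_Icc.2 (by linarith)) ⟨hs.1.le, hs.2⟩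
      rwa [Real.norm_eq_abs, Real.norm_eq_abs, abs_of_pos hst] at this
    have b2 : |(w s x - w t x) / (s - t)| ≤ Λ := by
      rw [abs_div, abs_of_pos hst, div_le_iff₀ hst]
      obtain ⟨x, rfl⟩ := QuotientAddGroup.mk_surjective x
      have := hp.lax.lip_time s t (ht.trans hs.1.le) ht x
      rwa [abs_of_pos hst] at this
    have b3 := h₂ s hs.1.le hs.2 x
    rw [Real.norm_eq_abs]
    refine (abs_sub _ _).trans ?_
    rw [abs_mul, abs_mul]
    gcongr
  · filter_upwards [hae] with x hx
    have l1 : Tendsto (fun s => (φ s x - φ t x) / (s - t)) (𝓝[>] t)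
        (𝓝 (deriv (fun s => φ s x) t)) := by
      have := (hasDerivWithinAt_iff_tendsto_slope' (by simp)).1
        ((hφ.hasDerivAt_time t x).hasDerivWithinAt (s := Ioi t))
      refine this.congr fun s => ?_
      rw [slope_def_field]
    have l2 : Tendsto (fun s => circleDeriv (φ s) x) (𝓝[>] t) (𝓝 (circleDeriv (φ t) x)) := by
      have : Continuous (fun s => circleDeriv (φ s) x) :=
        hφ.continuous_circleDeriv.comp (continuous_id.prodMk continuous_const)
      exact (this.tendsto t).mono_left nhdsWithin_le_nhds
    have := (l1.const_mul (y t x)).sub (hx.mul l2)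
    rwa [neg_mul, sub_neg_eq_add] at this

theorem continuousOn_integral_mul (hp : IsEntropyPair H c t₀ y₀ Λ w y)
    {φ : ℝ → UnitAddCircle → ℝ} (hφ : IsSmooth φ) (T : ℝ) :
    ContinuousOn (fun s => ∫ x, y s x * φ s x) (Icc t₀ T) := by
  have h1 : Continuous (fun s => c * (∫ x, φ s x) - ∫ x, w s x * circleDeriv (φ s) x) := by
    have e1 := continuous_parametric_integral_of_continuous (μ := (volume : Measure UnitAddCircle))
      (f := fun s x => φ s x) hφ.continuous isCompact_univ
    have e2 := continuous_parametric_integral_of_continuous (μ := (volume : Measure UnitAddCircle))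
      (f := fun s x => w s x * circleDeriv (φ s) x)
      (hp.continuous.mul hφ.continuous_circleDeriv) isCompact_univ
    simp only [Measure.restrict_univ] at e1 e2
    exact (continuous_const.mul e1).sub e2
  exact h1.continuousOn.congr fun s hs => hp.integral_mul_slice hφ hs.1 s

/-- The pairing of `y` with the test function is continuous in time and has a right derivative
everywhere, so the one-sided fundamental theorem of calculus applies up to a time past the support.
-/
theorem weak_eq (hH : IsAdmissibleHamiltonian H) (hp : IsEntropyPair H c t₀ y₀ Λ w y)
    {φ : ℝ → UnitAddCircle → ℝ} (hφ : IsSmooth φ)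
    (hsupp : HasCompactSupport (fun q : ℝ × UnitAddCircle => φ q.1 q.2)) :
    (∫ q in timeSpace t₀, (y q.1 q.2 * deriv (fun t => φ t q.2) q.1
        + H q.1 q.2 (y q.1 q.2) * circleDeriv (φ q.1) q.2))
      + ∫ x : UnitAddCircle, y t₀ x * φ t₀ x = 0 := by
  obtain ⟨T, hT, hφT⟩ := exists_time_bound_of_hasCompactSupport hsupp t₀
  set g : ℝ × UnitAddCircle → ℝ := fun q => y q.1 q.2 * deriv (fun t => φ t q.2) q.1
        + H q.1 q.2 (y q.1 q.2) * circleDeriv (φ q.1) q.2 with hg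
  have hφT' : ∀ t, T < t → ∀ x, deriv (fun t => φ t x) t = 0 := by
    intro t ht x
    have : (fun t => φ t x) =ᶠ[𝓝 t] fun _ => 0 := by
      filter_upwards [Ioi_mem_nhds ht] with s hs using hφT s (le_of_lt hs) x
    rw [this.deriv_eq, deriv_const]
  have hφT2 : ∀ t, T < t → ∀ x, circleDeriv (φ t) x = 0 := by
    intro t ht x
    have : φ t = fun _ => 0 := funext (hφT t ht.le)
    simp [circleDeriv, this]
  have hms : MeasurableSet (Ioc t₀ T ×ˢ univ : Set (ℝ × UnitAddCircle)) :=
    measurableSet_Ioc.prod MeasurableSet.univ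
  have hvol : (volume.restrict (Ioc t₀ T ×ˢ univ) : Measure (ℝ × UnitAddCircle))
      = (volume.restrict (Ioc t₀ T)).prod volume := by
    rw [Measure.volume_eq_prod, ← Measure.prod_restrict, Measure.restrict_univ]
  have hsub : (Ioc t₀ T ×ˢ univ : Set (ℝ × UnitAddCircle)) ⊆ timeSpace t₀ :=
    prod_mono (fun t ht => ht.1.le) subset_rfl
  have hle : (volume.restrict (Ioc t₀ T ×ˢ univ) : Measure (ℝ × UnitAddCircle))
      ≤ volume.restrict (timeSpace t₀) := Measure.restrict_mono hsub le_rfl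
  obtain ⟨C₁, hC₁, h₁⟩ := exists_abs_le_of_continuous hφ.continuous_deriv_time t₀ T
  obtain ⟨C₂, hC₂, h₂⟩ := exists_abs_le_of_continuous hφ.continuous_circleDeriv t₀ T
  obtain ⟨C₃, hC₃, h₃⟩ := hH.exists_abs_le (Λ + |c|)
  have hΛ := hp.lax.pos
  have hgi : Integrable g (volume.restrict (Ioc t₀ T ×ˢ univ)) := by
    have : IsFiniteMeasure (volume.restrict (Ioc t₀ T ×ˢ univ) :
        Measure (ℝ × UnitAddCircle)) := by
      rw [hvol]; infer_instance
    refine Integrable.of_bound (C := (Λ + |c|) * C₁ + C₃ * C₂) ?_ ?_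
    · exact ((hp.aesm.mul hφ.continuous_deriv_time.aestronglyMeasurable).add
        ((hp.aesm_flux hH).mul hφ.continuous_circleDeriv.aestronglyMeasurable)).mono_measure hle
    · filter_upwards [ae_restrict_mem hms, ae_mono hle hp.ae_timeSpace_abs_le] with q hq hy
      have b1 := h₁ q.1 hq.1.1.le hq.1.2 q.2
      have b2 := h₂ q.1 hq.1.1.le hq.1.2 q.2
      have b3 := h₃ q.1 q.2 _ hy
      rw [Real.norm_eq_abs]
      refine (abs_add_le _ _).trans ?_
      rw [abs_mul, abs_mul]
      gcongr
  have e1 : ∫ q in timeSpace t₀, g q = ∫ q in Ioc t₀ T ×ˢ univ, g q := by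
    refine setIntegral_eq_of_subset_of_ae_sdiff_eq_zero ?_ hsub ?_
    · exact (measurableSet_Ici.prod MeasurableSet.univ).nullMeasurableSet
    · have h0 : ∀ᵐ q : ℝ × UnitAddCircle, q ∈ timeSpace t₀ → t₀ < q.1 :=
        (ae_restrict_iff' (measurableSet_Ici.prod MeasurableSet.univ)).1
          (ae_lt_of_restrict_timeSpace t₀)
      filter_upwards [h0] with q hq hqm
      have h2 : T < q.1 := by
        by_contra h
        exact hqm.2 ⟨⟨hq hqm.1, not_lt.1 h⟩, trivial⟩
      simp only [hg, hφT' _ h2, hφT2 _ h2, mul_zero, add_zero]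
  have e2 : ∫ q in Ioc t₀ T ×ˢ univ, g q = ∫ t in t₀..T, ∫ x, g (t, x) := by
    rw [intervalIntegral.integral_of_le hT.le, hvol, integral_prod g (by rwa [← hvol])]
  have e3 := intervalIntegral.integral_eq_sub_of_hasDeriv_right_of_le hT.le
    (hp.continuousOn_integral_mul hφ T)
    (fun t ht => hp.hasDerivWithinAt_integral_mul hφ ht.1.le) (by
      rw [intervalIntegrable_iff_integrableOn_Ioc_of_le hT.le]
      exact Integrable.integral_prod_left (f := g) (by rwa [← hvol]))
  have e4 : ∫ x, y T x * φ T x = 0 := by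
    simp [hφT T le_rfl]
  rw [e1, e2]
  simp only [hg]
  rw [e3]
  linarith

theorem isEntropySolution (hH : IsAdmissibleHamiltonian H) (hp : IsEntropyPair H c t₀ y₀ Λ w y) :
    IsEntropySolution H t₀ y where
  integrable_init := hp.integrable le_rfl
  locallyIntegrable := locallyIntegrableOn_timeSpace_of_memLp hp.isBoundedOn
  locallyIntegrable_flux := locallyIntegrableOn_timeSpace_of_memLp (hp.isBoundedOn_flux hH)
  weak_eq _ hφ hsupp := hp.weak_eq hH hφ hsupp
  oleinik := hp.oleinik

end IsEntropyPair

/-! ### Fourier modes as a countable family of test functions -/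

theorem ae_circle_of_ae_restrict {P : UnitAddCircle → Prop}
    (h : ∀ᵐ x : ℝ, x ∈ Ioc (0:ℝ) 1 → P (x : UnitAddCircle)) : ∀ᵐ x : UnitAddCircle, P x := by
  refine ae_circle_of_ae ?_
  rw [← Measure.restrict_univ (μ := (volume : Measure ℝ)), ← iUnion_Ioc_intCast ℝ,
    ae_restrict_iUnion_iff]
  intro n
  rw [ae_restrict_iff' measurableSet_Ioc]
  have h1 := (measurePreserving_sub_right (volume : Measure ℝ) (n:ℝ)).quasiMeasurePreserving.ae h
  filter_upwards [h1] with x hx hxn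
  have h2 := hx ⟨by linarith [hxn.1], by linarith [hxn.2]⟩
  have h3 := (coe_periodic (fun z : UnitAddCircle => z)).sub_int_mul_eq (x := x) n
  rw [mul_one] at h3
  rwa [h3] at h2

/-- An integrable function on the circle orthogonal to all continuous functions vanishes. -/
theorem ae_eq_zero_of_integral_continuous_eq_zero {f : UnitAddCircle → ℝ}
    (hf : Integrable f volume)
    (h : ∀ g : UnitAddCircle → ℝ, Continuous g → ∫ x, g x * f x = 0) : f =ᵐ[volume] 0 := by
  have hloc : LocallyIntegrableOn (fun x : ℝ => f x) (Ioo 0 1) volume := by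
    have := intervalIntegrable_coe hf 0 1
    rw [intervalIntegrable_iff_integrableOn_Ioc_of_le zero_le_one] at this
    exact (this.mono_set Ioo_subset_Ioc_self).locallyIntegrableOn
  have key := isOpen_Ioo.ae_eq_zero_of_integral_contDiff_smul_eq_zero hloc fun g hg _ hgU => by
    have hg0 : ∀ x, x ∉ Ioo (0:ℝ) 1 → g x = 0 := fun x hx =>
      image_eq_zero_of_notMem_tsupport fun h => hx (hgU h)
    have hgc : Continuous (AddCircle.liftIco (1:ℝ) 0 g) :=
      AddCircle.liftIco_zero_continuous (by rw [hg0 0 (by simp), hg0 1 (by simp)])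
        hg.continuous.continuousOn
    have h1 := h _ hgc
    rw [← intervalIntegral_coe, intervalIntegral.integral_of_le zero_le_one,
      integral_Ioc_eq_integral_Ioo] at h1
    rw [← h1, ← setIntegral_eq_integral_of_forall_compl_eq_zero (s := Ioo (0:ℝ) 1)
      (fun x hx => by rw [hg0 x hx, zero_smul])]
    refine setIntegral_congr_fun measurableSet_Ioo fun x hx => ?_
    rw [AddCircle.liftIco_zero_coe_apply ⟨hx.1.le, hx.2⟩, smul_eq_mul]
  refine ae_circle_of_ae_restrict ?_
  have h1 : ∀ᵐ x : ℝ, x ≠ 1 := by simp [ae_iff]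
  filter_upwards [key, h1] with x hx hx1 hx2
  exact hx ⟨hx2.1, lt_of_le_of_ne hx2.2 hx1⟩

/-- The real part of a Fourier mode. -/
def cosMode (n : ℤ) (x : UnitAddCircle) : ℝ := (fourier n x : ℂ).re

/-- The imaginary part of a Fourier mode. -/
def sinMode (n : ℤ) (x : UnitAddCircle) : ℝ := (fourier n x : ℂ).im

theorem fourier_coe_eq (n : ℤ) (x : ℝ) : (fourier n (x : UnitAddCircle) : ℂ)
    = Complex.exp ((2 * Real.pi * n * x : ℝ) * Complex.I) := by
  rw [fourier_coe_apply]
  congr 1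
  push_cast
  ring

theorem cosMode_coe (n : ℤ) (x : ℝ) : cosMode n x = Real.cos (2 * Real.pi * n * x) := by
  rw [cosMode, fourier_coe_eq, Complex.exp_ofReal_mul_I_re]

theorem sinMode_coe (n : ℤ) (x : ℝ) : sinMode n x = Real.sin (2 * Real.pi * n * x) := by
  rw [sinMode, fourier_coe_eq, Complex.exp_ofReal_mul_I_im]

theorem contDiff_cosMode (n : ℤ) : ContDiff ℝ (⊤ : ℕ∞) (fun x : ℝ => cosMode n x) := by
  simp_rw [cosMode_coe]
  exact Real.contDiff_cos.comp (contDiff_const.mul contDiff_id)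

theorem contDiff_sinMode (n : ℤ) : ContDiff ℝ (⊤ : ℕ∞) (fun x : ℝ => sinMode n x) := by
  simp_rw [sinMode_coe]
  exact Real.contDiff_sin.comp (contDiff_const.mul contDiff_id)

theorem circleDeriv_cosMode (n : ℤ) (x : UnitAddCircle) :
    circleDeriv (cosMode n) x = -(2 * Real.pi * n) * sinMode n x := by
  obtain ⟨x, rfl⟩ := QuotientAddGroup.mk_surjective x
  rw [circleDeriv_coe, sinMode_coe]
  simp_rw [cosMode_coe]
  have := (((hasDerivAt_id x).const_mul (2 * Real.pi * n)).cos).deriv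
  simp only [id, mul_one] at this
  rw [this]; ring

theorem circleDeriv_sinMode (n : ℤ) (x : UnitAddCircle) :
    circleDeriv (sinMode n) x = (2 * Real.pi * n) * cosMode n x := by
  obtain ⟨x, rfl⟩ := QuotientAddGroup.mk_surjective x
  rw [circleDeriv_coe, cosMode_coe]
  simp_rw [sinMode_coe]
  have := (((hasDerivAt_id x).const_mul (2 * Real.pi * n)).sin).deriv
  simp only [id, mul_one] at this
  rw [this]; ring

theorem continuous_circleDeriv_of_contDiff {ψ : UnitAddCircle → ℝ}
    (hψ : ContDiff ℝ (⊤ : ℕ∞) (fun s : ℝ => ψ s)) : Continuous (circleDeriv ψ) := by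
  refine continuous_coinduced_dom.2 ?_
  have : Continuous (fun x : ℝ => circleDeriv ψ x) := by
    simp_rw [circleDeriv_coe]
    exact hψ.continuous_deriv (by simp)
  exact this

theorem integral_circleDeriv_eq_zero {ψ : UnitAddCircle → ℝ}
    (hψ : ContDiff ℝ (⊤ : ℕ∞) (fun s : ℝ => ψ s)) : ∫ x, circleDeriv ψ x = 0 := by
  rw [← intervalIntegral_coe]
  simp_rw [circleDeriv_coe]
  rw [intervalIntegral.integral_deriv_eq_sub
    (fun x _ => (hψ.differentiable (by simp)).differentiableAt)
    ((hψ.continuous_deriv (by simp)).intervalIntegrable _ _)]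
  have h01 := AddCircle.coe_add_period (1:ℝ) (0:ℝ)
  rw [zero_add] at h01
  rw [h01, sub_self]

/-- An integrable function with vanishing Fourier coefficients vanishes. -/
theorem ae_eq_zero_of_modes {f : UnitAddCircle → ℝ} (hf : Integrable f volume)
    (hcos : ∀ n, ∫ x, f x * cosMode n x = 0) (hsin : ∀ n, ∫ x, f x * sinMode n x = 0) :
    f =ᵐ[volume] 0 := by
  have hmul : ∀ g : C(UnitAddCircle, ℂ), Integrable (fun x => (f x : ℂ) * g x) volume := fun g =>
    hf.ofReal.mul_bdd g.continuous.aestronglyMeasurable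
      (Eventually.of_forall fun x => g.norm_coe_le_norm x)
  let L : C(UnitAddCircle, ℂ) →ₗ[ℂ] ℂ :=
    { toFun := fun g => ∫ x, (f x : ℂ) * g x
      map_add' := fun g h => by
        rw [← integral_add (hmul g) (hmul h)]
        congr 1; funext x
        rw [ContinuousMap.add_apply, mul_add]
      map_smul' := fun a g => by
        rw [RingHom.id_apply, smul_eq_mul, ← integral_const_mul]
        congr 1; funext x
        rw [ContinuousMap.smul_apply, smul_eq_mul]; ring }
  have hLc : Continuous L := by
    refine AddMonoidHomClass.continuous_of_bound L (∫ x, |f x|) fun g => ?_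
    rw [← integral_mul_const]
    refine norm_integral_le_of_norm_le (hf.abs.mul_const _) (Eventually.of_forall fun x => ?_)
    rw [norm_mul, Complex.norm_real, Real.norm_eq_abs]
    gcongr
    exact g.norm_coe_le_norm x
  have hker : ∀ g, L g = 0 := by
    intro g
    -- The bounded functional `L` vanishes on trigonometric polynomials, which are dense in the
    -- continuous functions.
    have h1 : (Submodule.span ℂ (range (fourier (T := (1:ℝ))))).topologicalClosure
        ≤ LinearMap.ker L := by
      refine Submodule.topologicalClosure_minimal _ (Submodule.span_le.2 ?_)
        (isClosed_singleton.preimage hLc)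
      rintro _ ⟨n, rfl⟩
      change ∫ x, (f x : ℂ) * fourier n x = 0
      have e1 : (fun x => (f x : ℂ) * fourier n x)
          = fun x => ((f x * cosMode n x : ℝ) : ℂ) + ((f x * sinMode n x : ℝ) : ℂ) * Complex.I := by
        funext x
        rw [← Complex.re_add_im (fourier n x : ℂ)]
        simp only [cosMode, sinMode]
        push_cast
        ring
      have hre : Integrable (fun x => f x * cosMode n x) volume := by
        have := (hmul (fourier n)).re
        refine this.congr (Eventually.of_forall fun x => ?_)
        simp [cosMode]
      have him : Integrable (fun x => f x * sinMode n x) volume := by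
        have := (hmul (fourier n)).im
        refine this.congr (Eventually.of_forall fun x => ?_)
        simp [sinMode]
      rw [e1, integral_add hre.ofReal (him.ofReal.mul_const _), integral_mul_const,
        integral_complex_ofReal, integral_complex_ofReal, hcos, hsin]
      simp
    rw [span_fourier_closure_eq_top] at h1
    exact h1 (Submodule.mem_top (x := g))
  refine ae_eq_zero_of_integral_continuous_eq_zero hf fun g hg => ?_
  have := hker ⟨fun x => (g x : ℂ), Complex.continuous_ofReal.comp hg⟩
  change ∫ x, (f x : ℂ) * (g x : ℂ) = 0 at this
  simp_rw [← Complex.ofReal_mul] at this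
  rw [integral_complex_ofReal, Complex.ofReal_eq_zero] at this
  simpa only [mul_comm] using this

/-- An integrable function whose distributional derivative vanishes on Fourier modes is
constant. -/
theorem ae_eq_const_of_modes {f : UnitAddCircle → ℝ} (hf : Integrable f volume)
    (hcos : ∀ n, ∫ x, f x * circleDeriv (cosMode n) x = 0)
    (hsin : ∀ n, ∫ x, f x * circleDeriv (sinMode n) x = 0) :
    f =ᵐ[volume] fun _ => ∫ x, f x := by
  have hfc : Integrable (fun x => f x - ∫ x, f x) volume := hf.sub (integrable_const _)
  have hmode : ∀ (n : ℤ) (g : UnitAddCircle → ℝ), Continuous g →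
      (∫ x, g x = 0) → (∫ x, f x * g x = 0) → ∫ x, (f x - ∫ x, f x) * g x = 0 := by
    intro n g hg h1 h2
    obtain ⟨C, hC⟩ := isCompact_univ.exists_bound_of_continuousOn hg.continuousOn
    have hi : Integrable (fun x => f x * g x) volume := hf.mul_bdd hg.aestronglyMeasurable
      (Eventually.of_forall fun x => hC x trivial)
    simp_rw [sub_mul]
    rw [integral_sub hi ((integrable_of_continuous_circle hg).const_mul _), integral_const_mul,
      h1, h2]
    simp
  have hcc : ∀ n, Continuous (cosMode n) := fun n =>
    Complex.continuous_re.comp (fourier n).continuous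
  have hsc : ∀ n, Continuous (sinMode n) := fun n =>
    Complex.continuous_im.comp (fourier n).continuous
  have hzero : ∫ x, (f x - ∫ x, f x) = 0 := by
    rw [integral_sub hf (integrable_const _), integral_const, measureReal_def,
      UnitAddCircle.measure_univ]
    simp
  -- Mode `0` is handled by subtracting the mean; for `n ≠ 0` each mode is a nonzero multiple of the
  -- derivative of the conjugate mode.
  have key := ae_eq_zero_of_modes hfc (fun n => ?_) (fun n => ?_)
  · filter_upwards [key] with x hx
    have : f x - ∫ x, f x = 0 := hx
    linarith
  · rcases eq_or_ne n 0 with rfl | hn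
    · have : ∀ x, cosMode 0 x = 1 := fun x => by simp [cosMode]
      simpa only [this, mul_one] using hzero
    · have hn' : (2 * Real.pi * n) ≠ 0 := by positivity
      refine hmode n _ (hcc n) ?_ ?_
      · have h1 := integral_circleDeriv_eq_zero (contDiff_sinMode n)
        simp_rw [circleDeriv_sinMode, integral_const_mul] at h1
        exact (mul_eq_zero.1 h1).resolve_left hn'
      · have h1 := hsin n
        simp_rw [circleDeriv_sinMode] at h1
        have e : (fun x => f x * (2 * Real.pi * n * cosMode n x))
            = fun x => (2 * Real.pi * n) * (f x * cosMode n x) := by funext x; ring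
        rw [e, integral_const_mul] at h1
        exact (mul_eq_zero.1 h1).resolve_left hn'
  · rcases eq_or_ne n 0 with rfl | hn
    · have : ∀ x, sinMode 0 x = 0 := fun x => by simp [sinMode]
      simp only [this, mul_zero, integral_zero]
    · have hn' : -(2 * Real.pi * n) ≠ 0 := neg_ne_zero.2 (by positivity)
      refine hmode n _ (hsc n) ?_ ?_
      · have h1 := integral_circleDeriv_eq_zero (contDiff_cosMode n)
        simp_rw [circleDeriv_cosMode, integral_const_mul] at h1
        exact (mul_eq_zero.1 h1).resolve_left hn'
      · have h1 := hcos n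
        simp_rw [circleDeriv_cosMode] at h1
        have e : (fun x => f x * (-(2 * Real.pi * n) * sinMode n x))
            = fun x => (-(2 * Real.pi * n)) * (f x * sinMode n x) := by funext x; ring
        rw [e, integral_const_mul] at h1
        exact (mul_eq_zero.1 h1).resolve_left hn'

/-! ### A priori properties of entropy solutions -/

/-- A time-dependent quantity whose distributional derivative on `[t₀,∞)` is `D`, with initial
value `A₀`, is almost everywhere the integral of `D`. -/
theorem ae_eq_add_integral_of_weak {A D : ℝ → ℝ} {t₀ A₀ : ℝ}
    (hA : ∀ T, IntegrableOn A (Ioc t₀ T) volume) (hD : ∀ T, IntegrableOn D (Ioc t₀ T) volume)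
    (h : ∀ θ : ℝ → ℝ, ContDiff ℝ (⊤ : ℕ∞) θ → HasCompactSupport θ →
      (∫ t in Ioi t₀, (deriv θ t * A t + θ t * D t)) + θ t₀ * A₀ = 0) :
    ∀ᵐ t, t₀ < t → A t = A₀ + ∫ s in t₀..t, D s := by
  have hDi : ∀ T, t₀ ≤ T → IntervalIntegrable D volume t₀ T := fun T hT => by
    rw [intervalIntegrable_iff_integrableOn_Ioc_of_le hT]; exact hD T
  have hAi : ∀ T, t₀ ≤ T → IntervalIntegrable A volume t₀ T := fun T hT => by
    rw [intervalIntegrable_iff_integrableOn_Ioc_of_le hT]; exact hA T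
  set E : ℝ → ℝ := fun t => A₀ + ∫ s in t₀..t, D s with hE
  have hEac : ∀ T, t₀ ≤ T → AbsolutelyContinuousOnInterval E t₀ T := fun T hT =>
    (ContDiffOn.absolutelyContinuousOnInterval (f := fun _ => A₀) contDiffOn_const).fun_add
      ((hDi T hT).absolutelyContinuousOnInterval_intervalIntegral left_mem_uIcc)
  have hloc : LocallyIntegrableOn (fun t => A t - E t) (Ioi t₀) volume := by
    intro t ht
    refine ⟨Ioc t₀ (t + 1), mem_nhdsWithin_of_mem_nhds (Ioc_mem_nhds ht (by linarith)), ?_⟩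
    refine (hA _).sub ?_
    have hle : t₀ ≤ t + 1 := by linarith [mem_Ioi.1 ht]
    have := (hEac (t + 1) hle).continuousOn
    rw [uIcc_of_le hle] at this
    exact (this.integrableOn_Icc).mono_set Ioc_subset_Icc_self
  have key := isOpen_Ioi.ae_eq_zero_of_integral_contDiff_smul_eq_zero hloc fun g hg hgc hgU => by
    have hg1 : ContDiff ℝ (⊤ : ℕ∞) g := hg
    have hg0 : ∀ t, t ≤ t₀ → g t = 0 := fun t ht =>
      image_eq_zero_of_notMem_tsupport fun h => absurd (hgU h) (not_lt.2 ht)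
    obtain ⟨B, hB⟩ := (show IsCompact (tsupport g) from hgc).bddAbove
    set T := max B t₀ + 1 with hTdef
    have hT : t₀ < T := by rw [hTdef]; linarith [le_max_right B t₀]
    have hgT : ∀ t, T ≤ t → g t = 0 := by
      intro t ht
      refine image_eq_zero_of_notMem_tsupport fun h => ?_
      have := hB h
      linarith [le_max_left B t₀]
    -- The test function is the primitive of `g` vanishing after `T`, so that its derivative
    -- reproduces `g`; an integration by parts against `E` gives the same identity for `E` as for
    -- `A`.
    set θ₀ : ℝ → ℝ := fun t => ∫ s in T..t, g s with hθ₀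
    have hθd : ∀ t, HasDerivAt θ₀ (g t) t := fun t =>
      intervalIntegral.integral_hasDerivAt_right (hg.continuous.intervalIntegrable _ _)
        (hg.continuous.stronglyMeasurableAtFilter _ _) hg.continuous.continuousAt
    have hθs : ContDiff ℝ (⊤ : ℕ∞) θ₀ := by
      rw [contDiff_infty_iff_deriv]
      refine ⟨fun t => (hθd t).differentiableAt, ?_⟩
      rw [show deriv θ₀ = g from funext fun t => (hθd t).deriv]
      exact hg1
    have hθT : ∀ t, T ≤ t → θ₀ t = 0 := by
      intro t ht
      refine intervalIntegral.integral_zero_ae (Eventually.of_forall fun s hs => ?_)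
      rw [uIoc_of_le ht] at hs
      exact hgT s hs.1.le
    -- `θ₀` is constant before `t₀` and need not vanish there; the cutoff equals `1` on `[t₀, T]`
    -- and makes the support compact.
    let χ : ContDiffBump t₀ := ⟨T - t₀ + 1, T - t₀ + 2, by linarith, by linarith⟩
    have hχ : ∀ t, t₀ ≤ t → t ≤ T → (χ : ℝ → ℝ) =ᶠ[𝓝 t] 1 := by
      intro t h1 h2
      refine χ.eventuallyEq_one_of_mem_ball ?_
      rw [Metric.mem_ball, Real.dist_eq, abs_of_nonneg (by linarith)]
      change t - t₀ < T - t₀ + 1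
      linarith
    have h1 := h (fun t => χ t * θ₀ t) (χ.contDiff.mul hθs) (χ.hasCompactSupport.mul_right)
    have e0 : (∫ t in Ioi t₀, (deriv (fun t => χ t * θ₀ t) t * A t + χ t * θ₀ t * D t))
        = ∫ t in t₀..T, (g t * A t + θ₀ t * D t) := by
      rw [intervalIntegral.integral_of_le hT.le]
      have e1 : (∫ t in Ioi t₀, (deriv (fun t => χ t * θ₀ t) t * A t + χ t * θ₀ t * D t))
          = ∫ t in Ioc t₀ T, (deriv (fun t => χ t * θ₀ t) t * A t + χ t * θ₀ t * D t) := by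
        refine setIntegral_eq_of_subset_of_forall_sdiff_eq_zero measurableSet_Ioi
          (fun t ht => ht.1) fun t ht => ?_
        have hTt : T < t := by
          by_contra hcon
          exact ht.2 ⟨ht.1, not_lt.1 hcon⟩
        have : (fun t => χ t * θ₀ t) =ᶠ[𝓝 t] fun _ => 0 := by
          filter_upwards [Ioi_mem_nhds hTt] with s hs
          rw [hθT s (le_of_lt hs), mul_zero]
        rw [this.deriv_eq, deriv_const, hθT t hTt.le]
        ring
      rw [e1]
      refine setIntegral_congr_fun measurableSet_Ioc fun t ht => ?_
      have hev := hχ t ht.1.le ht.2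
      have : (fun t => χ t * θ₀ t) =ᶠ[𝓝 t] θ₀ := by
        filter_upwards [hev] with s hs
        rw [hs, Pi.one_apply, one_mul]
      rw [this.deriv_eq, (hθd t).deriv, hev.eq_of_nhds, Pi.one_apply, one_mul]
    have e00 : χ t₀ = 1 := (hχ t₀ le_rfl hT.le).eq_of_nhds
    rw [e0, e00, one_mul] at h1
    have hgA : IntervalIntegrable (fun t => g t * A t) volume t₀ T :=
      (hAi T hT.le).continuousOn_mul hg.continuous.continuousOn
    have hθD : IntervalIntegrable (fun t => θ₀ t * D t) volume t₀ T :=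
      (hDi T hT.le).continuousOn_mul hθs.continuous.continuousOn
    have hEc := (hEac T hT.le).continuousOn
    have hgE : IntervalIntegrable (fun t => g t * E t) volume t₀ T :=
      (hg.continuous.continuousOn.mul hEc).intervalIntegrable
    rw [intervalIntegral.integral_add hgA hθD] at h1
    have ibp := (ContDiffOn.absolutelyContinuousOnInterval (a := t₀) (b := T)
      (hθs.of_le (by exact_mod_cast le_top)).contDiffOn).integral_mul_deriv_eq_deriv_mul
        (hEac T hT.le)
    have e2 : ∫ t in t₀..T, θ₀ t * deriv E t = ∫ t in t₀..T, θ₀ t * D t := by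
      refine intervalIntegral.integral_congr_ae ?_
      filter_upwards [(hDi T hT.le).ae_hasDerivAt_integral] with t ht htm
      have := (ht (uIoc_subset_uIcc htm) t₀ left_mem_uIcc).const_add A₀
      rw [this.deriv]
    have e3 : ∫ t in t₀..T, deriv θ₀ t * E t = ∫ t in t₀..T, g t * E t := by
      simp_rw [(hθd _).deriv]
    have e4 : E t₀ = A₀ := by simp [hE]
    rw [e2, e3, e4, hθT T le_rfl, zero_mul, zero_sub] at ibp
    have e5 : ∫ t, g t • (A t - E t) = ∫ t in t₀..T, g t * (A t - E t) := by
      rw [intervalIntegral.integral_of_le hT.le]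
      symm
      refine setIntegral_eq_integral_of_forall_compl_eq_zero fun t ht => ?_
      have : g t = 0 := by
        by_cases h1 : t ≤ t₀
        · exact hg0 t h1
        · refine hgT t ?_
          by_contra hcon
          exact ht ⟨not_le.1 h1, (not_le.1 hcon).le⟩
      rw [this, zero_mul]
    rw [e5]
    simp_rw [mul_sub]
    rw [intervalIntegral.integral_sub hgA hgE]
    linarith
  filter_upwards [key] with t ht h1
  have := ht h1
  rw [hE] at this
  linarith

/-- On the circle any point is reached from any other by moving in the positive direction by at most
`1`, so a one-sided bound controls the whole oscillation. -/
theorem sub_le_of_oleinik {g : UnitAddCircle → ℝ} {K : ℝ} (hK : 0 ≤ K)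
    (h : ∀ (x : UnitAddCircle) (δ : ℝ), 0 < δ → g (x + (δ : UnitAddCircle)) - g x ≤ K * δ)
    (a b : UnitAddCircle) : g b - g a ≤ K := by
  set δ := AddCircle.equivIoc (1:ℝ) 0 (b - a) with hδ
  have h1 := h a δ δ.2.1
  have h2 : ((δ : ℝ) : UnitAddCircle) = b - a := AddCircle.coe_equivIoc
  rw [h2, add_sub_cancel] at h1
  have h3 : (δ : ℝ) ≤ 1 := by simpa using δ.2.2
  have h4 := mul_le_mul_of_nonneg_left h3 hK
  linarith

/-- On the line `g x - K * x` is monotone, hence measurable. -/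
theorem measurable_of_oleinik {g : UnitAddCircle → ℝ} {K : ℝ}
    (h : ∀ (x : UnitAddCircle) (δ : ℝ), 0 < δ → g (x + (δ : UnitAddCircle)) - g x ≤ K * δ) :
    Measurable g := by
  have h1 : Antitone (fun x : ℝ => g x - K * x) := by
    intro x x' hx
    rcases hx.eq_or_lt with rfl | hx
    · exact le_rfl
    · have := h x (x' - x) (by linarith)
      rw [← AddCircle.coe_add, add_sub_cancel] at this
      dsimp only
      linarith
  have h2 : Measurable (fun x : ℝ => g x) := by
    have := h1.measurable.add (measurable_id.const_mul K)
    convert this using 1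
    funext x
    simp
  have h3 := h2.comp (measurable_subtype_coe.comp (AddCircle.measurableEquivIoc (1:ℝ) 0).measurable)
  convert h3 using 1
  funext x
  exact (congrArg g AddCircle.coe_equivIoc).symm

theorem abs_sub_integral_le {g : UnitAddCircle → ℝ} {K : ℝ} (hg : Integrable g volume)
    (h : ∀ a b, g b - g a ≤ K) (a : UnitAddCircle) : |g a - ∫ x, g x| ≤ K := by
  have h1 : ∀ r : ℝ, ∫ _ : UnitAddCircle, r = r := fun r => by
    rw [integral_const, measureReal_def, UnitAddCircle.measure_univ]
    simp
  have h2 : ∫ x, g x ≤ g a + K := by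
    rw [← h1 (g a + K)]
    exact integral_mono hg (integrable_const _) fun x => by linarith [h a x]
  have h3 : g a - K ≤ ∫ x, g x := by
    rw [← h1 (g a - K)]
    exact integral_mono (integrable_const _) hg fun x => by linarith [h x a]
  rw [abs_le]
  constructor <;> linarith

theorem integrableOn_of_locallyIntegrableOn_timeSpace {t₀ : ℝ} {f : ℝ × UnitAddCircle → ℝ}
    (hf : LocallyIntegrableOn f (timeSpace t₀) volume) (T : ℝ) :
    Integrable f ((volume.restrict (Ioc t₀ T)).prod volume) := by
  have h1 : IntegrableOn f (Icc t₀ T ×ˢ univ) volume :=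
    hf.integrableOn_compact_subset (prod_mono Icc_subset_Ici_self subset_rfl)
      (isCompact_Icc.prod isCompact_univ)
  have h2 := h1.mono_set (prod_mono Ioc_subset_Icc_self subset_rfl)
  rwa [IntegrableOn, Measure.volume_eq_prod, ← Measure.prod_restrict, Measure.restrict_univ] at h2

namespace IsEntropySolution

variable {H : ℝ → UnitAddCircle → ℝ → ℝ} {t₀ : ℝ} {z : ℝ → UnitAddCircle → ℝ}

theorem measurable_slice (hz : IsEntropySolution H t₀ z) {t : ℝ} (ht : t₀ < t) :
    Measurable (z t) := by
  obtain ⟨K, -, -, hK⟩ := hz.oleinik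
  exact measurable_of_oleinik (hK t ht)

theorem exists_abs_le_slice (hz : IsEntropySolution H t₀ z) {t : ℝ} (ht : t₀ < t) :
    ∃ M, ∀ x, |z t x| ≤ M := by
  obtain ⟨K, hK0, -, hK⟩ := hz.oleinik
  have h1 := sub_le_of_oleinik (hK0 t ht).le (hK t ht)
  refine ⟨K t + |z t 0|, fun x => ?_⟩
  rw [abs_le]
  constructor <;> linarith [h1 x 0, h1 0 x, neg_abs_le (z t 0), le_abs_self (z t 0)]

theorem integrable_slice (hz : IsEntropySolution H t₀ z) {t : ℝ} (ht : t₀ < t) :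
    Integrable (z t) volume := by
  obtain ⟨M, hM⟩ := hz.exists_abs_le_slice ht
  exact Integrable.of_bound (hz.measurable_slice ht).aestronglyMeasurable M
    (Eventually.of_forall hM)

/-- The conservation law tested against a function of space alone. -/
theorem ae_integral_mul (hz : IsEntropySolution H t₀ z) {ψ : UnitAddCircle → ℝ}
    (hψ : ContDiff ℝ (⊤ : ℕ∞) (fun s : ℝ => ψ s)) :
    ∀ᵐ t, t₀ < t → ∫ x, z t x * ψ x = (∫ x, z t₀ x * ψ x)
      + ∫ s in t₀..t, ∫ x, H s x (z s x) * circleDeriv ψ x := by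
  have hsm : ∀ θ : ℝ → ℝ, ContDiff ℝ (⊤ : ℕ∞) θ → IsSmooth (fun t x => θ t * ψ x) :=
    fun θ hθ => (hθ.comp contDiff_fst).mul (hψ.comp contDiff_snd)
  have hψc : Continuous ψ := continuous_coinduced_dom.2 hψ.continuous
  have hψd := continuous_circleDeriv_of_contDiff hψ
  obtain ⟨C₁, hC₁⟩ := isCompact_univ.exists_bound_of_continuousOn hψc.continuousOn
  obtain ⟨C₂, hC₂⟩ := isCompact_univ.exists_bound_of_continuousOn hψd.continuousOn
  refine ae_eq_add_integral_of_weak (fun T => ?_) (fun T => ?_) fun θ hθ hθc => ?_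
  · exact ((integrableOn_of_locallyIntegrableOn_timeSpace hz.locallyIntegrable T).mul_bdd
      (hψc.comp continuous_snd).aestronglyMeasurable
      (Eventually.of_forall fun q => hC₁ q.2 trivial)).integral_prod_left
  · exact ((integrableOn_of_locallyIntegrableOn_timeSpace hz.locallyIntegrable_flux T).mul_bdd
      (hψd.comp continuous_snd).aestronglyMeasurable
      (Eventually.of_forall fun q => hC₂ q.2 trivial)).integral_prod_left
  · have hcs : ∀ (η : ℝ → ℝ) (g : UnitAddCircle → ℝ), HasCompactSupport η →
        HasCompactSupport (fun q : ℝ × UnitAddCircle => η q.1 * g q.2) := by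
      intro η g hη
      refine HasCompactSupport.intro (K := tsupport η ×ˢ univ)
        ((show IsCompact (tsupport η) from hη).prod isCompact_univ) fun q hq => ?_
      rw [image_eq_zero_of_notMem_tsupport fun h => hq ⟨h, trivial⟩, zero_mul]
    have h1 := hz.weak_eq (fun t x => θ t * ψ x) (hsm θ hθ) (hcs θ ψ hθc)
    have hcl : IsClosed (timeSpace t₀) := isClosed_Ici.prod isClosed_univ
    have hd1 : Continuous (deriv θ) := hθ.continuous_deriv (by simp)
    have i1 := ((locallyIntegrableOn_iff_locallyIntegrable_restrict hcl).1
      hz.locallyIntegrable).integrable_smul_left_of_hasCompactSupport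
        (g := fun q => deriv θ q.1 * ψ q.2)
        ((hd1.comp continuous_fst).mul (hψc.comp continuous_snd))
        (hcs _ ψ hθc.deriv)
    have i2 := ((locallyIntegrableOn_iff_locallyIntegrable_restrict hcl).1
      hz.locallyIntegrable_flux).integrable_smul_left_of_hasCompactSupport
        (g := fun q => θ q.1 * circleDeriv ψ q.2)
        ((hθ.continuous.comp continuous_fst).mul (hψd.comp continuous_snd))
        (hcs _ _ hθc)
    have e1 : ∀ q : ℝ × UnitAddCircle,
        z q.1 q.2 * _root_.deriv (fun t => θ t * ψ q.2) q.1
          + H q.1 q.2 (z q.1 q.2) * circleDeriv (fun x => θ q.1 * ψ x) q.2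
        = (deriv θ q.1 * ψ q.2) • z q.1 q.2
          + (θ q.1 * circleDeriv ψ q.2) • H q.1 q.2 (z q.1 q.2) := by
      intro q
      have h2 : circleDeriv (fun x => θ q.1 * ψ x) q.2 = θ q.1 * circleDeriv ψ q.2 := by
        simp only [circleDeriv]
        exact deriv_const_mul_field _
      rw [h2, deriv_mul_const_field, smul_eq_mul, smul_eq_mul]
      ring
    have h2 := h1
    simp_rw [e1] at h2
    have i3 := i1.add i2
    rw [volume_restrict_timeSpace] at h2 i3
    have e2 := integral_prod _ i3
    simp only [Pi.add_apply] at e2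
    rw [e2] at h2
    have e3 : ∀ᵐ t ∂(volume.restrict (Ioi t₀)), ∫ x, ((deriv θ t * ψ x) • z t x
        + (θ t * circleDeriv ψ x) • H t x (z t x))
        = deriv θ t * (∫ x, z t x * ψ x) + θ t * ∫ x, H t x (z t x) * circleDeriv ψ x := by
      rw [volume_restrict_timeSpace] at i1 i2
      filter_upwards [i1.prod_right_ae, i2.prod_right_ae] with t ht1 ht2
      rw [integral_add ht1 ht2, ← integral_const_mul, ← integral_const_mul]
      congr 1 <;> (congr 1; funext x; rw [smul_eq_mul]; ring)
    rw [integral_congr_ae e3] at h2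
    rw [← h2]
    congr 1
    rw [← integral_const_mul]
    congr 1; funext x; ring

theorem ae_integral_eq (hz : IsEntropySolution H t₀ z) :
    ∀ᵐ t, t₀ < t → ∫ x, z t x = ∫ x, z t₀ x := by
  have := hz.ae_integral_mul (ψ := fun _ => 1) contDiff_const
  filter_upwards [this] with t ht h1
  have h2 := ht h1
  have h3 : ∀ x : UnitAddCircle, circleDeriv (fun _ => (1:ℝ)) x = 0 := fun x => by
    simp [circleDeriv]
  simpa only [h3, mul_one, mul_zero, integral_zero, intervalIntegral.integral_zero,
    add_zero] using h2

/-- Entropy solutions are bounded away from the initial time. -/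
theorem ae_abs_le (hz : IsEntropySolution H t₀ z) {s : ℝ} (hs : t₀ < s) :
    ∃ P, 0 < P ∧ ∀ᵐ t, s ≤ t → ∀ x, |z t x| ≤ P := by
  obtain ⟨K, hK0, hKa, hK⟩ := hz.oleinik
  -- The mean is conserved, and the oscillation at times after `s` is at most `K s`.
  refine ⟨K s + |∫ x, z t₀ x|, by have := hK0 s hs; positivity, ?_⟩
  filter_upwards [hz.ae_integral_eq] with t ht hst x
  have ht0 : t₀ < t := hs.trans_le hst
  have h1 := abs_sub_integral_le (hz.integrable_slice ht0)
    (sub_le_of_oleinik (hK0 t ht0).le (hK t ht0)) x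
  rw [ht ht0] at h1
  have h2 : K t ≤ K s := hKa hs ht0 hst
  have h3 := abs_add_le (z t x - ∫ x, z t₀ x) (∫ x, z t₀ x)
  rw [sub_add_cancel] at h3
  linarith

end IsEntropySolution

/-! ### Transport by one-sided Lipschitz velocities -/

/-- Integration by parts for a velocity with a one-sided Lipschitz bound. -/
theorem neg_integral_mul_deriv_le {F b g : UnitAddCircle → ℝ} {Λ κ B : ℝ}
    (hF : ∀ x y : ℝ, |F x - F y| ≤ Λ * |x - y|) (hF0 : ∀ x, 0 ≤ F x)
    (hg : ∀ᵐ x : ℝ, HasDerivAt (fun s : ℝ => F s) (g x) x) (hb : Measurable b)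
    (hbB : ∀ x, |b x| ≤ B)
    (hosl : ∀ (x : UnitAddCircle) (δ : ℝ), 0 < δ → b (x + (δ : UnitAddCircle)) - b x ≤ κ * δ) :
    -∫ x, b x * g x ≤ κ * ∫ x, F x := by
  have hFc := continuous_circle_of_lipschitz hF
  have hFi := integrable_of_continuous_circle hFc
  have hB : 0 ≤ B := (abs_nonneg _).trans (hbB 0)
  set δ : ℕ → ℝ := fun n => 1 / ((n:ℝ) + 1) with hδ
  have hδ0 : ∀ n, 0 < δ n := fun n => by simp only [hδ]; positivity
  have hδt : Tendsto δ atTop (𝓝[>] 0) := tendsto_nhdsWithin_iff.2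
    ⟨tendsto_one_div_add_atTop_nhds_zero_nat, Eventually.of_forall hδ0⟩
  have hbF : ∀ r : UnitAddCircle, Integrable (fun x => b (x - r) * F x) volume := fun r => by
    have := hFi.bdd_mul (f := fun x => b (x - r)) (c := B)
      (hb.comp (measurable_id.sub_const r)).aestronglyMeasurable
      (Eventually.of_forall fun x => hbB _)
    exact this
  have hlim : Tendsto (fun n => ∫ x, b x * ((F (x + (δ n : UnitAddCircle)) - F x) / δ n)) atTop
      (𝓝 (∫ x, b x * g x)) := by
    refine tendsto_integral_of_dominated_convergence (fun _ => B * Λ) (fun n => ?_)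
      (integrable_const _) (fun n => Eventually.of_forall fun x => ?_) ?_
    · exact hb.aestronglyMeasurable.mul
        (((hFc.comp (continuous_id.add continuous_const)).sub hFc).div_const
          _).aestronglyMeasurable
    · obtain ⟨x, rfl⟩ := QuotientAddGroup.mk_surjective x
      have h1 := hF (x + δ n) x
      rw [AddCircle.coe_add, add_sub_cancel_left] at h1
      rw [norm_mul, Real.norm_eq_abs, Real.norm_eq_abs, abs_div, abs_of_pos (hδ0 n)]
      rw [abs_of_pos (hδ0 n)] at h1
      have h2 := hbB (x : UnitAddCircle)
      have h3 : |F ((x : UnitAddCircle) + (δ n : UnitAddCircle)) - F (x : UnitAddCircle)| / δ n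
          ≤ Λ := (div_le_iff₀ (hδ0 n)).2 h1
      exact mul_le_mul h2 h3 (by have := hδ0 n; positivity) hB
    · refine ae_circle_of_ae ?_
      filter_upwards [hg] with x hx
      have h1 := hx.hasDerivWithinAt (s := Ioi x)
      rw [hasDerivWithinAt_iff_tendsto_slope' (by simp)] at h1
      have h2 : Tendsto (fun n => x + δ n) atTop (𝓝[>] x) := by
        refine tendsto_nhdsWithin_iff.2 ⟨?_, Eventually.of_forall fun n => ?_⟩
        · simpa using (tendsto_nhdsWithin_iff.1 hδt).1.const_add x
        · simp only [mem_Ioi]; linarith [hδ0 n]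
      have h3 := (h1.comp h2).const_mul (b x)
      refine h3.congr fun n => ?_
      simp only [Function.comp_apply, slope_def_field, add_sub_cancel_left, AddCircle.coe_add]
  refine le_of_tendsto hlim.neg (Eventually.of_forall fun n => ?_)
  -- Translation invariance moves the difference quotient from `F` to `b`, where the one-sided bound
  -- applies because `F` is nonnegative.
  have hshift : ∫ x, b x * F (x + (δ n : UnitAddCircle))
      = ∫ x, b (x - (δ n : UnitAddCircle)) * F x := by
    rw [← integral_add_right_eq_self (fun x => b (x - (δ n : UnitAddCircle)) * F x)
      (δ n : UnitAddCircle)]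
    simp only [add_sub_cancel_right]
  have hi0 : Integrable (fun x => b x * F x) volume := by simpa only [sub_zero] using hbF 0
  have hi1 : Integrable (fun x => b x * F (x + (δ n : UnitAddCircle))) volume := by
    have := (hbF (δ n)).comp_add_right (δ n : UnitAddCircle)
    simpa only [add_sub_cancel_right] using this
  have e1 : (fun x => b x * ((F (x + (δ n : UnitAddCircle)) - F x) / δ n))
      = fun x => (δ n)⁻¹ * (b x * F (x + (δ n : UnitAddCircle)) - b x * F x) := by
    funext x; rw [div_eq_inv_mul]; ring
  rw [e1, integral_const_mul, integral_sub hi1 hi0, hshift, ← integral_sub (hbF _) hi0,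
    ← integral_const_mul, ← integral_neg, ← integral_const_mul]
  refine integral_mono (((hbF _).sub hi0).const_mul _).neg (hFi.const_mul _) fun x => ?_
  have h1 := hosl (x - (δ n : UnitAddCircle)) (δ n) (hδ0 n)
  rw [sub_add_cancel] at h1
  have h2 := mul_le_mul_of_nonneg_right h1 (hF0 x)
  dsimp only
  rw [← sub_mul, ← mul_neg, ← neg_mul, neg_sub, inv_mul_le_iff₀ (hδ0 n)]
  linarith

theorem IsAdmissibleHamiltonian.isTonelli_self {H : ℝ → UnitAddCircle → ℝ → ℝ}
    (hH : IsAdmissibleHamiltonian H) : IsTonelli (fun t x p => H t (x : UnitAddCircle) p) := by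
  simpa only [zero_add] using hH.isTonelli 0

/-- The average of `∂ₚ H` over the segment between two momenta. -/
def averageSpeed (H : ℝ → UnitAddCircle → ℝ → ℝ) (t : ℝ) (x : UnitAddCircle) (p q : ℝ) : ℝ :=
  ∫ θ in (0:ℝ)..1, deriv (H t x) (q + θ * (p - q))

namespace IsAdmissibleHamiltonian

variable {H : ℝ → UnitAddCircle → ℝ → ℝ}

theorem continuous_deriv (hH : IsAdmissibleHamiltonian H) :
    Continuous (fun q : ℝ × UnitAddCircle × ℝ => deriv (H q.1 q.2.1) q.2.2) :=
  (IsOpenQuotientMap.id.prodMap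
    (isOpenQuotientMap_coe.prodMap IsOpenQuotientMap.id)).isQuotientMap.continuous_iff.2
      hH.isTonelli_self.contDiff_dP.continuous

theorem hasDerivAt (hH : IsAdmissibleHamiltonian H) (t : ℝ) (x : UnitAddCircle) (p : ℝ) :
    HasDerivAt (H t x) (deriv (H t x) p) p := by
  obtain ⟨x, rfl⟩ := QuotientAddGroup.mk_surjective x
  exact hH.isTonelli_self.hasDerivAt_dP t x p

theorem continuous_segment (hH : IsAdmissibleHamiltonian H) (t : ℝ) (x : UnitAddCircle)
    (p q : ℝ) : Continuous (fun θ : ℝ => deriv (H t x) (q + θ * (p - q))) :=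
  hH.continuous_deriv.comp (continuous_const.prodMk (continuous_const.prodMk (by fun_prop)))

theorem mul_averageSpeed (hH : IsAdmissibleHamiltonian H) (t : ℝ) (x : UnitAddCircle) (p q : ℝ) :
    averageSpeed H t x p q * (p - q) = H t x p - H t x q := by
  have h1 : ∀ θ ∈ uIcc (0:ℝ) 1, HasDerivAt (fun θ : ℝ => H t x (q + θ * (p - q)))
      (deriv (H t x) (q + θ * (p - q)) * (p - q)) θ := by
    intro θ _
    have h2 : HasDerivAt (fun θ : ℝ => q + θ * (p - q)) (p - q) θ := by
      simpa using ((hasDerivAt_id θ).mul_const (p - q)).const_add q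
    exact (hH.hasDerivAt t x _).comp θ h2
  have h2 := intervalIntegral.integral_eq_sub_of_hasDerivAt h1
    (((hH.continuous_segment t x p q).mul continuous_const).intervalIntegrable _ _)
  rw [intervalIntegral.integral_mul_const] at h2
  rw [averageSpeed, h2]
  simp

theorem continuous_averageSpeed (hH : IsAdmissibleHamiltonian H) (t : ℝ) :
    Continuous (fun a : UnitAddCircle × ℝ × ℝ => averageSpeed H t a.1 a.2.1 a.2.2) := by
  refine intervalIntegral.continuous_parametric_intervalIntegral_of_continuous' ?_ 0 1
  exact hH.continuous_deriv.comp (continuous_const.prodMk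
    ((continuous_fst.comp continuous_fst).prodMk (by fun_prop)))

/-- Local bounds for the average speed; it is one-sided Lipschitz along one-sided Lipschitz
arguments. -/
theorem exists_averageSpeed_bounds (hH : IsAdmissibleHamiltonian H) (P : ℝ) :
    ∃ C, 0 < C ∧ (∀ t x p q, |p| ≤ P → |q| ≤ P → |averageSpeed H t x p q| ≤ C) ∧
      ∀ t (x : UnitAddCircle) (δ K p q p' q' : ℝ), 0 ≤ δ → 0 ≤ K → |p| ≤ P → |q| ≤ P →
        |p'| ≤ P → |q'| ≤ P → p' - p ≤ K * δ → q' - q ≤ K * δ →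
        averageSpeed H t (x + (δ : UnitAddCircle)) p' q' - averageSpeed H t x p q
          ≤ C * (1 + K) * δ := by
  obtain ⟨C, hC, h1, h2⟩ := hH.isTonelli_self.biperiodic_dP.exists_lipschitz
    hH.isTonelli_self.contDiff_dP P
  have hseg : ∀ p q θ : ℝ, |p| ≤ P → |q| ≤ P → 0 ≤ θ → θ ≤ 1 → |q + θ * (p - q)| ≤ P := by
    intro p q θ hp hq h0 h1
    rw [abs_le] at hp hq ⊢
    constructor <;> nlinarith
  refine ⟨C, hC, fun t x p q hp hq => ?_, fun t x δ K p q p' q' hδ hK hp hq hp' hq' hpp hqq => ?_⟩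
  · obtain ⟨x, rfl⟩ := QuotientAddGroup.mk_surjective x
    have := intervalIntegral.norm_integral_le_of_norm_le_const (a := 0) (b := 1) (C := C)
      (f := fun θ : ℝ => deriv (H t (x : UnitAddCircle)) (q + θ * (p - q))) (fun θ hθ => by
        rw [uIoc_of_le zero_le_one] at hθ
        exact h1 t x _ (hseg p q θ hp hq hθ.1.le hθ.2))
    rw [sub_zero, abs_one, mul_one] at this
    exact this
  · obtain ⟨x, rfl⟩ := QuotientAddGroup.mk_surjective x
    rw [averageSpeed, averageSpeed, ← intervalIntegral.integral_sub
      ((hH.continuous_segment _ _ _ _).intervalIntegrable _ _)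
      ((hH.continuous_segment _ _ _ _).intervalIntegrable _ _)]
    have e1 : C * (1 + K) * δ = ∫ _ in (0:ℝ)..1, C * (1 + K) * δ := by simp
    rw [e1]
    refine intervalIntegral.integral_mono_on zero_le_one
      (((hH.continuous_segment _ _ _ _).sub
        (hH.continuous_segment _ _ _ _)).intervalIntegrable _ _)
      (continuous_const.intervalIntegrable _ _) fun θ hθ => ?_
    set m := q + θ * (p - q) with hm
    set m' := q' + θ * (p' - q') with hm'
    have hmm : m' - m ≤ K * δ := by
      have e2 : m' - m = θ * (p' - p) + (1 - θ) * (q' - q) := by rw [hm, hm']; ring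
      have := mul_le_mul_of_nonneg_left hpp hθ.1
      have := mul_le_mul_of_nonneg_left hqq (sub_nonneg.2 hθ.2)
      linarith
    have b1 := hseg p q θ hp hq hθ.1 hθ.2
    have b2 := hseg p' q' θ hp' hq' hθ.1 hθ.2
    change dP (fun t x p => H t (x : UnitAddCircle) p) t (x + δ) m'
      - dP (fun t x p => H t (x : UnitAddCircle) p) t x m ≤ _
    have hCδ : 0 ≤ C * (K * δ) := by positivity
    -- Convexity enters here: if the momentum decreases, so does `∂ₚH`, and only the dependence on
    -- `x` is left. Upper bounds on momentum increments thus suffice.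
    rcases le_total m' m with h | h
    · have h3 := (hH.isTonelli_self.strictMono_dP t (x + δ)).monotone h
      have h4 := (le_abs_self _).trans (h2 t (x + δ) m t x m b1 b1)
      rw [sub_self, sub_self, abs_zero, add_sub_cancel_left, abs_of_nonneg hδ, zero_add,
        add_zero] at h4
      linarith
    · have h4 := (le_abs_self _).trans (h2 t (x + δ) m' t x m b2 b1)
      rw [sub_self, abs_zero, add_sub_cancel_left, abs_of_nonneg hδ, zero_add,
        abs_of_nonneg (sub_nonneg.2 h)] at h4
      have h5 := mul_le_mul_of_nonneg_left hmm hC.le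
      linarith

end IsAdmissibleHamiltonian

/-- Squaring the positive part makes it differentiable at `0`, so the chain rule holds for the
excess at every point where the primitive is differentiable. -/
theorem hasDerivAt_max_zero_sq (a : ℝ) :
    HasDerivAt (fun a : ℝ => max a 0 ^ 2) (2 * max a 0) a := by
  rcases lt_trichotomy a 0 with h | rfl | h
  · rw [max_eq_right h.le, mul_zero]
    refine (hasDerivAt_const a (0:ℝ)).congr_of_eventuallyEq ?_
    filter_upwards [Iio_mem_nhds h] with b hb
    rw [max_eq_right (le_of_lt hb)]
    simp
  · rw [max_self, mul_zero, hasDerivAt_iff_isLittleO]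
    simp only [max_self, smul_eq_mul, mul_zero, sub_zero]
    refine Asymptotics.IsBigO.trans_isLittleO (g := fun b : ℝ => b ^ 2) ?_ ?_
    · refine Asymptotics.isBigO_of_le _ fun b => ?_
      rw [Real.norm_eq_abs, Real.norm_eq_abs, zero_pow two_ne_zero, sub_zero, abs_pow, abs_pow]
      have := abs_max_sub_max_le_abs b 0 0
      simp only [max_self, sub_zero] at this
      exact pow_le_pow_left₀ (abs_nonneg _) this 2
    · exact Asymptotics.isLittleO_pow_id one_lt_two
  · rw [max_eq_left h.le]
    have := (hasDerivAt_id a).pow 2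
    simp only [id, mul_one, Nat.cast_ofNat] at this
    refine (this.congr_of_eventuallyEq ?_).congr_deriv (by simp)
    filter_upwards [Ioi_mem_nhds h] with b hb
    simp [max_eq_left (le_of_lt (mem_Ioi.1 hb))]

/-- At a fixed time, the square of the excess of a primitive of `z₁ - z₂` over a level is
increased at most at a controlled rate by the flux difference. -/
theorem exists_excess_bound {H : ℝ → UnitAddCircle → ℝ → ℝ} (hH : IsAdmissibleHamiltonian H)
    (P K : ℝ) (hK : 0 ≤ K) : ∃ κ, 0 ≤ κ ∧ ∀ (t M Λ : ℝ) (z₁ z₂ d : UnitAddCircle → ℝ),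
      Measurable z₁ → Measurable z₂ → (∀ x, |z₁ x| ≤ P) → (∀ x, |z₂ x| ≤ P) →
      (∀ (x : UnitAddCircle) (δ : ℝ), 0 < δ → z₁ (x + (δ : UnitAddCircle)) - z₁ x ≤ K * δ) →
      (∀ (x : UnitAddCircle) (δ : ℝ), 0 < δ → z₂ (x + (δ : UnitAddCircle)) - z₂ x ≤ K * δ) →
      (∀ x y : ℝ, |d x - d y| ≤ Λ * |x - y|) →
      (∀ᵐ x : ℝ, HasDerivAt (fun s : ℝ => d s) (z₁ x - z₂ x) x) →
      -∫ x, 2 * max (d x - M) 0 * (H t x (z₁ x) - H t x (z₂ x))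
        ≤ κ * ∫ x, max (d x - M) 0 ^ 2 := by
  obtain ⟨C, hC, hC1, hC2⟩ := hH.exists_averageSpeed_bounds P
  refine ⟨C * (1 + K), by positivity, fun t M Λ z₁ z₂ d hm₁ hm₂ hb₁ hb₂ ho₁ ho₂ hd hd' => ?_⟩
  have hdc := continuous_circle_of_lipschitz hd
  obtain ⟨R, hR⟩ := isCompact_univ.exists_bound_of_continuousOn
    (f := fun x => max (d x - M) 0) ((hdc.sub continuous_const).max continuous_const).continuousOn
  have hΛ : 0 ≤ Λ := by simpa using (abs_nonneg _).trans (hd 1 0)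
  have hbm : Measurable (fun x => averageSpeed H t x (z₁ x) (z₂ x)) :=
    (hH.continuous_averageSpeed t).measurable.comp (measurable_id.prodMk (hm₁.prodMk hm₂))
  -- The flux difference is the average speed times `z₁ - z₂`, which is the derivative of `d`; the
  -- integrand is therefore the speed times the derivative of the squared excess.
  have key := neg_integral_mul_deriv_le (F := fun x => max (d x - M) 0 ^ 2)
    (b := fun x => averageSpeed H t x (z₁ x) (z₂ x))
    (g := fun x => 2 * max (d x - M) 0 * (z₁ x - z₂ x)) (Λ := 2 * R * Λ) (κ := C * (1 + K))
    (B := C) (fun x y => ?_) (fun x => sq_nonneg _) ?_ hbm (fun x => hC1 t x _ _ (hb₁ x) (hb₂ x))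
    (fun x δ hδ => hC2 t x δ K _ _ _ _ hδ.le hK (hb₁ x) (hb₂ x) (hb₁ _) (hb₂ _) (ho₁ x δ hδ)
      (ho₂ x δ hδ))
  · have e1 : ∀ x, averageSpeed H t x (z₁ x) (z₂ x) * (2 * max (d x - M) 0 * (z₁ x - z₂ x))
        = 2 * max (d x - M) 0 * (H t x (z₁ x) - H t x (z₂ x)) := by
      intro x
      rw [← hH.mul_averageSpeed]; ring
    simpa only [e1] using key
  · have h1 := hR (x : UnitAddCircle) trivial
    have h2 := hR (y : UnitAddCircle) trivial
    have h3 := abs_max_sub_max_le_abs (d x - M) (d y - M) 0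
    rw [sub_sub_sub_cancel_right] at h3
    have h4 := h3.trans (hd x y)
    rw [sq_sub_sq, abs_mul]
    rw [Real.norm_eq_abs] at h1 h2
    have h5 := (abs_add_le (max (d x - M) 0) (max (d y - M) 0)).trans (add_le_add h1 h2)
    calc _ ≤ (R + R) * (Λ * |x - y|) := mul_le_mul h5 h4 (abs_nonneg _) (by
          linarith [(abs_nonneg _).trans h1])
      _ = _ := by ring
  · filter_upwards [hd'] with x hx
    have h1 := hasDerivAt_max_zero_sq (d x - M)
    have h2 := hx.sub_const M
    exact h1.comp x h2

/-! ### Grönwall's inequality for the excess over a level -/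

theorem ae_prod_of_ae_ae {α β : Type*} [MeasurableSpace α] [MeasurableSpace β] {μ : Measure α}
    {ν : Measure β} [SFinite μ] [SFinite ν] {p : α × β → Prop}
    (hp : NullMeasurableSet {q | p q} (μ.prod ν)) (h : ∀ᵐ a ∂μ, ∀ᵐ b ∂ν, p (a, b)) :
    ∀ᵐ q ∂(μ.prod ν), p q := by
  obtain ⟨s, hs, hsp⟩ := hp
  have h1 : ∀ᵐ q ∂(μ.prod ν), (p q ↔ q ∈ s) := by
    filter_upwards [hsp.mem_iff] with q hq using hq
  have h2 : ∀ᵐ q ∂(μ.prod ν), q ∈ s := by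
    rw [Measure.ae_prod_mem_iff_ae_ae_mem hs]
    filter_upwards [h, Measure.ae_ae_of_ae_prod h1] with a ha1 ha2
    filter_upwards [ha1, ha2] with b hb1 hb2 using hb2.1 hb1
  filter_upwards [h1, h2] with q hq1 hq2 using hq1.2 hq2

theorem ae_ae_swap_of_ae_ae {μ : Measure ℝ} [SFinite μ] {β : ℝ × UnitAddCircle → ℝ}
    (hβ : AEStronglyMeasurable β (μ.prod volume)) {C : ℝ}
    (h : ∀ᵐ t ∂μ, ∀ x, |β (t, x)| ≤ C) : ∀ᵐ x : UnitAddCircle, ∀ᵐ t ∂μ, |β (t, x)| ≤ C := by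
  have h1 : ∀ᵐ q ∂(μ.prod (volume : Measure UnitAddCircle)), |β q| ≤ C := by
    refine ae_prod_of_ae_ae ?_ (h.mono fun t ht => Eventually.of_forall ht)
    exact nullMeasurableSet_le hβ.norm.aemeasurable aemeasurable_const
  exact Measure.ae_ae_of_ae_prod
    ((Measure.measurePreserving_swap (μ := (volume : Measure UnitAddCircle))
      (ν := μ)).quasiMeasurePreserving.ae h1)

/-- Grönwall argument for the excess of the time integral `D` of `-β` over a level. -/
theorem ae_le_of_excess_bound {β : ℝ × UnitAddCircle → ℝ} {t₀ T s C M κ : ℝ}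
    (hβ : Integrable β ((volume.restrict (Ioc t₀ T)).prod volume)) (hs : t₀ ≤ s)
    (hC : ∀ᵐ t, s < t → t ≤ T → ∀ x, |β (t, x)| ≤ C) (hC0 : 0 ≤ C) (hκ : 0 ≤ κ)
    (hrate : ∀ᵐ t, s < t → t ≤ T →
      -∫ x, 2 * max ((-∫ r in t₀..t, β (r, x)) - M) 0 * β (t, x)
        ≤ κ * ∫ x, max ((-∫ r in t₀..t, β (r, x)) - M) 0 ^ 2)
    (hinit : ∀ᵐ x : UnitAddCircle, (-∫ r in t₀..s, β (r, x)) ≤ M) {t : ℝ} (hst : s ≤ t)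
    (htT : t ≤ T) : ∀ᵐ x : UnitAddCircle, (-∫ r in t₀..t, β (r, x)) ≤ M := by
  set D : ℝ → UnitAddCircle → ℝ := fun t x => -∫ r in t₀..t, β (r, x) with hD
  set m : ℝ → UnitAddCircle → ℝ := fun t x => max (D t x - M) 0 with hm
  set I : ℝ → ℝ := fun t => ∫ x, m t x ^ 2 with hI
  set R := C * (T - s) with hR
  have hTs : 0 ≤ T - s := by linarith
  have hR0 : 0 ≤ R := by positivity
  have hres : ∀ a b, t₀ ≤ a → b ≤ T → Integrable β ((volume.restrict (Ioc a b)).prod volume) := by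
    intro a b ha hb
    refine hβ.mono_measure ?_
    exact Measure.prod_mono (Measure.restrict_mono (Ioc_subset_Ioc ha hb) le_rfl) le_rfl
  have hii : ∀ᵐ x : UnitAddCircle, ∀ a b, t₀ ≤ a → a ≤ b → b ≤ T →
      IntervalIntegrable (fun r => β (r, x)) volume a b := by
    filter_upwards [hβ.prod_left_ae] with x hx a b ha hab hb
    rw [intervalIntegrable_iff_integrableOn_Ioc_of_le hab]
    exact IntegrableOn.mono_set hx (Ioc_subset_Ioc ha hb)
  have hbd : ∀ᵐ x : UnitAddCircle, ∀ᵐ r, s < r → r ≤ T → |β (r, x)| ≤ C := by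
    have h1 : ∀ᵐ r ∂(volume.restrict (Ioc s T)), ∀ x, |β (r, x)| ≤ C := by
      rw [ae_restrict_iff' measurableSet_Ioc]
      filter_upwards [hC] with r hr hrm using hr hrm.1 hrm.2
    filter_upwards [ae_ae_swap_of_ae_ae (hres s T hs le_rfl).1 h1] with x hx
    rw [ae_restrict_iff' measurableSet_Ioc] at hx
    filter_upwards [hx] with r hr h2 h3 using hr ⟨h2, h3⟩
  have hDm : ∀ a, t₀ ≤ a → a ≤ T → AEStronglyMeasurable (D a) volume := by
    intro a ha haT
    have := (hres t₀ a le_rfl haT).integral_prod_right.aestronglyMeasurable.neg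
    refine this.congr (Eventually.of_forall fun x => ?_)
    simp only [hD, Pi.neg_apply, intervalIntegral.integral_of_le ha]
  have hmm : ∀ a, t₀ ≤ a → a ≤ T → AEStronglyMeasurable (m a) volume := by
    intro a ha haT
    have : Continuous (fun r : ℝ => max (r - M) 0) :=
      (continuous_id.sub continuous_const).max continuous_const
    exact this.comp_aestronglyMeasurable (hDm a ha haT)
  have hDdiff : ∀ᵐ x : UnitAddCircle, ∀ a b, s ≤ a → a ≤ b → b ≤ T →
      D b x - D a x = -∫ r in a..b, β (r, x) := by
    filter_upwards [hii] with x hx a b ha hab hb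
    have h1 := intervalIntegral.integral_add_adjacent_intervals
      (hx t₀ a le_rfl (hs.trans ha) (hab.trans hb)) (hx a b (hs.trans ha) hab hb)
    simp only [hD]
    linarith
  have hDlip : ∀ᵐ x : UnitAddCircle, ∀ a b, s ≤ a → a ≤ b → b ≤ T →
      |D b x - D a x| ≤ C * (b - a) := by
    filter_upwards [hDdiff, hbd] with x h1 h2 a b ha hab hb
    rw [h1 a b ha hab hb, abs_neg]
    have := intervalIntegral.norm_integral_le_of_norm_le_const_ae (a := a) (b := b) (C := C)
      (f := fun r => β (r, x)) (by
        filter_upwards [h2] with r hr hrm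
        rw [uIoc_of_le hab] at hrm
        exact hr (by linarith [hrm.1]) (hrm.2.trans hb))
    rwa [abs_of_nonneg (sub_nonneg.2 hab)] at this
  have hmlip : ∀ᵐ x : UnitAddCircle, ∀ a b, s ≤ a → a ≤ b → b ≤ T →
      |m b x - m a x| ≤ C * (b - a) := by
    filter_upwards [hDlip] with x h1 a b ha hab hb
    have h2 := abs_max_sub_max_le_abs (D b x - M) (D a x - M) 0
    rw [sub_sub_sub_cancel_right] at h2
    exact h2.trans (h1 a b ha hab hb)
  have hm0 : ∀ a x, 0 ≤ m a x := fun a x => le_max_right _ _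
  have hms : ∀ᵐ x : UnitAddCircle, m s x = 0 := by
    filter_upwards [hinit] with x hx
    exact max_eq_right (by simp only [hD]; linarith)
  have hmR : ∀ᵐ x : UnitAddCircle, ∀ a, s ≤ a → a ≤ T → m a x ≤ R := by
    filter_upwards [hmlip, hms] with x h1 h2 a ha haT
    have h3 := (abs_le.1 (h1 s a le_rfl ha haT)).2
    rw [h2, sub_zero] at h3
    exact h3.trans (mul_le_mul_of_nonneg_left (by linarith) hC0)
  have hmi2 : ∀ a, s ≤ a → a ≤ T → Integrable (fun x => m a x ^ 2) volume := by
    intro a ha haT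
    refine Integrable.of_bound (C := R ^ 2) ((hmm a (hs.trans ha) haT).pow 2) ?_
    filter_upwards [hmR] with x hx
    rw [Real.norm_eq_abs, abs_of_nonneg (sq_nonneg _)]
    exact pow_le_pow_left₀ (hm0 a x) (hx a ha haT) 2
  have hIlip : ∀ a b, s ≤ a → a ≤ b → b ≤ T → |I b - I a| ≤ 2 * R * C * (b - a) := by
    intro a b ha hab hb
    simp only [hI]
    rw [← integral_sub (hmi2 b (ha.trans hab) hb) (hmi2 a ha (hab.trans hb)), ← Real.norm_eq_abs]
    have h1 := norm_integral_le_of_norm_le_const (μ := (volume : Measure UnitAddCircle))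
      (f := fun x => m b x ^ 2 - m a x ^ 2) (C := 2 * R * C * (b - a)) (by
        filter_upwards [hmR, hmlip] with x h1 h2
        rw [Real.norm_eq_abs, sq_sub_sq, abs_mul]
        have h3 := h1 a ha (hab.trans hb)
        have h4 := h1 b (ha.trans hab) hb
        have h5 : |m b x + m a x| ≤ 2 * R := by
          rw [abs_of_nonneg (add_nonneg (hm0 b x) (hm0 a x))]; linarith
        calc _ ≤ (2 * R) * (C * (b - a)) := mul_le_mul h5 (h2 a b ha hab hb) (abs_nonneg _)
              (by positivity)
          _ = _ := by ring)
    rwa [measureReal_def, UnitAddCircle.measure_univ, ENNReal.toReal_one, mul_one] at h1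
  set C' := 2 * C ^ 2 + 2 * κ * R * C with hC'
  -- The weight is first frozen at the end time `b`, then moved to the running time `r`, where the
  -- rate hypothesis applies, and finally the bound is moved to `a`. The time-Lipschitz bounds make
  -- these changes `O(b - a)` in the rate; `C'` collects them.
  have hstep : ∀ a b, s ≤ a → a ≤ b → b ≤ T → I b - I a ≤ (b - a) * (κ * I a + C' * (b - a)) := by
    intro a b ha hab hb
    have haT := hab.trans hb
    have hsb := ha.trans hab
    have hβab := hres a b (hs.trans ha) hb
    have hprod : Integrable (fun q : ℝ × UnitAddCircle => 2 * m b q.2 * β q)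
        ((volume.restrict (Ioc a b)).prod volume) := by
      refine hβab.bdd_mul (c := 2 * R) ?_ ?_
      · exact ((hmm b (hs.trans hsb) hb).const_mul 2).comp_snd
      · have : ∀ᵐ q ∂((volume.restrict (Ioc a b)).prod (volume : Measure UnitAddCircle)),
            m b q.2 ≤ R :=
          Measure.quasiMeasurePreserving_snd.ae (by
            filter_upwards [hmR] with x hx using hx b hsb hb)
        filter_upwards [this] with q hq
        rw [Real.norm_eq_abs, abs_of_nonneg (by linarith [hm0 b q.2])]
        linarith
    have h1 : I b - I a ≤ -∫ x, ∫ r in a..b, 2 * m b x * β (r, x) := by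
      simp only [hI]
      rw [← integral_sub (hmi2 b hsb hb) (hmi2 a ha haT), ← integral_neg]
      have hint : Integrable (fun x => -∫ r in a..b, 2 * m b x * β (r, x)) volume := by
        have := hprod.integral_prod_right.neg
        refine this.congr (Eventually.of_forall fun x => ?_)
        simp only [Pi.neg_apply, intervalIntegral.integral_of_le hab]
      refine integral_mono_ae ((hmi2 b hsb hb).sub (hmi2 a ha haT)) hint ?_
      filter_upwards [hDdiff] with x hx
      have h2 := hx a b ha hab hb
      rw [intervalIntegral.integral_const_mul, ← mul_neg, ← h2]
      -- Where the excess at time `b` is positive it equals `D b x - M`, and at time `a` it is at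
      -- least `D a x - M`. Combined with `m_b² - m_a² ≤ 2 m_b (m_b - m_a)`, this removes the
      -- positive parts from the increment.
      have h3 : m b x * (m b x - m a x) ≤ m b x * (D b x - D a x) := by
        rcases (hm0 b x).eq_or_lt with h | h
        · rw [← h, zero_mul, zero_mul]
        · refine mul_le_mul_of_nonneg_left ?_ h.le
          have h4 : m b x = D b x - M := by
            simp only [hm]
            refine max_eq_left ?_
            by_contra hcon
            simp only [hm, max_eq_right (not_le.1 hcon).le, lt_irrefl] at h
          have h5 : D a x - M ≤ m a x := le_max_left _ _
          linarith
      nlinarith [sq_nonneg (m b x - m a x)]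
    have h2 : ∫ x, ∫ r in a..b, 2 * m b x * β (r, x)
        = ∫ r in a..b, ∫ x, 2 * m b x * β (r, x) := by
      simp_rw [intervalIntegral.integral_of_le hab]
      exact (integral_integral_swap (f := fun r x => 2 * m b x * β (r, x)) hprod).symm
    have h3 : -∫ r in a..b, ∫ x, 2 * m b x * β (r, x)
        ≤ ∫ r in a..b, (κ * I a + C' * (b - a)) := by
      rw [← intervalIntegral.integral_neg]
      refine intervalIntegral.integral_mono_ae_restrict hab ?_ intervalIntegrable_const ?_
      · rw [intervalIntegrable_iff_integrableOn_Ioc_of_le hab]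
        exact hprod.integral_prod_left.neg
      · rw [EventuallyLE, ae_restrict_iff' measurableSet_Icc]
        have hslice : ∀ᵐ r, r ∈ Ioc a b → AEStronglyMeasurable (fun x => β (r, x)) volume := by
          have := hβab.prod_right_ae
          rw [ae_restrict_iff' measurableSet_Ioc] at this
          filter_upwards [this] with r hr hrm using (hr hrm).1
        have hne : ∀ᵐ r : ℝ, r ≠ a := by simp [ae_iff]
        filter_upwards [hrate, hC, hslice, hne] with r h3 h4 h5 hra hrm
        have har : a < r := lt_of_le_of_ne hrm.1 (Ne.symm hra)
        have hsr : s < r := by linarith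
        have hrT := hrm.2.trans hb
        have h6 := h3 hsr hrT
        have h7 := h4 hsr hrT
        have h8 := h5 ⟨har, hrm.2⟩
        have hmi : ∀ e, s ≤ e → e ≤ T → Integrable (fun x => 2 * m e x * β (r, x)) volume := by
          intro e he heT
          refine Integrable.of_bound (C := 2 * R * C)
            (((hmm e (hs.trans he) heT).const_mul 2).mul h8) ?_
          filter_upwards [hmR] with x hx
          rw [norm_mul, Real.norm_eq_abs, Real.norm_eq_abs,
            abs_of_nonneg (by linarith [hm0 e x])]
          exact mul_le_mul (by linarith [hx e he heT]) (h7 x) (abs_nonneg _) (by positivity)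
        have h9 : -∫ x, 2 * m b x * β (r, x) ≤ (-∫ x, 2 * m r x * β (r, x))
            + 2 * C ^ 2 * (b - a) := by
          have e1 : (∫ x, 2 * m r x * β (r, x)) - ∫ x, 2 * m b x * β (r, x)
              ≤ 2 * C ^ 2 * (b - a) := by
            rw [← integral_sub (hmi r hsr.le hrT) (hmi b hsb hb)]
            refine (le_abs_self _).trans ?_
            rw [← Real.norm_eq_abs]
            have e2 := norm_integral_le_of_norm_le_const
              (μ := (volume : Measure UnitAddCircle))
              (f := fun x => 2 * m r x * β (r, x) - 2 * m b x * β (r, x))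
              (C := 2 * C ^ 2 * (b - a)) (by
                filter_upwards [hmlip] with x hx
                have e3 := hx r b hsr.le hrm.2 hb
                have e4 : 2 * m r x * β (r, x) - 2 * m b x * β (r, x)
                    = -(2 * (m b x - m r x) * β (r, x)) := by ring
                rw [e4, norm_neg, norm_mul, norm_mul, Real.norm_eq_abs, Real.norm_eq_abs,
                  Real.norm_eq_abs, abs_two]
                have e5 : |m b x - m r x| ≤ C * (b - a) :=
                  e3.trans (mul_le_mul_of_nonneg_left (by linarith) hC0)
                calc _ ≤ 2 * (C * (b - a)) * C := by
                      have := sub_nonneg.2 hab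
                      gcongr
                      exact h7 x
                  _ = _ := by ring)
            rwa [measureReal_def, UnitAddCircle.measure_univ, ENNReal.toReal_one, mul_one] at e2
          linarith
        have h10 : I r ≤ I a + 2 * R * C * (b - a) := by
          have e1 := (abs_le.1 (hIlip a r ha har.le hrT)).2
          have e2 : 2 * R * C * (r - a) ≤ 2 * R * C * (b - a) :=
            mul_le_mul_of_nonneg_left (by linarith [hrm.2]) (by positivity)
          linarith
        have h11 := mul_le_mul_of_nonneg_left h10 hκ
        have h12 : -∫ x, 2 * m r x * β (r, x) ≤ κ * I r := h6
        rw [hC']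
        linarith
    rw [intervalIntegral.integral_const, smul_eq_mul] at h3
    rw [h2] at h1
    exact h1.trans h3
  have hIs : I s = 0 := by
    simp only [hI]
    rw [integral_eq_zero_of_ae]
    filter_upwards [hms] with x hx
    simp [hx]
  have hIc : ContinuousOn I (Icc s T) := by
    have : LipschitzOnWith (2 * R * C).toNNReal I (Icc s T) := by
      refine LipschitzOnWith.of_dist_le_mul fun a ha b hb => ?_
      rw [Real.coe_toNNReal _ (by positivity), Real.dist_eq, Real.dist_eq]
      rcases le_total a b with h | h
      · have := hIlip a b ha.1 h hb.2
        rwa [abs_sub_comm, abs_sub_comm a b, abs_of_nonneg (sub_nonneg.2 h)]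
      · have := hIlip b a hb.1 h ha.2
        rwa [abs_of_nonneg (a := a - b) (sub_nonneg.2 h)]
    exact this.continuousOn
  -- The one-sided Dini derivative is enough. The initial value and the inhomogeneity are zero, so
  -- the bound is zero for any `κ`.
  have hgr := le_gronwallBound_of_liminf_deriv_right_le (f := I) (f' := fun r => κ * I r)
    (δ := 0) (K := κ) (ε := 0) hIc (fun a ha r hr => by
      refine Eventually.frequently ?_
      have hlim : Tendsto (fun z => κ * I a + C' * (z - a)) (𝓝[>] a) (𝓝 (κ * I a)) := by
        have : Continuous (fun z => κ * I a + C' * (z - a)) := by fun_prop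
        have h := this.tendsto a
        rw [sub_self, mul_zero, add_zero] at h
        exact h.mono_left nhdsWithin_le_nhds
      filter_upwards [hlim.eventually (gt_mem_nhds hr), self_mem_nhdsWithin,
        nhdsWithin_le_nhds (Iio_mem_nhds ha.2)] with z h1 h2 h3
      have hza : 0 < z - a := sub_pos.2 h2
      rw [inv_mul_lt_iff₀ hza]
      refine (hstep a z ha.1 (le_of_lt h2) (le_of_lt h3)).trans_lt ?_
      exact mul_lt_mul_of_pos_left h1 hza) hIs.le (fun a _ => by simp) t ⟨hst, htT⟩
  have hzero : gronwallBound 0 κ 0 (t - s) = 0 := by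
    rcases eq_or_ne κ 0 with rfl | h
    · simp [gronwallBound]
    · simp [gronwallBound, h]
  rw [hzero] at hgr
  have hIt : ∫ x, m t x ^ 2 = 0 :=
    le_antisymm hgr (integral_nonneg fun x => sq_nonneg _)
  rw [integral_eq_zero_iff_of_nonneg (fun x => sq_nonneg _) (hmi2 t hst htT)] at hIt
  filter_upwards [hIt] with x hx
  have h1 : m t x = 0 := pow_eq_zero_iff two_ne_zero |>.1 hx
  have h2 : D t x - M ≤ m t x := le_max_left _ _
  have h3 : D t x ≤ M := by linarith
  exact h3

theorem exists_of_ae_of_lt {p : ℝ → Prop} {a b : ℝ} (hab : a < b) (h : ∀ᵐ t, p t) :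
    ∃ t, a < t ∧ t < b ∧ p t := by
  have h1 : (ae (volume.restrict (Ioo a b))).NeBot := by
    rw [ae_neBot, Ne, Measure.restrict_eq_zero, Real.volume_Ioo, ENNReal.ofReal_eq_zero]
    linarith
  obtain ⟨t, ht1, ht2⟩ := ((ae_restrict_of_ae h).and
    (ae_restrict_mem (μ := volume) (s := Ioo a b) measurableSet_Ioo)).exists
  exact ⟨t, ht2.1, ht2.2, ht1⟩

/-- A function on the circle is controlled by its integral and its oscillation at a small scale. -/
theorem abs_le_of_integral_abs_le {d : UnitAddCircle → ℝ} (hd : Continuous d) {δ ω η : ℝ}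
    (hδ : 0 < δ) (hδ1 : δ ≤ 1) (hω : ∀ a b : ℝ, |a - b| ≤ δ → |d a - d b| ≤ ω)
    (hη : ∫ x, |d x| ≤ δ * η) (x : ℝ) : |d x| ≤ ω + η := by
  have hdr : Continuous (fun y : ℝ => |d y|) :=
    (hd.comp isOpenQuotientMap_coe.continuous).abs
  have h1 : ∫ _ in x..(x + δ), |d x| ≤ ∫ y in x..(x + δ), (|d y| + ω) := by
    refine intervalIntegral.integral_mono_on (by linarith) intervalIntegrable_const
      ((hdr.add continuous_const).intervalIntegrable _ _) fun y hy => ?_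
    have h2 := hω x y (by rw [abs_sub_comm, abs_of_nonneg] <;> linarith [hy.1, hy.2])
    have h3 := abs_sub_abs_le_abs_sub (d x) (d y)
    linarith
  have h2 : ∫ y in x..(x + δ), |d y| ≤ ∫ x, |d x| := by
    have e := UnitAddCircle.intervalIntegral_preimage x (fun z => |d z|)
    rw [← e]
    refine intervalIntegral.integral_mono_interval le_rfl (by linarith) (by linarith)
      (Eventually.of_forall fun y => abs_nonneg _) (hdr.intervalIntegrable _ _)
  rw [intervalIntegral.integral_add (hdr.intervalIntegrable _ _) intervalIntegrable_const,
    intervalIntegral.integral_const, intervalIntegral.integral_const, smul_eq_mul, smul_eq_mul,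
    add_sub_cancel_left] at h1
  refine le_of_mul_le_mul_left ?_ hδ
  linarith

/-! ### Uniqueness of entropy solutions -/

/-- The time integral of the flux difference of two functions. -/
def fluxPotential (H : ℝ → UnitAddCircle → ℝ → ℝ) (t₀ : ℝ) (z₁ z₂ : ℝ → UnitAddCircle → ℝ)
    (t : ℝ) (x : UnitAddCircle) : ℝ :=
  -∫ r in t₀..t, (H r x (z₁ r x) - H r x (z₂ r x))

namespace IsEntropySolution

variable {H : ℝ → UnitAddCircle → ℝ → ℝ} {t₀ : ℝ} {z₁ z₂ : ℝ → UnitAddCircle → ℝ}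

theorem integrable_flux_sub (hz₁ : IsEntropySolution H t₀ z₁) (hz₂ : IsEntropySolution H t₀ z₂)
    (T : ℝ) : Integrable (fun q : ℝ × UnitAddCircle => H q.1 q.2 (z₁ q.1 q.2)
      - H q.1 q.2 (z₂ q.1 q.2)) ((volume.restrict (Ioc t₀ T)).prod volume) :=
  (integrableOn_of_locallyIntegrableOn_timeSpace hz₁.locallyIntegrable_flux T).sub
    (integrableOn_of_locallyIntegrableOn_timeSpace hz₂.locallyIntegrable_flux T)

theorem integrable_fluxPotential (hz₁ : IsEntropySolution H t₀ z₁)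
    (hz₂ : IsEntropySolution H t₀ z₂) {t : ℝ} (ht : t₀ ≤ t) :
    Integrable (fluxPotential H t₀ z₁ z₂ t) volume := by
  have := (integrable_flux_sub hz₁ hz₂ t).integral_prod_right.neg
  refine this.congr (Eventually.of_forall fun x => ?_)
  simp only [fluxPotential, Pi.neg_apply, intervalIntegral.integral_of_le ht]

theorem integral_abs_fluxPotential_le (hz₁ : IsEntropySolution H t₀ z₁)
    (hz₂ : IsEntropySolution H t₀ z₂) {t : ℝ} (ht : t₀ ≤ t) :
    ∫ x, |fluxPotential H t₀ z₁ z₂ t x|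
      ≤ ∫ r in t₀..t, ∫ x, |H r x (z₁ r x) - H r x (z₂ r x)| := by
  have hi := (integrable_flux_sub hz₁ hz₂ t).abs
  have h1 : ∫ r in t₀..t, ∫ x, |H r x (z₁ r x) - H r x (z₂ r x)|
      = ∫ x, ∫ r in t₀..t, |H r x (z₁ r x) - H r x (z₂ r x)| := by
    simp_rw [intervalIntegral.integral_of_le ht]
    exact integral_integral_swap (f := fun r x => |H r x (z₁ r x) - H r x (z₂ r x)|) hi
  rw [h1]
  refine integral_mono (integrable_fluxPotential hz₁ hz₂ ht).abs ?_ fun x => ?_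
  · refine hi.integral_prod_right.congr (Eventually.of_forall fun x => ?_)
    simp only [intervalIntegral.integral_of_le ht]
  · simp only [fluxPotential, abs_neg]
    exact intervalIntegral.abs_integral_le_integral_abs ht

/-- The weak form of the equation identifies the distributional derivative of the flux
potential. -/
theorem integral_fluxPotential_mul (hz₁ : IsEntropySolution H t₀ z₁)
    (hz₂ : IsEntropySolution H t₀ z₂) (hinit : z₁ t₀ =ᵐ[volume] z₂ t₀) {ψ : UnitAddCircle → ℝ}
    (hψ : ContDiff ℝ (⊤ : ℕ∞) (fun s : ℝ => ψ s)) :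
    ∀ᵐ t, t₀ < t → ∫ x, (z₁ t x - z₂ t x) * ψ x
      = -∫ x, fluxPotential H t₀ z₁ z₂ t x * circleDeriv ψ x := by
  have hψc : Continuous ψ := continuous_coinduced_dom.2 hψ.continuous
  have hψd := continuous_circleDeriv_of_contDiff hψ
  obtain ⟨C₁, hC₁⟩ := isCompact_univ.exists_bound_of_continuousOn hψc.continuousOn
  obtain ⟨C₂, hC₂⟩ := isCompact_univ.exists_bound_of_continuousOn hψd.continuousOn
  have hmulψ : ∀ f : UnitAddCircle → ℝ, Integrable f volume →
      Integrable (fun x => f x * ψ x) volume := fun f hf =>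
    hf.mul_bdd hψc.aestronglyMeasurable (Eventually.of_forall fun x => hC₁ x trivial)
  have hmulq : ∀ (T : ℝ) (f : ℝ × UnitAddCircle → ℝ),
      Integrable f ((volume.restrict (Ioc t₀ T)).prod volume) →
      Integrable (fun q => f q * circleDeriv ψ q.2) ((volume.restrict (Ioc t₀ T)).prod volume) :=
    fun T f hf => hf.mul_bdd (hψd.comp continuous_snd).aestronglyMeasurable
      (Eventually.of_forall fun q => hC₂ q.2 trivial)
  have h0 : ∫ x, z₁ t₀ x * ψ x = ∫ x, z₂ t₀ x * ψ x :=
    integral_congr_ae (by filter_upwards [hinit] with x hx; rw [hx])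
  filter_upwards [hz₁.ae_integral_mul hψ, hz₂.ae_integral_mul hψ] with t h1 h2 ht
  have e1 := h1 ht
  have e2 := h2 ht
  have i1 := hmulq t _ (integrableOn_of_locallyIntegrableOn_timeSpace
    hz₁.locallyIntegrable_flux t)
  have i2 := hmulq t _ (integrableOn_of_locallyIntegrableOn_timeSpace
    hz₂.locallyIntegrable_flux t)
  have i3 := hmulq t _ (integrable_flux_sub hz₁ hz₂ t)
  have e3 : ∫ x, (z₁ t x - z₂ t x) * ψ x = (∫ x, z₁ t x * ψ x) - ∫ x, z₂ t x * ψ x := by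
    rw [← integral_sub (hmulψ _ (hz₁.integrable_slice ht)) (hmulψ _ (hz₂.integrable_slice ht))]
    congr 1; funext x; ring
  have e4 : (∫ s in t₀..t, ∫ x, H s x (z₁ s x) * circleDeriv ψ x)
      - (∫ s in t₀..t, ∫ x, H s x (z₂ s x) * circleDeriv ψ x)
      = ∫ s in t₀..t, ∫ x, (H s x (z₁ s x) - H s x (z₂ s x)) * circleDeriv ψ x := by
    simp_rw [intervalIntegral.integral_of_le ht.le]
    rw [← integral_sub i1.integral_prod_left i2.integral_prod_left]
    refine integral_congr_ae ?_
    filter_upwards [i1.prod_right_ae, i2.prod_right_ae] with s hs1 hs2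
    rw [← integral_sub hs1 hs2]
    congr 1; funext x; ring
  have e5 : ∫ s in t₀..t, ∫ x, (H s x (z₁ s x) - H s x (z₂ s x)) * circleDeriv ψ x
      = ∫ x, ∫ s in t₀..t, (H s x (z₁ s x) - H s x (z₂ s x)) * circleDeriv ψ x := by
    simp_rw [intervalIntegral.integral_of_le ht.le]
    exact integral_integral_swap
      (f := fun s x => (H s x (z₁ s x) - H s x (z₂ s x)) * circleDeriv ψ x) i3
  rw [e3, e1, e2, h0, add_sub_add_left_eq_sub, e4, e5, ← integral_neg]
  congr 1; funext x
  rw [intervalIntegral.integral_mul_const, fluxPotential]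
  ring

/-- At almost every time, the flux potential is a Lipschitz primitive of the difference of the
two solutions. -/
theorem ae_exists_primitive (hz₁ : IsEntropySolution H t₀ z₁)
    (hz₂ : IsEntropySolution H t₀ z₂) (hinit : z₁ t₀ =ᵐ[volume] z₂ t₀) :
    ∀ᵐ t, t₀ < t → ∃ (d : UnitAddCircle → ℝ) (Λ : ℝ), (∀ x y : ℝ, |d x - d y| ≤ Λ * |x - y|) ∧
      (∀ᵐ x : ℝ, HasDerivAt (fun s : ℝ => d s) (z₁ t x - z₂ t x) x) ∧
      (∀ a b : ℝ, d b - d a = ∫ r in a..b, (z₁ t r - z₂ t r)) ∧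
      fluxPotential H t₀ z₁ z₂ t =ᵐ[volume] d := by
  -- The exceptional set of times depends on the test function; with countably many modes one null
  -- set serves for all of them.
  have hcos := ae_all_iff.2 fun n =>
    integral_fluxPotential_mul hz₁ hz₂ hinit (contDiff_cosMode n)
  have hsin := ae_all_iff.2 fun n =>
    integral_fluxPotential_mul hz₁ hz₂ hinit (contDiff_sinMode n)
  filter_upwards [hcos, hsin, hz₁.ae_integral_eq, hz₂.ae_integral_eq] with t h1 h2 h3 h4 ht
  have hζi : Integrable (fun x => z₁ t x - z₂ t x) volume :=
    (hz₁.integrable_slice ht).sub (hz₂.integrable_slice ht)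
  have hζ0 : ∫ x, (z₁ t x - z₂ t x) = 0 := by
    rw [integral_sub (hz₁.integrable_slice ht) (hz₂.integrable_slice ht), h3 ht, h4 ht,
      integral_congr_ae hinit, sub_self]
  obtain ⟨M₁, hM₁⟩ := hz₁.exists_abs_le_slice ht
  obtain ⟨M₂, hM₂⟩ := hz₂.exists_abs_le_slice ht
  have hlip := primitive_lipschitz hζi 0 (M := M₁ + M₂) (Eventually.of_forall fun x =>
    (abs_sub _ _).trans (add_le_add (hM₁ x) (hM₂ x)))
  set q : UnitAddCircle → ℝ := (primitive_periodic hζi hζ0).lift with hq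
  have hqc : ∀ x : ℝ, q x = primitive (fun x => z₁ t x - z₂ t x) 0 x := fun x =>
    Function.Periodic.lift_coe _ _
  have hqlip : ∀ x y : ℝ, |q x - q y| ≤ (M₁ + M₂ + |0|) * |x - y| := fun x y => by
    rw [hqc, hqc]; exact hlip x y
  have hqd : ∀ᵐ x : ℝ, HasDerivAt (fun s : ℝ => q s) (z₁ t x - z₂ t x) x := by
    filter_upwards [ae_hasDerivAt_primitive hζi 0] with x hx
    simp_rw [hqc]
    rwa [sub_zero] at hx
  have hΛ : 0 ≤ M₁ + M₂ + |0| := by simpa using (abs_nonneg _).trans (hqlip 1 0)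
  have hweak := isWeakDeriv_of_lipschitz hΛ hqlip hqd hζi
  have hqcont := continuous_circle_of_lipschitz hqlip
  have hPi := integrable_fluxPotential hz₁ hz₂ ht.le
  have hmode : ∀ ψ : UnitAddCircle → ℝ, ContDiff ℝ (⊤ : ℕ∞) (fun s : ℝ => ψ s) →
      (∫ x, (z₁ t x - z₂ t x) * ψ x = -∫ x, fluxPotential H t₀ z₁ z₂ t x * circleDeriv ψ x) →
      ∫ x, (fluxPotential H t₀ z₁ z₂ t x - q x) * circleDeriv ψ x = 0 := by
    intro ψ hψ h
    have hψd := continuous_circleDeriv_of_contDiff hψ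
    obtain ⟨C, hC⟩ := isCompact_univ.exists_bound_of_continuousOn hψd.continuousOn
    have hi : Integrable (fun x => q x * circleDeriv ψ x) volume :=
      integrable_of_continuous_circle (hqcont.mul hψd)
    simp_rw [sub_mul]
    rw [integral_sub (hPi.mul_bdd hψd.aestronglyMeasurable
      (Eventually.of_forall fun x => hC x trivial))
      hi, hweak.2.2 ψ hψ, h]
    ring
  have hconst := ae_eq_const_of_modes (hPi.sub hweak.1)
    (fun n => hmode _ (contDiff_cosMode n) (h1 n ht))
    (fun n => hmode _ (contDiff_sinMode n) (h2 n ht))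
  set k := ∫ x, (fluxPotential H t₀ z₁ z₂ t - q) x with hk
  refine ⟨fun x => q x + k, M₁ + M₂ + |0|, fun x y => ?_, ?_, fun a b => ?_, ?_⟩
  · rw [add_sub_add_right_eq_sub]; exact hqlip x y
  · filter_upwards [hqd] with x hx using hx.add_const k
  · have := primitive_sub hζi 0 a b
    simp only [sub_zero] at this
    rw [add_sub_add_right_eq_sub, hqc, hqc, this]
  · filter_upwards [hconst] with x hx
    have h5 : fluxPotential H t₀ z₁ z₂ t x - q x = k := hx
    linarith

/-- Smallness at the initial time of the difference of two solutions, in a weak sense. -/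
def InitiallyClose (t₀ : ℝ) (z₁ z₂ : ℝ → UnitAddCircle → ℝ) : Prop :=
  ∀ ε, 0 < ε → ∃ δ, 0 < δ ∧ δ ≤ 1 ∧ ∃ τ, t₀ < τ ∧ ∀ᵐ s, t₀ < s → s < τ → ∀ a b : ℝ,
    |a - b| ≤ δ → |∫ r in a..b, (z₁ s r - z₂ s r)| ≤ ε

/-- Integrability of the flux makes the potential small in `L¹` near the initial time. The
hypothesis of initial closeness bounds its oscillation at scale `δ`, and smallness in `L¹` relative
to `δ` then becomes uniform smallness. -/
theorem exists_abs_fluxPotential_le (hz₁ : IsEntropySolution H t₀ z₁)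
    (hz₂ : IsEntropySolution H t₀ z₂) (hinit : z₁ t₀ =ᵐ[volume] z₂ t₀)
    (hclose : InitiallyClose t₀ z₁ z₂) {ε τ : ℝ} (hε : 0 < ε) (hτ : t₀ < τ) :
    ∃ s, t₀ < s ∧ s < τ ∧ ∀ᵐ x, |fluxPotential H t₀ z₁ z₂ s x| ≤ ε := by
  obtain ⟨δ, hδ, hδ1, τ', hτ', hclose⟩ := hclose (ε / 2) (half_pos hε)
  have hint : IntervalIntegrable (fun r => ∫ x, |H r x (z₁ r x) - H r x (z₂ r x)|) volume
      t₀ τ := by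
    rw [intervalIntegrable_iff_integrableOn_Ioc_of_le hτ.le]
    exact (integrable_flux_sub hz₁ hz₂ τ).abs.integral_prod_left
  have hcont := intervalIntegral.continuousOn_primitive_interval' hint left_mem_uIcc
  rw [uIcc_of_le hτ.le] at hcont
  have h1 := hcont t₀ ⟨le_rfl, hτ.le⟩
  have h2 := Metric.continuousWithinAt_iff.1 h1 (δ * (ε / 2)) (by positivity)
  obtain ⟨ρ, hρ, h3⟩ := h2
  obtain ⟨s, hs1, hs2, h4, h5⟩ := exists_of_ae_of_lt
    (show t₀ < min (min τ τ') (t₀ + ρ) by simp only [lt_min_iff]; exact ⟨⟨hτ, hτ'⟩, by linarith⟩)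
    (hclose.and (ae_exists_primitive hz₁ hz₂ hinit))
  simp only [lt_min_iff] at hs2
  obtain ⟨d, Λ, hd1, -, hd3, hd4⟩ := h5 hs1
  refine ⟨s, hs1, hs2.1.1, ?_⟩
  have h6 := h3 (x := s) ⟨hs1.le, hs2.1.1.le⟩ (by
    rw [Real.dist_eq, abs_of_pos (by linarith)]; linarith)
  rw [intervalIntegral.integral_same, Real.dist_eq, sub_zero] at h6
  have h7 : ∫ x, |d x| ≤ δ * (ε / 2) := by
    have e1 : ∫ x, |d x| = ∫ x, |fluxPotential H t₀ z₁ z₂ s x| :=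
      integral_congr_ae (by filter_upwards [hd4] with x hx; rw [hx])
    rw [e1]
    exact (integral_abs_fluxPotential_le hz₁ hz₂ hs1.le).trans ((le_abs_self _).trans h6.le)
  have h8 := abs_le_of_integral_abs_le (continuous_circle_of_lipschitz hd1) hδ hδ1
    (ω := ε / 2) (fun a b hab => by
      rw [hd3 b a]
      exact h4 hs1 hs2.1.2 b a (by rwa [abs_sub_comm])) h7
  filter_upwards [hd4] with x hx
  obtain ⟨x, rfl⟩ := QuotientAddGroup.mk_surjective x
  rw [hx]
  exact (h8 x).trans (by linarith)

/-- The Oleinik constants may blow up at `t₀` too fast for Grönwall's inequality to start there. It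
is started at a time `s > t₀` at which the potential is already at most `ε`: the excess over `ε` is
then exactly zero and stays zero, however large the rate at `s`. -/
theorem ae_fluxPotential_le (hH : IsAdmissibleHamiltonian H) (hz₁ : IsEntropySolution H t₀ z₁)
    (hz₂ : IsEntropySolution H t₀ z₂) (hinit : z₁ t₀ =ᵐ[volume] z₂ t₀)
    (hclose : InitiallyClose t₀ z₁ z₂) {ε t : ℝ} (hε : 0 < ε) (ht : t₀ < t) :
    ∀ᵐ x, fluxPotential H t₀ z₁ z₂ t x ≤ ε := by
  obtain ⟨s, hs1, hs2, hs3⟩ := exists_abs_fluxPotential_le hz₁ hz₂ hinit hclose hε ht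
  obtain ⟨P₁, hP₁, hb₁⟩ := hz₁.ae_abs_le hs1
  obtain ⟨P₂, hP₂, hb₂⟩ := hz₂.ae_abs_le hs1
  obtain ⟨K₁, hK₁, hK₁a, ho₁⟩ := hz₁.oleinik
  obtain ⟨K₂, hK₂, hK₂a, ho₂⟩ := hz₂.oleinik
  have hk₁ := (hK₁ s hs1).le
  have hk₂ := (hK₂ s hs1).le
  obtain ⟨C, hC, hCb⟩ := hH.exists_abs_le (P₁ + P₂)
  obtain ⟨κ, hκ, hrate⟩ := exists_excess_bound hH (P₁ + P₂) (K₁ s + K₂ s) (by positivity)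
  refine ae_le_of_excess_bound (β := fun q => H q.1 q.2 (z₁ q.1 q.2) - H q.1 q.2 (z₂ q.1 q.2))
    (integrable_flux_sub hz₁ hz₂ t) hs1.le (C := C + C) ?_ (by positivity) hκ ?_ ?_ hs2.le le_rfl
  · filter_upwards [hb₁, hb₂] with r h1 h2 hr _ x
    exact (abs_sub _ _).trans (add_le_add
      (hCb _ _ _ ((h1 hr.le x).trans (by linarith)))
      (hCb _ _ _ ((h2 hr.le x).trans (by linarith))))
  · filter_upwards [hb₁, hb₂, ae_exists_primitive hz₁ hz₂ hinit] with r h1 h2 h3 hr _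
    have hr0 := hs1.trans hr
    obtain ⟨d, Λ, hd1, hd2, -, hd4⟩ := h3 hr0
    have key := hrate r ε Λ (z₁ r) (z₂ r) d (hz₁.measurable_slice hr0) (hz₂.measurable_slice hr0)
      (fun x => (h1 hr.le x).trans (by linarith)) (fun x => (h2 hr.le x).trans (by linarith))
      (fun x δ hδ => (ho₁ r hr0 x δ hδ).trans (mul_le_mul_of_nonneg_right (by
        linarith [hK₁a hs1 hr0 hr.le]) hδ.le))
      (fun x δ hδ => (ho₂ r hr0 x δ hδ).trans (mul_le_mul_of_nonneg_right (by
        linarith [hK₂a hs1 hr0 hr.le]) hδ.le)) hd1 hd2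
    have e1 : ∫ x, 2 * max (d x - ε) 0 * (H r x (z₁ r x) - H r x (z₂ r x))
        = ∫ x, 2 * max (fluxPotential H t₀ z₁ z₂ r x - ε) 0
          * (H r x (z₁ r x) - H r x (z₂ r x)) :=
      integral_congr_ae (by filter_upwards [hd4] with x hx; rw [hx])
    have e2 : ∫ x, max (d x - ε) 0 ^ 2 = ∫ x, max (fluxPotential H t₀ z₁ z₂ r x - ε) 0 ^ 2 :=
      integral_congr_ae (by filter_upwards [hd4] with x hx; rw [hx])
    rw [e1, e2] at key
    exact key
  · filter_upwards [hs3] with x hx using (abs_le.1 hx).2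

theorem InitiallyClose.symm {z₁ z₂ : ℝ → UnitAddCircle → ℝ} (h : InitiallyClose t₀ z₁ z₂) :
    InitiallyClose t₀ z₂ z₁ := by
  intro ε hε
  obtain ⟨δ, hδ, hδ1, τ, hτ, h1⟩ := h ε hε
  refine ⟨δ, hδ, hδ1, τ, hτ, ?_⟩
  filter_upwards [h1] with s hs h2 h3 a b hab
  have := hs h2 h3 a b hab
  rw [← abs_neg, ← intervalIntegral.integral_neg] at this
  simpa only [neg_sub] using this

/-- Uniqueness of entropy solutions at almost every time. -/
theorem ae_eq_of_initiallyClose (hH : IsAdmissibleHamiltonian H)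
    (hz₁ : IsEntropySolution H t₀ z₁) (hz₂ : IsEntropySolution H t₀ z₂)
    (hinit : z₁ t₀ =ᵐ[volume] z₂ t₀) (hclose : InitiallyClose t₀ z₁ z₂) :
    ∀ᵐ t, t₀ < t → z₁ t =ᵐ[volume] z₂ t := by
  have hneg : ∀ t x, fluxPotential H t₀ z₂ z₁ t x = -fluxPotential H t₀ z₁ z₂ t x := by
    intro t x
    rw [fluxPotential, fluxPotential, neg_neg, ← intervalIntegral.integral_neg]
    simp only [neg_sub]
  have hzero : ∀ t, t₀ < t → ∀ᵐ x, fluxPotential H t₀ z₁ z₂ t x = 0 := by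
    intro t ht
    have h1 : ∀ᵐ x, ∀ n : ℕ, |fluxPotential H t₀ z₁ z₂ t x| ≤ 1 / ((n:ℝ) + 1) := by
      refine ae_all_iff.2 fun n => ?_
      have hn : 0 < 1 / ((n:ℝ) + 1) := by positivity
      filter_upwards [ae_fluxPotential_le hH hz₁ hz₂ hinit hclose hn ht,
        ae_fluxPotential_le hH hz₂ hz₁ hinit.symm hclose.symm hn ht] with x h1 h2
      rw [hneg] at h2
      exact abs_le.2 ⟨by linarith, h1⟩
    filter_upwards [h1] with x hx
    exact abs_nonpos_iff.1 (ge_of_tendsto' tendsto_one_div_add_atTop_nhds_zero_nat hx)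
  filter_upwards [ae_exists_primitive hz₁ hz₂ hinit] with t h1 ht
  obtain ⟨d, Λ, hd1, hd2, -, hd4⟩ := h1 ht
  have hd0 : d = fun _ => 0 := by
    refine Continuous.ae_eq_iff_eq volume (continuous_circle_of_lipschitz hd1)
      continuous_const |>.1 ?_
    filter_upwards [hd4, hzero t ht] with x hx1 hx2
    rw [← hx1, hx2]
  refine ae_circle_of_ae ?_
  filter_upwards [hd2] with x hx
  simp only [hd0] at hx
  have := hx.unique (hasDerivAt_const x (0:ℝ))
  linarith

end IsEntropySolution

theorem abs_intervalIntegral_le_integral_abs {f : UnitAddCircle → ℝ} (hf : Integrable f volume)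
    {a b : ℝ} (hab : |a - b| ≤ 1) : |∫ r in a..b, f r| ≤ ∫ x, |f x| := by
  wlog h : a ≤ b generalizing a b
  · rw [intervalIntegral.integral_symm, abs_neg]
    exact this (by rwa [abs_sub_comm]) (not_le.1 h).le
  rw [abs_sub_comm, abs_of_nonneg (sub_nonneg.2 h)] at hab
  rw [← UnitAddCircle.intervalIntegral_preimage a (fun x => |f x|)]
  refine (intervalIntegral.abs_integral_le_integral_abs h).trans ?_
  exact intervalIntegral.integral_mono_interval le_rfl h (by linarith)
    (Eventually.of_forall fun y => abs_nonneg _) (intervalIntegrable_coe hf.abs _ _)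

theorem IsBoundedOn.exists_ae_abs_le {t₀ : ℝ} {z : ℝ → UnitAddCircle → ℝ} (hz : IsBoundedOn t₀ z) :
    ∃ M, 0 < M ∧ ∀ᵐ t, t₀ < t → ∀ᵐ x, |z t x| ≤ M := by
  obtain ⟨M, hM, h⟩ := exists_bound_of_memLp_top hz
  refine ⟨M, hM, ?_⟩
  rw [volume_restrict_timeSpace] at h
  have := Measure.ae_ae_of_ae_prod h
  rwa [ae_restrict_iff' measurableSet_Ioi] at this

namespace IsEntropySolution

variable {H : ℝ → UnitAddCircle → ℝ → ℝ} {t₀ : ℝ} {z₁ z₂ : ℝ → UnitAddCircle → ℝ}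

/-- The integral over an interval of length at most `1` is bounded by the `L¹` norm, so the scale `δ
= 1` works and only the time has to be close to `t₀`. -/
theorem initiallyClose_of_isContinuousL1 (hz₁ : IsEntropySolution H t₀ z₁)
    (hz₂ : IsEntropySolution H t₀ z₂) (hinit : z₁ t₀ =ᵐ[volume] z₂ t₀)
    (hc₁ : IsContinuousL1 t₀ z₁) (hc₂ : IsContinuousL1 t₀ z₂) : InitiallyClose t₀ z₁ z₂ := by
  intro ε hε
  have h1 := (hc₁.2 t₀ le_rfl).add (hc₂.2 t₀ le_rfl)
  rw [add_zero] at h1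
  have h2 := h1.eventually (gt_mem_nhds (ENNReal.ofReal_pos.2 hε))
  rw [eventually_nhdsWithin_iff] at h2
  obtain ⟨ρ, hρ, h3⟩ := Metric.eventually_nhds_iff.1 h2
  refine ⟨1, one_pos, le_rfl, t₀ + ρ, by linarith, Eventually.of_forall fun s hs hsρ a b hab => ?_⟩
  have hm₁ := hz₁.integrable_slice hs
  have hm₂ := hz₂.integrable_slice hs
  refine (abs_intervalIntegral_le_integral_abs (hm₁.sub hm₂) hab).trans ?_
  have h4 := h3 (y := s) (by rw [Real.dist_eq, abs_of_pos] <;> linarith) (mem_Ici.2 hs.le)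
  have h5 : eLpNorm (z₁ s - z₂ s) 1 volume ≤ ENNReal.ofReal ε := by
    have e1 : z₁ s - z₂ s =ᵐ[volume] (z₁ s - z₁ t₀) - (z₂ s - z₂ t₀) := by
      filter_upwards [hinit] with x hx
      simp only [Pi.sub_apply, hx]
      ring
    rw [eLpNorm_congr_ae e1]
    refine (eLpNorm_sub_le ?_ ?_ le_rfl).trans h4.le
    · exact hm₁.1.sub hz₁.integrable_init.1
    · exact hm₂.1.sub hz₂.integrable_init.1
  have h6 : ∫ x, |(z₁ s - z₂ s) x| = (eLpNorm (z₁ s - z₂ s) 1 volume).toReal := by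
    rw [eLpNorm_one_eq_lintegral_enorm, ← integral_norm_eq_lintegral_enorm (hm₁.sub hm₂).1]
    simp only [Real.norm_eq_abs]
  rw [h6]
  exact ENNReal.toReal_le_of_le_ofReal hε.le h5

/-- Boundedness gives smallness over short intervals at almost every time, with no information on
convergence at `t₀`; here the scale `δ` carries the estimate. -/
theorem initiallyClose_of_isBoundedOn (hb₁ : IsBoundedOn t₀ z₁) (hb₂ : IsBoundedOn t₀ z₂) :
    InitiallyClose t₀ z₁ z₂ := by
  intro ε hε
  obtain ⟨M₁, hM₁, h₁⟩ := hb₁.exists_ae_abs_le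
  obtain ⟨M₂, hM₂, h₂⟩ := hb₂.exists_ae_abs_le
  refine ⟨min 1 (ε / (M₁ + M₂)), by positivity, min_le_left _ _, t₀ + 1, by linarith, ?_⟩
  filter_upwards [h₁, h₂] with s hs1 hs2 hs _ a b hab
  have h3 := intervalIntegral.norm_integral_le_of_norm_le_const_ae (a := a) (b := b)
    (C := M₁ + M₂) (f := fun r : ℝ => z₁ s r - z₂ s r) (by
      filter_upwards [ae_of_ae_circle (hs1 hs), ae_of_ae_circle (hs2 hs)] with r hr1 hr2 _
      exact (abs_sub _ _).trans (add_le_add hr1 hr2))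
  refine h3.trans ?_
  rw [abs_sub_comm]
  have h4 := mul_le_mul_of_nonneg_left (hab.trans (min_le_right _ _))
    (show 0 ≤ M₁ + M₂ by positivity)
  refine h4.trans_eq ?_
  field_simp

/-- Uniqueness of entropy solutions which are continuous in time with values in `L¹`. -/
theorem eq_of_isContinuousL1 (hH : IsAdmissibleHamiltonian H)
    (hz₁ : IsEntropySolution H t₀ z₁) (hz₂ : IsEntropySolution H t₀ z₂)
    (hinit : z₁ t₀ =ᵐ[volume] z₂ t₀) (hc₁ : IsContinuousL1 t₀ z₁) (hc₂ : IsContinuousL1 t₀ z₂)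
    {t : ℝ} (ht : t₀ ≤ t) : z₁ t =ᵐ[volume] z₂ t := by
  have hae := ae_eq_of_initiallyClose hH hz₁ hz₂ hinit
    (initiallyClose_of_isContinuousL1 hz₁ hz₂ hinit hc₁ hc₂)
  have h0 : eLpNorm (z₁ t - z₂ t) 1 volume = 0 := by
    refine le_antisymm (le_of_forall_pos_le_add fun ε hε => ?_) zero_le
    have h1 := (hc₁.2 t ht).add (hc₂.2 t ht)
    rw [add_zero] at h1
    have h2 := h1.eventually (gt_mem_nhds hε)
    rw [eventually_nhdsWithin_iff] at h2
    obtain ⟨ρ, hρ, h3⟩ := Metric.eventually_nhds_iff.1 h2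
    -- Equality holds at almost every time, so there are such times just after `t`, and continuity
    -- in `L¹` extends the equality to `t`.
    obtain ⟨s, hs1, hs2, hs3⟩ := exists_of_ae_of_lt (show t < t + ρ by linarith) hae
    have h4 := h3 (y := s) (by rw [Real.dist_eq, abs_of_pos] <;> linarith)
      (mem_Ici.2 (ht.trans hs1.le))
    have e1 : z₁ t - z₂ t =ᵐ[volume] (z₂ s - z₂ t) - (z₁ s - z₁ t) := by
      filter_upwards [hs3 (ht.trans_lt hs1)] with x hx
      simp only [Pi.sub_apply, hx]
      ring
    have hs0 := ht.trans hs1.le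
    rw [zero_add, eLpNorm_congr_ae e1]
    refine (eLpNorm_sub_le ((hc₂.1 s hs0).1.sub (hc₂.1 t ht).1)
      ((hc₁.1 s hs0).1.sub (hc₁.1 t ht).1) le_rfl).trans ?_
    rw [add_comm]
    exact h4.le
  rw [eLpNorm_eq_zero_iff ((hc₁.1 t ht).1.sub (hc₂.1 t ht).1) one_ne_zero] at h0
  filter_upwards [h0] with x hx
  exact sub_eq_zero.1 hx

/-- Uniqueness of bounded entropy solutions. -/
theorem ae_eq_of_isBoundedOn (hH : IsAdmissibleHamiltonian H)
    (hz₁ : IsEntropySolution H t₀ z₁) (hz₂ : IsEntropySolution H t₀ z₂)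
    (hinit : z₁ t₀ =ᵐ[volume] z₂ t₀) (hb₁ : IsBoundedOn t₀ z₁) (hb₂ : IsBoundedOn t₀ z₂) :
    ∀ᵐ q : ℝ × UnitAddCircle ∂(volume.restrict (timeSpace t₀)), z₁ q.1 q.2 = z₂ q.1 q.2 := by
  have hae := ae_eq_of_initiallyClose hH hz₁ hz₂ hinit (initiallyClose_of_isBoundedOn hb₁ hb₂)
  have m₁ := hb₁.1
  have m₂ := hb₂.1
  rw [volume_restrict_timeSpace] at m₁ m₂ ⊢
  refine ae_prod_of_ae_ae (nullMeasurableSet_eq_fun m₁.aemeasurable m₂.aemeasurable) ?_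
  rw [ae_restrict_iff' measurableSet_Ioi]
  filter_upwards [hae] with t ht h1 using ht h1

end IsEntropySolution

/-! ### Uniqueness of the viscosity solution and conclusion -/

/-- Uniqueness of viscosity solutions, one of which is Lipschitz in space. -/
theorem IsViscositySolution.eq_of_lipschitz {H : ℝ → UnitAddCircle → ℝ → ℝ} {c t₀ Λ : ℝ}
    {v w : ℝ → UnitAddCircle → ℝ} (hH : IsAdmissibleHamiltonian H)
    (hv : IsViscositySolution H c t₀ v) (hw : IsViscositySolution H c t₀ w)
    (hinit : ∀ x : ℝ, v t₀ x = w t₀ x)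
    (hlip : ∀ t, t₀ ≤ t → ∀ x y : ℝ, |w t x - w t y| ≤ Λ * |x - y|) {t : ℝ} (ht : t₀ ≤ t)
    (x : UnitAddCircle) : v t x = w t x := by
  have hcont : ∀ u : ℝ → UnitAddCircle → ℝ, IsViscositySolution H c t₀ u →
      ContinuousOn (fun q : ℝ × ℝ => u q.1 (q.2 : UnitAddCircle)) (Ici t₀ ×ˢ univ) :=
    fun u hu => hu.continuousOn.comp
      (continuous_fst.prodMk (isOpenQuotientMap_coe.continuous.comp continuous_snd)).continuousOn
      fun q hq => ⟨hq.1, trivial⟩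
  obtain ⟨x, rfl⟩ := QuotientAddGroup.mk_surjective x
  refine le_antisymm ?_ ?_
  · exact (hH.isTonelli c).comparison (u := fun t x => v t x) (v := fun t x => w t x)
      hv.subsolution hw.supersolution (hcont v hv) (hcont w hw)
      (fun t _ => coe_periodic (v t)) (fun t _ => coe_periodic (w t)) (Or.inr hlip)
      (fun x => (hinit x).le) t x ht
  · exact (hH.isTonelli c).comparison (u := fun t x => w t x) (v := fun t x => v t x)
      hw.subsolution hv.supersolution (hcont w hw) (hcont v hv)
      (fun t _ => coe_periodic (w t)) (fun t _ => coe_periodic (v t)) (Or.inl hlip)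
      (fun x => (hinit x).ge) t x ht

end BurgersCircle

end

theorem mainTheorem5 (H : ℝ → UnitAddCircle → ℝ → ℝ)
    (hH : BurgersCircle.IsAdmissibleHamiltonian H)
    (t₀ : ℝ) (y₀ : UnitAddCircle → ℝ) (hy₀ : MemLp y₀ ⊤ (volume : Measure UnitAddCircle)) :
    ∃ y : ℝ → UnitAddCircle → ℝ,
      -- existence, in `L^∞ ∩ C([t₀,∞), L¹)`
      (BurgersCircle.IsEntropySolution H t₀ y ∧ y t₀ =ᵐ[volume] y₀ ∧
        BurgersCircle.IsBoundedOn t₀ y ∧ BurgersCircle.IsContinuousL1 t₀ y) ∧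
      -- uniqueness in `C([t₀,∞), L¹)`
      (∀ z : ℝ → UnitAddCircle → ℝ,
        BurgersCircle.IsEntropySolution H t₀ z → z t₀ =ᵐ[volume] y₀ →
        BurgersCircle.IsContinuousL1 t₀ z → ∀ t, t₀ ≤ t → z t =ᵐ[volume] y t) ∧
      -- uniqueness in `L^∞`
      (∀ z : ℝ → UnitAddCircle → ℝ,
        BurgersCircle.IsEntropySolution H t₀ z → z t₀ =ᵐ[volume] y₀ →
        BurgersCircle.IsBoundedOn t₀ z →
        ∀ᵐ q : ℝ × UnitAddCircle ∂(volume.restrict (BurgersCircle.timeSpace t₀)),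
          z q.1 q.2 = y q.1 q.2) ∧
      -- the unique viscosity solution with datum `∫₀ˣ (y₀ - c)`, and `y = c + ∂ₓ u`
      ∃ u : ℝ → UnitAddCircle → ℝ,
        (BurgersCircle.IsViscositySolution H (∫ r : UnitAddCircle, y₀ r) t₀ u ∧
          ∀ x : ℝ, u t₀ (x : UnitAddCircle) =
            ∫ s in (0 : ℝ)..x, (y₀ (s : UnitAddCircle) - ∫ r : UnitAddCircle, y₀ r)) ∧
        (∀ v : ℝ → UnitAddCircle → ℝ,
          BurgersCircle.IsViscositySolution H (∫ r : UnitAddCircle, y₀ r) t₀ v →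
          (∀ x : ℝ, v t₀ (x : UnitAddCircle) =
            ∫ s in (0 : ℝ)..x, (y₀ (s : UnitAddCircle) - ∫ r : UnitAddCircle, y₀ r)) →
          ∀ t, t₀ ≤ t → ∀ x : UnitAddCircle, v t x = u t x) ∧
        ∀ t, t₀ ≤ t → BurgersCircle.IsWeakDeriv (u t)
          (fun x => y t x - ∫ r : UnitAddCircle, y₀ r) := by
  obtain ⟨Λ, w, y, hp⟩ := BurgersCircle.exists_isEntropyPair hH t₀ hy₀ rfl
  have hy := hp.isEntropySolution hH
  have hyc := hp.isContinuousL1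
  have hw := hp.lax.isViscositySolution hp.continuous
  refine ⟨y, ⟨hy, by rw [hp.init], hp.isBoundedOn, hyc⟩, ?_, ?_, w, ⟨hw, hp.lax.init⟩, ?_, ?_⟩
  · intro z hz hz₀ hzc t ht
    exact hz.eq_of_isContinuousL1 hH hy (by rwa [hp.init]) hzc hyc ht
  · intro z hz hz₀ hzb
    exact hz.ae_eq_of_isBoundedOn hH hy (by rwa [hp.init]) hzb hp.isBoundedOn
  · intro v hv hv₀ t ht x
    refine hv.eq_of_lipschitz hH hw (fun x => ?_) hp.lax.lip ht x
    rw [hv₀ x]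
    exact (hp.lax.init x).symm
  · intro t ht
    exact hp.isWeakDeriv ht
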